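/- Let $k$ be an algebraically closed field, let $X$ be a smooth projective (integral) curve over $k$, and let $\mathcal{P}(X)$ be the category of vector bundles over $X$ (locally free sheaves of finite rank, a full subcategory of the category of $\mathcal{O}_X$-modules); its exact sequences are the sequences of vector bundles that are short exact as sequences of $\mathcal{O}_X$-modules. The slope of a non-zero vector bundle $E$ is $\mu(E)=\deg(E)/\operatorname{rank}(E)$, and $E$ is semi-stable if $\mu(E')\le\mu(E)$ for every non-zero proper sub-bundle $E'$ of $E$. If $$0=E_0\subsetneq E_1\subsetneq\cdots\subsetneq E_s=E$$ is the Harder–Narasimhan filtration of a non-zero vector bundle $E$ (the quotients $F_i=E_i/E_{i-1}$ are semi-stable vector bundles with $\mu(F_1)>\cdots>\mu(F_s)$), put $\mu_{\max}(E)=\mu(F_1)$ and $\mu_{\min}(E)=\mu(F_s)$. Let $I\subset\mathbb{R}$ be an interval (of any kind, possibly of length zero), and let $\mathcal{P}(I)$ be the full subcategory of $\mathcal{P}(X)$ consisting of the zero bundle and of all non-zero vector bundles $E$ with $\mu_{\max}(E),\mu_{\min}(E)\in I$. Then $\mathcal{P}(I)$ is closed under extensions in $\mathcal{P}(X)$: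 if $0\to E'\to E\to E''\to 0$ is a short exact sequence in $\mathcal{P}(X)$ with $E',E''\in\mathcal{P}(I)$, then $E\in\mathcal{P}(I)$. Moreover, $\mathcal{P}(I)$ is an exact category in the sense of Quillen, whose exact sequences are the short exact sequences of $\mathcal{P}(X)$ with all terms in $\mathcal{P}(I)$. -/

import Mathlib

open CategoryTheory CategoryTheory.Limits AlgebraicGeometry

universe u v w

namespace HNExact

/-! ### Smooth projective curves -/

attribute [local instance] MvPolynomial.gradedAlgebra

/-- Projective `n`-space over `k`: `Proj` of the polynomial ring in `n + 1` variables, graded by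
total degree. -/
noncomputable def projectiveSpace (k : Type u) [Field k] (n : ℕ) : Scheme.{u} :=
  Proj (MvPolynomial.homogeneousSubmodule (Fin (n + 1)) k)

/-- The structure morphism of projective `n`-space over `k`. -/
noncomputable def projectiveSpaceHom (k : Type u) [Field k] (n : ℕ) :
    projectiveSpace k n ⟶ Spec (.of k) :=
  Proj.toSpecZero (MvPolynomial.homogeneousSubmodule (Fin (n + 1)) k) ≫
    Spec.map (CommRingCat.ofHom
      (algebraMap k (MvPolynomial.homogeneousSubmodule (Fin (n + 1)) k 0)))

/-- A smooth projective curve over `k`: an integral scheme over `k`, smooth of relative dimension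
`1`, which admits a closed immersion over `k` into some projective space. -/
structure SmoothProjectiveCurve (k : Type u) [Field k] where
  /-- the underlying scheme -/
  X : Scheme.{u}
  /-- the structure morphism -/
  hom : X ⟶ Spec (.of k)
  isIntegral : IsIntegral X
  smooth : SmoothOfRelativeDimension 1 hom
  projective : ∃ (n : ℕ) (i : X ⟶ projectiveSpace k n),
    IsClosedImmersion i ∧ i ≫ projectiveSpaceHom k n = hom

attribute [instance] SmoothProjectiveCurve.isIntegral SmoothProjectiveCurve.smooth

instance {k : Type u} [Field k] (C : SmoothProjectiveCurve k) : IsLocallyNoetherian C.X :=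
  have : Smooth C.hom := SmoothOfRelativeDimension.smooth 1 C.hom
  LocallyOfFiniteType.isLocallyNoetherian C.hom

/-! ### Vector bundles, rank and degree -/

section VectorBundles

variable {X : Scheme.{u}}

/-- Restriction of sections of an `𝒪_X`-module. -/
noncomputable def res (E : X.Modules) {U V : X.Opens} (h : V ≤ U) (m : Γ(E, U)) : Γ(E, V) :=
  E.presheaf.map (homOfLE h).op m

/-- A frame of length `r` of the `𝒪_X`-module `E` over the open set `U`: sections
`e₁, …, e_r` of `E` over `U` such that over every open `V ⊆ U` each section of `E` is an
`𝒪_X(V)`-linear combination of `e₁|_V, …, e_r|_V` in a unique way. In other words, the morphism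
`𝒪_U ^ r ⟶ E|_U` given by the `eᵢ` is an isomorphism. -/
structure LocalFrame (E : X.Modules) (r : ℕ) (U : X.Opens) where
  /-- the sections of the frame -/
  sec : Fin r → Γ(E, U)
  existsUnique : ∀ (V : X.Opens) (h : V ≤ U) (m : Γ(E, V)),
    ∃! c : Fin r → Γ(X, V), m = ∑ i, c i • res E h (sec i)

/-- A choice, for every point of `X`, of a frame of length `r` of `E` over an open neighbourhood
of that point. -/
structure FrameAtlas (E : X.Modules) (r : ℕ) where
  /-- the neighbourhood of a point -/
  nhd : X → X.Opens
  mem_nhd : ∀ x, x ∈ nhd x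
  /-- the frame on that neighbourhood -/
  frame : ∀ x, LocalFrame E r (nhd x)

/-- `E` is locally free of rank `r`. -/
def HasRank (E : X.Modules) (r : ℕ) : Prop := Nonempty (FrameAtlas E r)

/-- Vector bundles, as locally free sheaves of finite rank. (The schemes considered are connected,
so that the rank is constant.) -/
def IsVectorBundle : ObjectProperty X.Modules := fun E => ∃ r, HasRank E r

/-- A monomorphism `i : F ⟶ E` of vector bundles is a sub-bundle if the quotient is a vector
bundle. -/
def IsSubbundle {F E : X.Modules} (i : F ⟶ E) : Prop :=
  Mono i ∧ IsVectorBundle F ∧ IsVectorBundle (cokernel i)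

variable (X) in
/-- The category `𝒫(X)` of vector bundles over `X`, a full subcategory of the abelian category of
`𝒪_X`-modules. -/
abbrev VectorBundle := (IsVectorBundle (X := X)).FullSubcategory

/-- The short exact sequences `0 ⟶ E' ⟶ E ⟶ E'' ⟶ 0` of `𝒫(X)`: they are those sequences of vector
bundles which are short exact as sequences of `𝒪_X`-modules. -/
def vectorBundleExact : ObjectProperty (ShortComplex (VectorBundle X)) :=
  fun S => (S.map (IsVectorBundle (X := X)).ι).ShortExact

open Classical in
/-- The rank of a vector bundle. -/
noncomputable def rank (E : X.Modules) : ℕ := if h : IsVectorBundle E then h.choose else 0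

/-- The matrix over `𝒪_X(U ∩ V)` which expresses the frame `s` in terms of the frame `t`:
`s j = ∑ i, (transition s t) i j • t i` on `U ∩ V`. -/
noncomputable def LocalFrame.transition {E : X.Modules} {r : ℕ} {U V : X.Opens}
    (s : LocalFrame E r U) (t : LocalFrame E r V) : Matrix (Fin r) (Fin r) Γ(X, U ⊓ V) :=
  Matrix.of fun i j =>
    (t.existsUnique (U ⊓ V) inf_le_right (res E inf_le_left (s.sec j))).choose i

variable [IsIntegral X]

lemma genericPoint_mem {U : X.Opens} {x : X} (hx : x ∈ U) : genericPoint X ∈ U :=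
  ((genericPoint_spec X).mem_open_set_iff U.isOpen).mpr ⟨x, trivial, hx⟩

variable [IsLocallyNoetherian X]

/-- The frame `s` of `E` at the generic point gives the rational section `s₁ ∧ ⋯ ∧ s_r` of the line
bundle `det E`. Near a point `x`, this section is `det (transition s t)` times the local generator
`t₁ ∧ ⋯ ∧ t_r`, for a frame `t` of `E` at `x`. Hence the integer below is its order of vanishing
at `x` (it is `0` at the generic point). -/
noncomputable def FrameAtlas.ordDet {E : X.Modules} {r : ℕ} (A : FrameAtlas E r) (x : X) : ℤ :=
  X.ord (X.presheaf.germ _ (genericPoint X)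
    (show genericPoint X ∈ A.nhd (genericPoint X) ⊓ A.nhd x from
      ⟨A.mem_nhd _, genericPoint_mem (A.mem_nhd x)⟩)
    ((A.frame (genericPoint X)).transition (A.frame x)).det) x

/-- The degree of the divisor of the rational section of `det E` given by the frame at the generic
point. Over an algebraically closed field every closed point of a curve has degree `1`. -/
noncomputable def FrameAtlas.degree {E : X.Modules} {r : ℕ} (A : FrameAtlas E r) : ℤ :=
  ∑ᶠ x : X, A.ordDet x

open Classical in
/-- The degree of a vector bundle `E` on a smooth projective curve over an algebraically closed
field: the degree of the divisor of a non-zero rational section of `det E`. -/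
noncomputable def degree (E : X.Modules) : ℤ :=
  if h : IsVectorBundle E then h.choose_spec.some.degree else 0

/-- The slope `deg E / rank E` (of a non-zero vector bundle). -/
noncomputable def slope (E : X.Modules) : ℝ := (degree E : ℝ) / (rank E : ℝ)

/-! ### Semi-stability and Harder–Narasimhan filtrations -/

/-- A vector bundle is semi-stable if `μ(F) ≤ μ(E)` for every non-zero proper sub-bundle `F`. -/
def IsSemistable (E : X.Modules) : Prop :=
  IsVectorBundle E ∧ ∀ (F : X.Modules) (i : F ⟶ E), IsSubbundle i → ¬ IsZero F → ¬ IsIso i →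
    slope F ≤ slope E

/-- A Harder–Narasimhan filtration of a (necessarily non-zero) vector bundle, with `n + 1` steps:
`0 = E₀ ⊊ E₁ ⊊ ⋯ ⊊ E_{n+1} = E` with semi-stable quotients `F_i = E_{i+1} / E_i` (`0 ≤ i ≤ n`)
such that `μ(F₀) > μ(F₁) > ⋯ > μ(F_n)`. -/
structure HNFiltration (E : X.Modules) where
  /-- the number of steps minus one -/
  n : ℕ
  /-- the terms of the filtration -/
  sub : Fin (n + 2) → Subobject E
  strictMono : StrictMono sub
  sub_zero : sub 0 = ⊥
  sub_last : sub (Fin.last (n + 1)) = ⊤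
  semistable : ∀ i : Fin (n + 1), IsSemistable
    (cokernel ((sub i.castSucc).ofLE (sub i.succ) (strictMono.monotone i.castSucc_le_succ)))
  slope_anti : StrictAnti fun i : Fin (n + 1) => slope
    (cokernel ((sub i.castSucc).ofLE (sub i.succ) (strictMono.monotone i.castSucc_le_succ)))

namespace HNFiltration

variable {E : X.Modules} (H : HNFiltration E)

/-- The successive quotients of the filtration. -/
noncomputable def quot (i : Fin (H.n + 1)) : X.Modules :=
  cokernel ((H.sub i.castSucc).ofLE (H.sub i.succ) (H.strictMono.monotone i.castSucc_le_succ))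

/-- `μ_max(E)`, the slope of the first quotient. -/
noncomputable def muMax : ℝ := slope (H.quot 0)

/-- `μ_min(E)`, the slope of the last quotient. -/
noncomputable def muMin : ℝ := slope (H.quot (Fin.last H.n))

end HNFiltration

variable (X) in
/-- The full subcategory `𝒫(I)` of `𝒫(X)`: it consists of the vector bundles `E` with
`μ_max(E), μ_min(E) ∈ I`, and of the zero bundle (for which `μ_max` and `μ_min` are not defined). -/
def slopesIn (I : Set ℝ) : ObjectProperty (VectorBundle X) := fun E =>
  IsZero E.obj ∨ ∃ H : HNFiltration E.obj, H.muMax ∈ I ∧ H.muMin ∈ I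

end VectorBundles

/-! ### Exact categories -/

section ExactCategories

variable {A : Type v} [Category.{w} A] [Preadditive A]

/-- The admissible monomorphisms of a class `ℰ` of sequences `M' ⟶ M ⟶ M''`: the morphisms
`M' ⟶ M` which occur as first morphism. -/
def AdmissibleMono (ℰ : ObjectProperty (ShortComplex A)) : MorphismProperty A := fun _ M i =>
  ∃ (M'' : A) (j : M ⟶ M'') (h : i ≫ j = 0), ℰ (ShortComplex.mk i j h)

/-- The admissible epimorphisms of a class `ℰ` of sequences `M' ⟶ M ⟶ M''`: the morphisms
`M ⟶ M''` which occur as second morphism. -/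
def AdmissibleEpi (ℰ : ObjectProperty (ShortComplex A)) : MorphismProperty A := fun M _ j =>
  ∃ (M' : A) (i : M' ⟶ M) (h : i ≫ j = 0), ℰ (ShortComplex.mk i j h)

/-- The additive category `A` together with the class `ℰ` of sequences is an exact category in the
sense of Quillen. -/
structure IsExactCategory (ℰ : ObjectProperty (ShortComplex A)) : Prop where
  /-- `A` is additive -/
  hasFiniteBiproducts : HasFiniteBiproducts A
  /-- `ℰ` is closed under isomorphisms of sequences -/
  of_iso : ∀ {S T : ShortComplex A}, (S ≅ T) → ℰ S → ℰ T
  /-- `ℰ` contains the split sequences `0 ⟶ M' ⟶ M' ⊕ M'' ⟶ M'' ⟶ 0` -/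
  of_splitting : ∀ S : ShortComplex A, Nonempty S.Splitting → ℰ S
  /-- in a sequence of `ℰ` the first morphism is a kernel of the second one -/
  isKernel : ∀ S : ShortComplex A, ℰ S → Nonempty (IsLimit (KernelFork.ofι S.f S.zero))
  /-- in a sequence of `ℰ` the second morphism is a cokernel of the first one -/
  isCokernel : ∀ S : ShortComplex A, ℰ S → Nonempty (IsColimit (CokernelCofork.ofπ S.g S.zero))
  epi_comp : ∀ {L M N : A} (p : L ⟶ M) (q : M ⟶ N),
    AdmissibleEpi ℰ p → AdmissibleEpi ℰ q → AdmissibleEpi ℰ (p ≫ q)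
  mono_comp : ∀ {L M N : A} (i : L ⟶ M) (j : M ⟶ N),
    AdmissibleMono ℰ i → AdmissibleMono ℰ j → AdmissibleMono ℰ (i ≫ j)
  /-- base change of admissible epimorphisms along arbitrary morphisms -/
  epi_baseChange : ∀ {M M'' N : A} (p : M ⟶ M'') (f : N ⟶ M''), AdmissibleEpi ℰ p →
    ∃ (P : A) (f' : P ⟶ M) (p' : P ⟶ N), IsPullback f' p' p f ∧ AdmissibleEpi ℰ p'
  /-- cobase change of admissible monomorphisms along arbitrary morphisms -/
  mono_cobaseChange : ∀ {M' M N : A} (i : M' ⟶ M) (f : M' ⟶ N), AdmissibleMono ℰ i →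
    ∃ (P : A) (f' : M ⟶ P) (i' : N ⟶ P), IsPushout i f f' i' ∧ AdmissibleMono ℰ i'
  /-- a morphism which has a kernel is an admissible epimorphism if some composition `p ≫ q` is -/
  epi_of_comp : ∀ {L M N : A} (p : L ⟶ M) (q : M ⟶ N), HasKernel q →
    AdmissibleEpi ℰ (p ≫ q) → AdmissibleEpi ℰ q
  /-- a morphism which has a cokernel is an admissible monomorphism if some composition is -/
  mono_of_comp : ∀ {L M N : A} (i : L ⟶ M) (j : M ⟶ N), HasCokernel i →
    AdmissibleMono ℰ (i ≫ j) → AdmissibleMono ℰ i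

end ExactCategories

end HNExact

/-!
# Bundles with Harder–Narasimhan slopes in an interval form an exact category

*Slopes.* For a non-zero vector bundle `E` on the curve and an order-connected set `I`, membership of
`E` in `𝒫(I)` means that there are `a, b ∈ I` such that every vector bundle `K` contained in `E`
satisfies `deg K ≤ b * rk K` (`SubDegreeLE`) and `deg E - deg K ≥ a * (rk E - rk K)`
(`QuotDegreeGE`); see `slopesIn_iff`. Both conditions are inherited by extensions, because `K` is then
itself an extension of bundles contained in the two ends, and degree and rank are additive. One
direction of the equivalence applies this to the filtration, using that its quotients are
semi-stable. The other direction needs a Harder–Narasimhan filtration to exist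
(`nonempty_hnFiltration`): slopes of bundles contained in `E` are bounded above
(`exists_subDegreeLE`), hence there is a quotient bundle of minimal slope, and of maximal rank among
those, which is semi-stable, and induction applies to its kernel.

*Bundles on a curve.* The local rings of the curve are principal ideal domains
(`isPrincipalIdealRing_stalk`), since by smoothness their differentials are generated by one element.
Therefore saturated subobjects of bundles are sub-bundles (`IsSaturated.exists_hasRank`); this
applies to kernels of morphisms of bundles and to the saturation of a subobject.

*Degree.* The degree, defined by determinants of transition matrices to a frame at the generic point,
is independent of the frames, monotone for monomorphisms of bundles of equal rank
(`degree_le_of_mono`), and additive (`degree_add`). The first two rest on the fact that a principal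
divisor has degree zero (`finsum_ord_eq_zero`). For this, a non-constant rational function `t` gives
a finite morphism to the affine line from the open set where it has no poles: its graph is closed in
the product of the line with the curve, which is proper over the line, and its fibres are finite.
Counting the fibre over `0` with multiplicities shows that `t` has `[k(X) : k(t)]` zeros, and so has
`t⁻¹`.

*Exactness.* A full subcategory of an abelian category which contains a zero object and is closed
under extensions is an exact category (`isExactCategory_shortExactIn`); this is applied to `𝒫(I)`
inside the category of `𝒪_X`-modules.
-/

namespace HNExact

/-! ### Sections of sheaves of modules -/

section Sections

variable {X : Scheme.{u}}

/-- Restriction of functions. -/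
noncomputable def resO {U V : X.Opens} (h : V ≤ U) : Γ(X, U) →+* Γ(X, V) :=
  (X.presheaf.map (homOfLE h).op).hom

variable {E F G : X.Modules} {U V W : X.Opens}

lemma mem_inf {x : X} (hU : x ∈ U) (hV : x ∈ V) : x ∈ U ⊓ V := ⟨hU, hV⟩

lemma mem_univ_inf {ι : Type*} [Fintype ι] {V : ι → X.Opens} {x : X} (h : ∀ i, x ∈ V i) :
    x ∈ Finset.univ.inf V := by
  classical
  have : ∀ s : Finset ι, x ∈ s.inf V := fun s => by
    induction s using Finset.induction_on with
    | empty => exact trivial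
    | insert a s _ ih => rw [Finset.inf_insert]; exact mem_inf (h a) ih
  exact this _

lemma exists_germ_eq_pi (x : X) {ι : Type*} [Finite ι] (c : ι → X.presheaf.stalk x) :
    ∃ (U : X.Opens) (hU : x ∈ U) (a : ι → Γ(X, U)), ∀ i, X.presheaf.germ U x hU (a i) = c i := by
  cases nonempty_fintype ι
  choose V hV a ha using fun i => X.presheaf.exists_germ_eq (c i)
  exact ⟨Finset.univ.inf V, mem_univ_inf hV,
    fun i => resO (Finset.inf_le (Finset.mem_univ i)) (a i),
    fun i => (TopCat.Presheaf.germ_res_apply X.presheaf (homOfLE _) _ _ _).trans (ha i)⟩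

@[simp] lemma res_zero (h : V ≤ U) : res E h 0 = 0 := map_zero _
@[simp] lemma res_add (h : V ≤ U) (m n : Γ(E, U)) : res E h (m + n) = res E h m + res E h n :=
  map_add _ _ _
@[simp] lemma res_sum (h : V ≤ U) {ι : Type*} (s : Finset ι) (m : ι → Γ(E, U)) :
    res E h (∑ i ∈ s, m i) = ∑ i ∈ s, res E h (m i) := map_sum _ _ _
@[simp] lemma res_smul (h : V ≤ U) (c : Γ(X, U)) (m : Γ(E, U)) :
    res E h (c • m) = resO h c • res E h m :=
  Scheme.Modules.map_smul E (homOfLE h) c m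

@[simp] lemma res_res (h : V ≤ U) (h' : W ≤ V) (m : Γ(E, U)) :
    res E h' (res E h m) = res E (h'.trans h) m := by
  simp only [res]
  rw [← ConcreteCategory.comp_apply, ← Functor.map_comp]
  rfl

@[simp] lemma res_self (h : U ≤ U) (m : Γ(E, U)) : res E h m = m := by
  simp [res]

lemma app_res (φ : E ⟶ F) (h : V ≤ U) (m : Γ(E, U)) :
    φ.app V (res E h m) = res F h (φ.app U m) :=
  congr($(φ.mapPresheaf.naturality (homOfLE h).op) m)

lemma app_smul (φ : E ⟶ F) (c : Γ(X, U)) (m : Γ(E, U)) :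
    φ.app U (c • m) = c • φ.app U m := by simp

lemma app_comp (φ : E ⟶ F) (ψ : F ⟶ G) (m : Γ(E, U)) :
    (φ ≫ ψ).app U m = ψ.app U (φ.app U m) := rfl

/-- A section is determined by its restrictions to the members of a cover. -/
lemma eq_of_res_eq {m n : Γ(E, U)}
    (h : ∀ x ∈ U, ∃ (V : X.Opens) (hV : V ≤ U), x ∈ V ∧ res E hV m = res E hV n) : m = n := by
  choose V hV hx hmn using h
  refine TopCat.Sheaf.eq_of_locally_eq' ⟨E.presheaf, E.isSheaf⟩ (fun x : U => V x.1 x.2) U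
    (fun x => homOfLE (hV x.1 x.2)) ?_ m n fun x => hmn x.1 x.2
  intro x hxU
  exact TopologicalSpace.Opens.mem_iSup.mpr ⟨⟨x, hxU⟩, hx x hxU⟩

lemma eqO_of_resO_eq {m n : Γ(X, U)}
    (h : ∀ x ∈ U, ∃ (V : X.Opens) (hV : V ≤ U), x ∈ V ∧ resO hV m = resO hV n) : m = n := by
  choose V hV hx hmn using h
  refine TopCat.Sheaf.eq_of_locally_eq' X.sheaf (fun x : U => V x.1 x.2) U
    (fun x => homOfLE (hV x.1 x.2)) ?_ m n fun x => hmn x.1 x.2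
  intro x hxU
  exact TopologicalSpace.Opens.mem_iSup.mpr ⟨⟨x, hxU⟩, hx x hxU⟩

/-- Compatible families of sections over the members of a cover glue. -/
lemma exists_glue {ι : Type u} (V : ι → X.Opens) (hV : ∀ i, V i ≤ U)
    (hcov : ∀ x ∈ U, ∃ i, x ∈ V i) (s : ∀ i, Γ(E, V i))
    (hs : ∀ i j, res E inf_le_left (s i) = res E (inf_le_right : V i ⊓ V j ≤ _) (s j)) :
    ∃ t : Γ(E, U), ∀ i, res E (hV i) t = s i := by
  obtain ⟨t, ht, -⟩ := TopCat.Sheaf.existsUnique_gluing' ⟨E.presheaf, E.isSheaf⟩ V U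
    (fun i => homOfLE (hV i))
    (fun x hx => TopologicalSpace.Opens.mem_iSup.mpr (hcov x hx)) s hs
  exact ⟨t, ht⟩

lemma exists_glueO {ι : Type u} (V : ι → X.Opens) (hV : ∀ i, V i ≤ U)
    (hcov : ∀ x ∈ U, ∃ i, x ∈ V i) (s : ∀ i, Γ(X, V i))
    (hs : ∀ i j, resO inf_le_left (s i) = resO (inf_le_right : V i ⊓ V j ≤ _) (s j)) :
    ∃ t : Γ(X, U), ∀ i, resO (hV i) t = s i := by
  obtain ⟨t, ht, -⟩ := TopCat.Sheaf.existsUnique_gluing' X.sheaf V U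
    (fun i => homOfLE (hV i))
    (fun x hx => TopologicalSpace.Opens.mem_iSup.mpr (hcov x hx)) s hs
  exact ⟨t, ht⟩

lemma app_injective (φ : E ⟶ F) [Mono φ] (U : X.Opens) : Function.Injective (φ.app U) := by
  have : Mono ((Scheme.Modules.toPresheaf X).map φ) := inferInstance
  have h : Mono (((Scheme.Modules.toPresheaf X).map φ).app (.op U)) := inferInstance
  exact (AddCommGrpCat.mono_iff_injective _).mp h

lemma app_bijective (φ : E ⟶ F) [IsIso φ] (U : X.Opens) : Function.Bijective (φ.app U) :=
  (ConcreteCategory.isIso_iff_bijective _).mp inferInstance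

lemma isZero_of_subsingleton (h : ∀ U, Subsingleton Γ(E, U)) : IsZero E := by
  rw [IsZero.iff_id_eq_zero]
  ext U x
  exact Subsingleton.elim _ _

lemma subsingleton_of_isZero (h : IsZero E) (U : X.Opens) : Subsingleton Γ(E, U) := by
  refine ⟨fun a b => ?_⟩
  have key : ∀ m : Γ(E, U), m = 0 := fun m => by
    have h1 : (𝟙 E : E ⟶ E).app U m = (0 : E ⟶ E).app U m := by rw [h.eq_of_src (𝟙 E) 0]
    simpa using h1
  rw [key a, key b]

/-- A subsheaf of modules of `E`: submodules of the modules of sections which are stable under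
restriction, such that membership is a local condition. -/
structure LocalSubmodule (E : X.Modules) where
  /-- the submodule of sections over an open set -/
  carrier (U : X.Opens) : Submodule Γ(X, U) Γ(E, U)
  res_mem {U V : X.Opens} (h : V ≤ U) {m : Γ(E, U)} : m ∈ carrier U → res E h m ∈ carrier V
  mem_of_local {U : X.Opens} {m : Γ(E, U)} :
    (∀ x ∈ U, ∃ (V : X.Opens) (h : V ≤ U), x ∈ V ∧ res E h m ∈ carrier V) → m ∈ carrier U

namespace LocalSubmodule

variable (N : LocalSubmodule E)

/-- The underlying presheaf of modules of a subsheaf of modules. -/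
noncomputable def toSubmodule : E.val.Submodule where
  obj U := N.carrier U.unop
  map f _ hm := N.res_mem (leOfHom f.unop) hm

/-- A subsheaf of modules as an object of the category of `𝒪_X`-modules. -/
noncomputable def toModules : X.Modules where
  val := N.toSubmodule.toPresheafOfModules
  isSheaf := by
    refine (TopCat.Presheaf.isSheaf_iff_isSheafUniqueGluing
      (X := X.toTopCat) (C := AddCommGrpCat.{u})
      N.toSubmodule.toPresheafOfModules.presheaf).mpr ?_
    intro ι U s hs
    have hs' : ∀ i j, res E (inf_le_left : U i ⊓ U j ≤ _) (s i : N.carrier (U i)).1 =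
        res E inf_le_right (s j : N.carrier (U j)).1 :=
      fun i j => congr_arg Subtype.val (hs i j)
    obtain ⟨t, ht⟩ := exists_glue (E := E) U (fun i => le_iSup U i)
      (fun x hx => TopologicalSpace.Opens.mem_iSup.mp hx)
      (fun i => (s i : N.carrier (U i)).1) hs'
    have htm : t ∈ N.carrier (iSup U) := N.mem_of_local fun x hx => by
      obtain ⟨i, hi⟩ := TopologicalSpace.Opens.mem_iSup.mp hx
      exact ⟨U i, le_iSup U i, hi, by rw [ht i]; exact (s i : N.carrier (U i)).2⟩
    refine ⟨(⟨t, htm⟩ : N.carrier (iSup U)), fun i => Subtype.ext (ht i), fun t' ht' => ?_⟩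
    refine Subtype.ext (eq_of_res_eq fun x hx => ?_)
    obtain ⟨i, hi⟩ := TopologicalSpace.Opens.mem_iSup.mp hx
    exact ⟨U i, le_iSup U i, hi, (congr_arg Subtype.val (ht' i)).trans (ht i).symm⟩

/-- The inclusion of a subsheaf of modules. -/
noncomputable def ι : N.toModules ⟶ E := ⟨N.toSubmodule.ι⟩

lemma ι_app_mem (U : X.Opens) (m : Γ(N.toModules, U)) : N.ι.app U m ∈ N.carrier U :=
  (m : N.carrier U).2

lemma exists_ι_app {m : Γ(E, U)} (hm : m ∈ N.carrier U) : ∃ n, N.ι.app U n = m :=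
  ⟨(⟨m, hm⟩ : N.carrier U), rfl⟩

instance : Mono N.ι := by
  refine ⟨fun {Z} a b hab => ?_⟩
  ext U m
  exact Subtype.ext (congr($(congr_arg (fun φ : Z ⟶ E => φ.app U) hab) m))

/-- A morphism whose values on sections belong to a subsheaf factors through this subsheaf. -/
lemma exists_lift (φ : F ⟶ E) (h : ∀ U m, φ.app U m ∈ N.carrier U) :
    ∃ ψ : F ⟶ N.toModules, ψ ≫ N.ι = φ := by
  let α : F.val.presheaf ⟶ N.toModules.val.presheaf :=
    { app := fun U => AddCommGrpCat.ofHom (AddMonoidHom.mk'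
        (fun m : Γ(F, U.unop) => (⟨φ.app U.unop m, h _ m⟩ : N.carrier U.unop))
        (fun a b => Subtype.ext (map_add (φ.app U.unop).hom a b)))
      naturality := fun U V f => by
        ext m
        exact Subtype.ext (app_res φ (leOfHom f.unop) m) }
  refine ⟨⟨PresheafOfModules.homMk α fun U r m => Subtype.ext (app_smul φ r m)⟩, ?_⟩
  ext U m
  rfl

end LocalSubmodule

/-- The subsheaf of sections killed by a morphism. -/
noncomputable def kerSub (φ : E ⟶ F) : LocalSubmodule E where
  carrier U :=
    { carrier := {m | φ.app U m = 0}
      add_mem' := fun {a b} ha hb => by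
        simp only [Set.mem_ofPred_eq] at *; rw [map_add, ha, hb, add_zero]
      zero_mem' := map_zero _
      smul_mem' := fun c m hm => by
        simp only [Set.mem_ofPred_eq] at *; rw [app_smul, hm, smul_zero] }
  res_mem h m hm := by
    change φ.app _ _ = 0
    rw [app_res, show φ.app _ m = 0 from hm, res_zero]
  mem_of_local {U m} h := by
    refine eq_of_res_eq fun x hx => ?_
    obtain ⟨V, hV, hxV, hm⟩ := h x hx
    refine ⟨V, hV, hxV, ?_⟩
    rw [← app_res, res_zero]
    exact hm

/-- The subsheaf of sections which belong locally to the image of a morphism. -/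
noncomputable def imSub (φ : E ⟶ F) : LocalSubmodule F where
  carrier U :=
    { carrier := {m | ∀ x ∈ U, ∃ (V : X.Opens) (h : V ≤ U), x ∈ V ∧ ∃ n, φ.app V n = res F h m}
      add_mem' := fun {a b} ha hb x hx => by
        obtain ⟨V, hV, hxV, n, hn⟩ := ha x hx
        obtain ⟨V', hV', hxV', n', hn'⟩ := hb x hx
        refine ⟨V ⊓ V', inf_le_left.trans hV, ⟨hxV, hxV'⟩,
          res E inf_le_left n + res E inf_le_right n', ?_⟩
        rw [map_add, app_res, app_res, hn, hn']
        simp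
      zero_mem' := fun x hx => ⟨U, le_rfl, hx, 0, by simp⟩
      smul_mem' := fun c m hm x hx => by
        obtain ⟨V, hV, hxV, n, hn⟩ := hm x hx
        exact ⟨V, hV, hxV, resO hV c • n, by rw [app_smul, hn, res_smul]⟩ }
  res_mem {U V} h m hm x hx := by
    obtain ⟨W, hW, hxW, n, hn⟩ := hm x (h hx)
    refine ⟨W ⊓ V, inf_le_right, ⟨hxW, hx⟩, res E inf_le_left n, ?_⟩
    rw [app_res, hn]
    simp
  mem_of_local {U m} h x hx := by
    obtain ⟨V, hV, hxV, hm⟩ := h x hx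
    obtain ⟨W, hW, hxW, n, hn⟩ := hm x hxV
    exact ⟨W, hW.trans hV, hxW, n, by rw [hn, res_res]⟩

/-- An epimorphism of `𝒪_X`-modules is locally surjective: it factors through the subsheaf of
sections which are locally in its image, whose inclusion is therefore an isomorphism. -/
lemma exists_local_lift (φ : E ⟶ F) [Epi φ] (m : Γ(F, U)) {x : X} (hx : x ∈ U) :
    ∃ (V : X.Opens) (h : V ≤ U), x ∈ V ∧ ∃ n, φ.app V n = res F h m := by
  obtain ⟨ψ, hψ⟩ := (imSub φ).exists_lift φ
    (fun U m x hx => ⟨U, le_rfl, hx, m, by simp⟩)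
  have : Epi (ψ ≫ (imSub φ).ι) := by rw [hψ]; infer_instance
  have : Epi (imSub φ).ι := epi_of_epi ψ _
  have : IsIso (imSub φ).ι := isIso_of_mono_of_epi _
  obtain ⟨n, rfl⟩ := (app_bijective (imSub φ).ι U).2 m
  exact (imSub φ).ι_app_mem U n x hx

/-- A section killed by the second morphism of a short exact sequence comes from the first term. -/
lemma exists_of_app_eq_zero {S : ShortComplex X.Modules} (hS : S.ShortExact) {m : Γ(S.X₂, U)}
    (hm : S.g.app U m = 0) : ∃ n : Γ(S.X₁, U), S.f.app U n = m := by
  have := hS.mono_f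
  have hk : (kerSub S.g).ι ≫ S.g = 0 := by
    ext V n
    exact (kerSub S.g).ι_app_mem V n
  obtain ⟨n, hn⟩ := (kerSub S.g).exists_ι_app (m := m) hm
  refine ⟨(hS.exact.lift _ hk).app U n, ?_⟩
  rw [← app_comp, hS.exact.lift_f, hn]

lemma app_app_eq_zero (S : ShortComplex X.Modules) (m : Γ(S.X₁, U)) :
    S.g.app U (S.f.app U m) = 0 := by
  rw [← app_comp, S.zero]; rfl

end Sections

/-! ### Frames -/

section Frames

variable {X : Scheme.{u}} {E F G : X.Modules} {U V W : X.Opens} {r r' : ℕ}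

namespace LocalFrame

variable (s : LocalFrame E r U)

/-- The coordinates of a section with respect to a frame. -/
noncomputable def coord (h : V ≤ U) (m : Γ(E, V)) : Fin r → Γ(X, V) :=
  (s.existsUnique V h m).choose

lemma sum_coord (h : V ≤ U) (m : Γ(E, V)) : ∑ i, s.coord h m i • res E h (s.sec i) = m :=
  (s.existsUnique V h m).choose_spec.1.symm

lemma coord_eq (h : V ≤ U) {m : Γ(E, V)} {c : Fin r → Γ(X, V)}
    (hc : ∑ i, c i • res E h (s.sec i) = m) : s.coord h m = c :=
  ((s.existsUnique V h m).choose_spec.2 c hc.symm).symm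

lemma coord_sum_smul (h : V ≤ U) (c : Fin r → Γ(X, V)) :
    s.coord h (∑ i, c i • res E h (s.sec i)) = c := s.coord_eq h rfl

lemma coord_injective (h : V ≤ U) : Function.Injective (s.coord h) := fun m n hmn => by
  rw [← s.sum_coord h m, hmn, s.sum_coord]

lemma coord_add (h : V ≤ U) (m n : Γ(E, V)) : s.coord h (m + n) = s.coord h m + s.coord h n := by
  apply s.coord_eq
  simp [add_smul, Finset.sum_add_distrib, s.sum_coord]

lemma coord_smul (h : V ≤ U) (c : Γ(X, V)) (m : Γ(E, V)) :
    s.coord h (c • m) = c • s.coord h m := by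
  apply s.coord_eq
  simp [mul_smul, ← Finset.smul_sum, s.sum_coord]

lemma coord_zero (h : V ≤ U) : s.coord h (0 : Γ(E, V)) = 0 := by
  apply s.coord_eq; simp

lemma coord_res (h : V ≤ U) (h' : W ≤ V) (m : Γ(E, V)) :
    s.coord (h'.trans h) (res E h' m) = fun i => resO h' (s.coord h m i) := by
  apply s.coord_eq
  conv_rhs => rw [← s.sum_coord h m]
  simp

/-- The restriction of a frame to a smaller open set. -/
noncomputable def restrict (h : V ≤ U) : LocalFrame E r V where
  sec i := res E h (s.sec i)
  existsUnique W hW m := by simpa using s.existsUnique W (hW.trans h) m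

end LocalFrame

/-- Sections form a frame if the coefficients of linear combinations are unique, and if every
section is locally a linear combination: the local coefficients glue. -/
noncomputable def LocalFrame.ofLocal (sec : Fin r → Γ(E, U))
    (huniq : ∀ (V : X.Opens) (h : V ≤ U) (c : Fin r → Γ(X, V)),
      ∑ i, c i • res E h (sec i) = 0 → c = 0)
    (hex : ∀ (V : X.Opens) (_ : V ≤ U) (m : Γ(E, V)), ∀ x ∈ V, ∃ (W : X.Opens) (hW : W ≤ V)
      (hWU : W ≤ U), x ∈ W ∧ ∃ c : Fin r → Γ(X, W), ∑ i, c i • res E hWU (sec i) = res E hW m) :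
    LocalFrame E r U where
  sec := sec
  existsUnique V h m := by
    have huniq' : ∀ (V : X.Opens) (h : V ≤ U) (c c' : Fin r → Γ(X, V)),
        ∑ i, c i • res E h (sec i) = ∑ i, c' i • res E h (sec i) → c = c' := fun V h c c' hc => by
      rw [← sub_eq_zero]
      apply huniq V h
      simp [sub_smul, hc]
    choose W hWV hWU hxW c hc using hex V h m
    have key : ∀ i : Fin r, ∃ t : Γ(X, V), ∀ x : V,
        resO (hWV x.1 x.2) t = c x.1 x.2 i := fun i => by
      refine exists_glueO (fun x : V => W x.1 x.2) (fun x => hWV x.1 x.2)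
        (fun x hx => ⟨⟨x, hx⟩, hxW x hx⟩) (fun x : V => c x.1 x.2 i) fun x y => ?_
      have := huniq' (W x.1 x.2 ⊓ W y.1 y.2) (inf_le_left.trans (hWU _ _))
        (fun i => resO inf_le_left (c x.1 x.2 i)) (fun i => resO inf_le_right (c y.1 y.2 i)) ?_
      · exact congr_fun this i
      · have h1 := congr_arg (res E (inf_le_left : W x.1 x.2 ⊓ W y.1 y.2 ≤ _)) (hc x.1 x.2)
        have h2 := congr_arg (res E (inf_le_right : W x.1 x.2 ⊓ W y.1 y.2 ≤ _)) (hc y.1 y.2)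
        simp only [res_sum, res_smul, res_res] at h1 h2
        rw [h1, h2]
    choose t ht using key
    refine ⟨t, eq_of_res_eq fun x hx => ⟨W x hx, hWV x hx, hxW x hx, ?_⟩, fun c' hc' => ?_⟩
    · rw [← hc x hx]
      simp [ht _ ⟨x, hx⟩]
    · apply huniq' V h
      rw [← hc']
      refine (eq_of_res_eq fun x hx => ⟨W x hx, hWV x hx, hxW x hx, ?_⟩)
      rw [← hc x hx]
      simp [ht _ ⟨x, hx⟩]

/-- The frame obtained from a frame by an invertible matrix. -/
noncomputable def LocalFrame.change (s : LocalFrame E r U) (P : Matrix (Fin r) (Fin r) Γ(X, U))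
    (hP : IsUnit P.det) : LocalFrame E r U where
  sec j := ∑ i, P i j • s.sec i
  existsUnique V h m := by
    have hPV : IsUnit ((resO h).mapMatrix P).det := by
      rw [← RingHom.map_det]; exact hP.map _
    have hsum : ∀ c : Fin r → Γ(X, V), ∑ j, c j • res E h (∑ i, P i j • s.sec i) =
        ∑ i, ((resO h).mapMatrix P).mulVec c i • res E h (s.sec i) := fun c => by
      simp only [res_sum, res_smul, Finset.smul_sum, smul_smul, Matrix.mulVec, dotProduct,
        Finset.sum_smul]
      rw [Finset.sum_comm]
      refine Finset.sum_congr rfl fun i _ => Finset.sum_congr rfl fun j _ => ?_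
      rw [mul_comm]; rfl
    refine ⟨((resO h).mapMatrix P)⁻¹.mulVec (s.coord h m), ?_, fun c hc => ?_⟩
    · simp only [hsum, Matrix.mulVec_mulVec, Matrix.mul_nonsing_inv _ hPV, Matrix.one_mulVec,
        s.sum_coord]
    · simp only [hsum] at hc
      rw [s.coord_eq h hc.symm, Matrix.mulVec_mulVec, Matrix.nonsing_inv_mul _ hPV,
        Matrix.one_mulVec]

/-- A frame of the first term and lifts of a frame of the last term of a short exact sequence form
a frame of the middle term. -/
noncomputable def LocalFrame.extension {S : ShortComplex X.Modules} (hS : S.ShortExact)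
    (s : LocalFrame S.X₁ r U) (t : LocalFrame S.X₃ r' U) (e : Fin r' → Γ(S.X₂, U))
    (he : ∀ j, S.g.app U (e j) = t.sec j) : LocalFrame S.X₂ (r + r') U where
  sec := Fin.append (fun i => S.f.app U (s.sec i)) e
  existsUnique V h m := by
    have := hS.mono_f
    have hg : ∀ c : Fin (r + r') → Γ(X, V),
        S.g.app V (∑ i, c i • res S.X₂ h (Fin.append (fun i => S.f.app U (s.sec i)) e i)) =
          ∑ j, c (Fin.natAdd r j) • res S.X₃ h (t.sec j) := fun c => by
      rw [Fin.sum_univ_add, map_add, map_sum, map_sum, Finset.sum_eq_zero, zero_add]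
      · simp [app_res, he]
      · intro i _
        rw [app_smul, Fin.append_left, ← app_res, app_app_eq_zero, smul_zero]
    obtain ⟨n, hn⟩ := exists_of_app_eq_zero (U := V) hS
      (m := m - ∑ j, t.coord h (S.g.app V m) j • res S.X₂ h (e j)) (by
        rw [map_sub, map_sum]
        simp only [app_smul, app_res, he, t.sum_coord, sub_self])
    refine ⟨Fin.append (s.coord h n) (t.coord h (S.g.app V m)), ?_, fun c hc => ?_⟩
    · dsimp only
      rw [Fin.sum_univ_add]
      simp only [Fin.append_left, Fin.append_right, ← app_res, ← app_smul, ← map_sum, s.sum_coord]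
      rw [hn, sub_add_cancel]
    · have h2 : t.coord h (S.g.app V m) = fun j => c (Fin.natAdd r j) := by
        apply t.coord_eq
        rw [hc, hg]
      have h1 : s.coord h n = fun i => c (Fin.castAdd r' i) := by
        apply s.coord_eq
        apply app_injective S.f
        rw [hn, h2, eq_sub_iff_add_eq]
        refine Eq.trans ?_ hc.symm
        rw [Fin.sum_univ_add, map_sum]
        simp [app_res]
      rw [h1, h2]
      exact (Fin.append_castAdd_natAdd (f := c)).symm

lemma LocalFrame.extension_sec_castAdd {S : ShortComplex X.Modules} (hS : S.ShortExact)
    (s : LocalFrame S.X₁ r U) (t : LocalFrame S.X₃ r' U) (e : Fin r' → Γ(S.X₂, U))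
    (he : ∀ i, S.g.app U (e i) = t.sec i) (i : Fin r) :
    (extension hS s t e he).sec (Fin.castAdd r' i) = S.f.app U (s.sec i) :=
  Fin.append_left (fun i => S.f.app U (s.sec i)) e i

lemma LocalFrame.extension_sec_natAdd {S : ShortComplex X.Modules} (hS : S.ShortExact)
    (s : LocalFrame S.X₁ r U) (t : LocalFrame S.X₃ r' U) (e : Fin r' → Γ(S.X₂, U))
    (he : ∀ i, S.g.app U (e i) = t.sec i) (i : Fin r') :
    (extension hS s t e he).sec (Fin.natAdd r i) = e i :=
  Fin.append_right (fun i => S.f.app U (s.sec i)) e i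

lemma HasRank.of_frames (h : ∀ x : X, ∃ U : X.Opens, x ∈ U ∧ Nonempty (LocalFrame E r U)) :
    HasRank E r := by
  choose U hx hU using h
  exact ⟨⟨U, hx, fun x => (hU x).some⟩⟩

lemma HasRank.exists_frame (h : HasRank E r) (x : X) :
    ∃ U : X.Opens, x ∈ U ∧ Nonempty (LocalFrame E r U) :=
  h.elim fun A => ⟨A.nhd x, A.mem_nhd x, ⟨A.frame x⟩⟩

/-- Near every point, a finite family of sections lifts along an epimorphism. -/
lemma exists_local_lifts (φ : E ⟶ F) [Epi φ] {ι : Type*} [Finite ι] (m : ι → Γ(F, U)) {x : X}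
    (hx : x ∈ U) : ∃ (V : X.Opens) (h : V ≤ U), x ∈ V ∧
      ∃ n : ι → Γ(E, V), ∀ i, φ.app V (n i) = res F h (m i) := by
  cases nonempty_fintype ι
  choose V hV hxV n hn using fun i => exists_local_lift φ (m i) hx
  refine ⟨U ⊓ Finset.univ.inf V, inf_le_left, mem_inf hx (mem_univ_inf hxV), fun i => res E
    (inf_le_right.trans (Finset.inf_le (Finset.mem_univ i))) (n i), fun i => ?_⟩
  rw [app_res, hn, res_res]

/-- An extension of locally free sheaves is locally free. -/
lemma HasRank.extension {S : ShortComplex X.Modules} (hS : S.ShortExact)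
    (h₁ : HasRank S.X₁ r) (h₃ : HasRank S.X₃ r') : HasRank S.X₂ (r + r') := by
  have := hS.epi_g
  refine .of_frames fun x => ?_
  obtain ⟨U, hxU, ⟨s⟩⟩ := h₁.exists_frame x
  obtain ⟨V, hxV, ⟨t⟩⟩ := h₃.exists_frame x
  obtain ⟨W, hW, hxW, e, he⟩ := exists_local_lifts S.g
    ((t.restrict (inf_le_right : U ⊓ V ≤ V)).sec) (x := x) ⟨hxU, hxV⟩
  exact ⟨W, hxW, ⟨.extension hS (s.restrict (hW.trans inf_le_left))
    ((t.restrict inf_le_right).restrict hW) e he⟩⟩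

section SubQuotient

variable {S : ShortComplex X.Modules} (hS : S.ShortExact) (s : LocalFrame S.X₂ (r + r') U)
  (hs : ∀ (V : X.Opens) (h : V ≤ U) (m : Γ(S.X₂, V)),
    (∃ n, S.f.app V n = m) ↔ ∀ j : Fin r', s.coord h m (Fin.natAdd r j) = 0)

include hS hs

/-- If the sections of the sub-object in a short exact sequence are those whose last coordinates
vanish, then the first members of the frame form a frame of the sub-object. -/
lemma LocalFrame.nonempty_sub : Nonempty (LocalFrame S.X₁ r U) := by
  have := hS.mono_f
  have h1 : ∀ i : Fin r, ∃ n, S.f.app U n = s.sec (Fin.castAdd r' i) := fun i => by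
    rw [hs U le_rfl]
    intro j
    rw [s.coord_eq le_rfl (c := Pi.single (Fin.castAdd r' i) 1)]
    · rw [Pi.single_eq_of_ne]
      intro h
      have := congr_arg Fin.val h
      simp only [Fin.val_natAdd, Fin.val_castAdd] at this
      omega
    · rw [Finset.sum_eq_single (Fin.castAdd r' i)]
      · simp
      · intro b _ hb; simp [Pi.single_eq_of_ne hb]
      · simp
  choose e he using h1
  have hsum : ∀ (V : X.Opens) (h : V ≤ U) (c : Fin r → Γ(X, V)),
      S.f.app V (∑ i, c i • res S.X₁ h (e i)) =
      ∑ i, Fin.append c (0 : Fin r' → Γ(X, V)) i • res S.X₂ h (s.sec i) := fun V h c => by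
    rw [Fin.sum_univ_add, map_sum]
    simp [app_res, he]
  refine ⟨⟨e, fun V h m => ?_⟩⟩
  refine ⟨fun i => s.coord h (S.f.app V m) (Fin.castAdd r' i), ?_, fun c hc => ?_⟩
  · apply app_injective S.f
    dsimp only
    rw [hsum]
    conv_lhs => rw [← s.sum_coord h (S.f.app V m)]
    refine Finset.sum_congr rfl fun i _ => ?_
    congr 1
    refine Fin.addCases (fun i => ?_) (fun j => ?_) i
    · simp
    · simpa using (hs V h _).1 ⟨m, rfl⟩ j
  · ext i
    rw [hc, hsum, s.coord_sum_smul]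
    simp

/-- If the sections of the sub-object in a short exact sequence are those whose last coordinates
vanish, then the last members of the frame form a frame of the quotient. -/
lemma LocalFrame.nonempty_quotient : Nonempty (LocalFrame S.X₃ r' U) := by
  have := hS.epi_g
  have hsum : ∀ (V : X.Opens) (h : V ≤ U) (c : Fin r' → Γ(X, V)),
      ∑ j, c j • res S.X₃ h (S.g.app U (s.sec (Fin.natAdd r j))) = S.g.app V
      (∑ i, Fin.append (0 : Fin r → Γ(X, V)) c i • res S.X₂ h (s.sec i)) := fun V h c => by
    rw [Fin.sum_univ_add, map_add, map_sum, map_sum]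
    simp [app_res]
  refine ⟨.ofLocal (fun j => S.g.app U (s.sec (Fin.natAdd r j))) (fun V h c hc => ?_)
    fun V h m x hx => ?_⟩
  · rw [hsum] at hc
    ext j
    have := (hs V h _).1 (exists_of_app_eq_zero hS hc) j
    rw [s.coord_sum_smul] at this
    simpa using this
  · obtain ⟨W, hW, hxW, n, hn⟩ := exists_local_lift S.g m hx
    refine ⟨W, hW, hW.trans h, hxW,
      fun j => s.coord (hW.trans h) n (Fin.natAdd r j), ?_⟩
    rw [hsum, ← hn, ← sub_eq_zero, ← map_sub]
    obtain ⟨n', hn'⟩ := (hs W (hW.trans h) ((∑ i, Fin.append (0 : Fin r → Γ(X, W))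
      (fun j => s.coord (hW.trans h) n (Fin.natAdd r j)) i • res S.X₂ (hW.trans h) (s.sec i))
        - n)).2 fun j => by
          rw [sub_eq_add_neg, ← neg_one_smul Γ(X, W) n, s.coord_add, s.coord_sum_smul,
            s.coord_smul]
          simp
    rw [← hn', app_app_eq_zero]

end SubQuotient

end Frames

/-! ### Rational coordinates and rank -/

section RationalCoordinates

variable {X : Scheme.{u}} [IsIntegral X] {E F G : X.Modules} {U V W : X.Opens} {r r' r'' : ℕ}

/-- The germ of a function at the generic point, as an element of the function field. -/
noncomputable def toK (hU : genericPoint X ∈ U) : Γ(X, U) →+* X.functionField :=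
  (X.presheaf.germ U (genericPoint X) hU).hom

lemma toK_injective (hU : genericPoint X ∈ U) : Function.Injective (toK hU) :=
  germ_injective_of_isIntegral X (genericPoint X) hU

@[simp] lemma toK_resO (hV : genericPoint X ∈ V) (h : V ≤ U) (c : Γ(X, U)) :
    toK hV (resO h c) = toK (h hV) c :=
  TopCat.Presheaf.germ_res_apply X.presheaf (homOfLE h) _ hV c

lemma exists_toK_eq (c : X.functionField) :
    ∃ (U : X.Opens) (hU : genericPoint X ∈ U) (a : Γ(X, U)), toK hU a = c :=
  X.presheaf.exists_germ_eq c

lemma exists_toK_eq_pi {ι : Type*} [Finite ι] (c : ι → X.functionField) :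
    ∃ (U : X.Opens) (hU : genericPoint X ∈ U) (a : ι → Γ(X, U)), ∀ i, toK hU (a i) = c i :=
  exists_germ_eq_pi (genericPoint X) c

namespace LocalFrame

variable (s : LocalFrame E r U) (hU : genericPoint X ∈ U)

/-- The coordinates of a section, over an open set `V`, with respect to a frame over an open set
`U`: they are functions on `U ⊓ V`, considered as rational functions. -/
noncomputable def ratCoord (hV : genericPoint X ∈ V) :
    Γ(E, V) →+ (Fin r → X.functionField) where
  toFun m i := toK (mem_inf hU hV) (s.coord inf_le_left
    (res E inf_le_right m) i)
  map_zero' := by ext i; simp [coord_zero]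
  map_add' m n := by ext i; simp [coord_add]

lemma ratCoord_smul (hV : genericPoint X ∈ V) (c : Γ(X, V)) (m : Γ(E, V)) :
    s.ratCoord hU hV (c • m) = toK hV c • s.ratCoord hU hV m := by
  ext i
  simp [ratCoord, coord_smul]

lemma ratCoord_res (hV : genericPoint X ∈ V) (hW : genericPoint X ∈ W) (h : W ≤ V)
    (m : Γ(E, V)) : s.ratCoord hU hW (res E h m) = s.ratCoord hU hV m := by
  ext i
  have := s.coord_res (inf_le_left : U ⊓ V ≤ U) (inf_le_inf_left U h) (res E inf_le_right m)
  simp only [res_res] at this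
  simp only [ratCoord, AddMonoidHom.coe_mk, ZeroHom.coe_mk, res_res, this, toK_resO]

lemma ratCoord_of_le (h : V ≤ U) (hV : genericPoint X ∈ V) (m : Γ(E, V)) :
    s.ratCoord hU hV m = fun i => toK hV (s.coord h m i) := by
  ext i
  have := s.coord_res h (inf_le_right : U ⊓ V ≤ V) m
  simp only [ratCoord, AddMonoidHom.coe_mk, ZeroHom.coe_mk, this, toK_resO]

lemma ratCoord_restrict (h : V ≤ U) (hV : genericPoint X ∈ V) (hW : genericPoint X ∈ W)
    (m : Γ(E, W)) : (s.restrict h).ratCoord hV hW m = s.ratCoord hU hW m := by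
  have hVW : genericPoint X ∈ V ⊓ W := mem_inf hV hW
  rw [← ratCoord_res _ _ hW hVW inf_le_right, ratCoord_of_le _ _ inf_le_left,
    ← s.ratCoord_res hU hW hVW inf_le_right, s.ratCoord_of_le _ (inf_le_left.trans h)]
  have : (s.restrict h).coord inf_le_left (res E (inf_le_right : V ⊓ W ≤ W) m) =
      s.coord (inf_le_left.trans h) (res E inf_le_right m) := by
    apply coord_eq
    simp [restrict, s.sum_coord]
  rw [this]

lemma ratCoord_sec (j : Fin r) : s.ratCoord hU hU (s.sec j) = Pi.single j 1 := by
  rw [s.ratCoord_of_le hU le_rfl, s.coord_eq le_rfl (c := Pi.single j 1)]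
  · ext i
    by_cases h : i = j
    · subst h; simp
    · simp [Pi.single_eq_of_ne h]
  · rw [Finset.sum_eq_single j]
    · simp
    · intro b _ hb; simp [Pi.single_eq_of_ne hb]
    · simp

/-- Every vector of rational functions consists of the coordinates of a section. -/
lemma exists_ratCoord_eq (c : Fin r → X.functionField) :
    ∃ (V : X.Opens) (_ : V ≤ U) (hV : genericPoint X ∈ V) (m : Γ(E, V)),
      s.ratCoord hU hV m = c := by
  obtain ⟨W, hW, a, ha⟩ := exists_toK_eq_pi c
  refine ⟨U ⊓ W, inf_le_left, mem_inf hU hW,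
    ∑ i, (resO inf_le_right (a i) : Γ(X, U ⊓ W)) • res E inf_le_left (s.sec i), ?_⟩
  rw [ratCoord_of_le _ _ inf_le_left, coord_sum_smul]
  ext i
  simp [ha]

end LocalFrame

/-- A section of a vector bundle on an integral scheme is determined by its restriction to a
non-empty open set, since this holds for its coordinates. -/
lemma res_injective (hE : HasRank E r) (h : V ≤ U) (hV : genericPoint X ∈ V) :
    Function.Injective (res E h) := by
  intro m n hmn
  refine eq_of_res_eq fun x hx => ?_
  obtain ⟨W, hxW, ⟨s⟩⟩ := hE.exists_frame x
  refine ⟨U ⊓ W, inf_le_left, ⟨hx, hxW⟩, s.coord_injective inf_le_right ?_⟩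
  have hη : genericPoint X ∈ (U ⊓ W) ⊓ V := mem_inf (mem_inf (h hV) (genericPoint_mem hxW)) hV
  ext i
  apply toK_injective (inf_le_left (a := U ⊓ W) (b := V) hη)
  have key : ∀ m : Γ(E, U), toK (inf_le_left (a := U ⊓ W) (b := V) hη)
      (s.coord inf_le_right (res E (inf_le_left : U ⊓ W ≤ U) m) i) =
      toK hη (s.coord (inf_le_left.trans inf_le_right)
        (res E (inf_le_right : (U ⊓ W) ⊓ V ≤ V) (res E h m)) i) := fun m => by
    have := congr_fun (s.coord_res (inf_le_right : U ⊓ W ≤ W) (inf_le_left : (U ⊓ W) ⊓ V ≤ _)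
      (res E inf_le_left m)) i
    rw [res_res] at this ⊢
    rw [this, toK_resO]
  rw [key, key, hmn]

lemma LocalFrame.ratCoord_injective (hE : HasRank E r') (s : LocalFrame E r U)
    (hU : genericPoint X ∈ U) (hV : genericPoint X ∈ V) :
    Function.Injective (s.ratCoord hU hV) := by
  intro m n hmn
  have hη : genericPoint X ∈ U ⊓ V := mem_inf hU hV
  apply res_injective hE (inf_le_right : U ⊓ V ≤ V) hη
  apply s.coord_injective inf_le_left
  ext i
  exact toK_injective hη (congr_fun hmn i)

/-- The matrix over the function field of a morphism with respect to two frames. -/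
noncomputable def ratMatrix (φ : E ⟶ F) (s : LocalFrame E r U) (t : LocalFrame F r' V)
    (hU : genericPoint X ∈ U) (hV : genericPoint X ∈ V) :
    Matrix (Fin r') (Fin r) X.functionField :=
  Matrix.of fun i j => t.ratCoord hV hU (φ.app U (s.sec j)) i

section RatMatrix

variable (φ : E ⟶ F) (s : LocalFrame E r U) (t : LocalFrame F r' V)
    (hU : genericPoint X ∈ U) (hV : genericPoint X ∈ V)

lemma ratMatrix_mulVec (hW : genericPoint X ∈ W) (m : Γ(E, W)) :
    (ratMatrix φ s t hU hV).mulVec (s.ratCoord hU hW m) = t.ratCoord hV hW (φ.app W m) := by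
  have hη : genericPoint X ∈ U ⊓ W := mem_inf hU hW
  rw [← s.ratCoord_res hU hW hη inf_le_right, ← t.ratCoord_res hV hW hη inf_le_right, ← app_res,
    s.ratCoord_of_le hU inf_le_left]
  conv_rhs => rw [← s.sum_coord (inf_le_left : U ⊓ W ≤ U) (res E inf_le_right m)]
  rw [map_sum, map_sum]
  ext i
  simp only [app_smul, Matrix.mulVec, dotProduct, Finset.sum_apply, LocalFrame.ratCoord_smul,
    app_res, t.ratCoord_res hV hU hη, ratMatrix, Matrix.of_apply, Pi.smul_apply, smul_eq_mul]
  exact Finset.sum_congr rfl fun j _ => mul_comm _ _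

lemma ratMatrix_comp (ψ : F ⟶ G) (t' : LocalFrame G r'' W) (hW : genericPoint X ∈ W) :
    ratMatrix (φ ≫ ψ) s t' hU hW = ratMatrix ψ t t' hV hW * ratMatrix φ s t hU hV := by
  ext i j
  have := congr_fun (ratMatrix_mulVec ψ t t' hV hW hU (φ.app U (s.sec j))) i
  exact this.symm

lemma ratMatrix_id : ratMatrix (𝟙 E) s s hU hU = 1 := by
  ext i j
  change s.ratCoord hU hU (s.sec j) i = _
  rw [s.ratCoord_sec, Matrix.one_apply, Pi.single_apply]

lemma ratMatrix_mulVec_injective [Mono φ] (hF : HasRank F r') :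
    Function.Injective (ratMatrix φ s t hU hV).mulVec := by
  suffices h : ∀ c, (ratMatrix φ s t hU hV).mulVec c = 0 → c = 0 by
    intro a b hab
    rw [← sub_eq_zero]
    apply h
    rw [Matrix.mulVec_sub]
    exact sub_eq_zero.2 hab
  intro c hc
  obtain ⟨W, hWU, hW, m, rfl⟩ := s.exists_ratCoord_eq hU c
  rw [ratMatrix_mulVec _ _ _ _ _ hW, ← map_zero (t.ratCoord hV hW)] at hc
  have := app_injective φ W ((t.ratCoord_injective hF hV hW hc).trans (map_zero _).symm)
  rw [this, map_zero]

/-- A morphism which is surjective near the generic point has a surjective matrix over the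
function field. -/
lemma ratMatrix_mulVec_surjective
    (h : ∀ (W : X.Opens) (m : Γ(F, W)), genericPoint X ∈ W → ∃ (W' : X.Opens) (hW : W' ≤ W),
      genericPoint X ∈ W' ∧ ∃ n, φ.app W' n = res F hW m) :
    Function.Surjective (ratMatrix φ s t hU hV).mulVec := by
  intro c
  obtain ⟨W, hWU, hW, m, rfl⟩ := t.exists_ratCoord_eq hV c
  obtain ⟨W', hWW, hW', n, hn⟩ := h W m hW
  refine ⟨s.ratCoord hU hW' n, ?_⟩
  rw [ratMatrix_mulVec, hn, t.ratCoord_res hV hW hW']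

end RatMatrix

lemma HasRank.exists_generic_frame (hE : HasRank E r) :
    ∃ (U : X.Opens) (_ : genericPoint X ∈ U), Nonempty (LocalFrame E r U) := by
  obtain ⟨U, hU, h⟩ := hE.exists_frame (genericPoint X)
  exact ⟨U, hU, h⟩

lemma HasRank.le_of_mono (hE : HasRank E r) (hF : HasRank F r') (φ : E ⟶ F) [Mono φ] :
    r ≤ r' := by
  obtain ⟨U, hU, ⟨s⟩⟩ := hE.exists_generic_frame
  obtain ⟨V, hV, ⟨t⟩⟩ := hF.exists_generic_frame
  have := LinearMap.finrank_le_finrank_of_injective (f := (ratMatrix φ s t hU hV).mulVecLin)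
    (ratMatrix_mulVec_injective φ s t hU hV hF)
  simpa using this

lemma HasRank.eq_of_generically_surjective (hE : HasRank E r) (hF : HasRank F r')
    (φ : E ⟶ F) [Mono φ]
    (h : ∀ (W : X.Opens) (m : Γ(F, W)), genericPoint X ∈ W → ∃ (W' : X.Opens) (hW : W' ≤ W),
      genericPoint X ∈ W' ∧ ∃ n, φ.app W' n = res F hW m) : r = r' := by
  obtain ⟨U, hU, ⟨s⟩⟩ := hE.exists_generic_frame
  obtain ⟨V, hV, ⟨t⟩⟩ := hF.exists_generic_frame
  have := (LinearEquiv.ofBijective (ratMatrix φ s t hU hV).mulVecLin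
    ⟨ratMatrix_mulVec_injective φ s t hU hV hF,
      ratMatrix_mulVec_surjective φ s t hU hV h⟩).finrank_eq
  simpa using this

lemma HasRank.unique (hE : HasRank E r) (hE' : HasRank E r') : r = r' :=
  le_antisymm (hE.le_of_mono hE' (𝟙 E)) (hE'.le_of_mono hE (𝟙 E))

lemma rank_eq (hE : HasRank E r) : rank E = r := by
  have h : IsVectorBundle E := ⟨r, hE⟩
  rw [rank, dif_pos h]
  exact h.choose_spec.unique hE

lemma IsVectorBundle.hasRank (hE : IsVectorBundle E) : HasRank E (rank E) := by
  obtain ⟨r, hr⟩ := hE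
  rwa [rank_eq hr]

end RationalCoordinates

/-! ### Local rings and topology of a curve -/

section LocalRings

open IsLocalRing Polynomial KaehlerDifferential in
/-- If the module of differentials of a local ring `R`, essentially of finite type over a field, is
generated by one element, then it is generated by some `d b`. Hence `R` is unramified over the
polynomial ring `k[b]`, so that its maximal ideal is generated by a generator of a prime ideal of
`k[b]`. -/
lemma maximalIdeal_isPrincipal_of_kaehler (k R : Type*) [Field k] [CommRing R] [IsLocalRing R]
    [Algebra k R] [Algebra.EssFiniteType k R] (ω : Ω[R⁄k]) (hω : Submodule.span R {ω} = ⊤) :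
    (maximalIdeal R).IsPrincipal := by
  obtain ⟨b, hb⟩ : ∃ b : R, Submodule.span R {D k R b} = ⊤ := by
    have hD : ∀ b, ∃ c : R, c • ω = D k R b := fun b =>
      Submodule.mem_span_singleton.mp (hω ▸ Submodule.mem_top)
    choose c hc using hD
    by_cases h : ∃ b, IsUnit (c b)
    · obtain ⟨b, hb⟩ := h
      refine ⟨b, ?_⟩
      rw [← hc, Submodule.span_singleton_smul_eq hb, hω]
    · -- otherwise all `d b` lie in `𝔪 Ω`, so that `Ω = 0` by Nakayama's lemma
      push Not at h
      have hle : (⊤ : Submodule R Ω[R⁄k]) ≤ maximalIdeal R • ⊤ := by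
        rw [← span_range_derivation, Submodule.span_le]
        rintro _ ⟨b, rfl⟩
        rw [span_range_derivation, SetLike.mem_coe, ← hc]
        exact Submodule.smul_mem_smul ((mem_maximalIdeal _).mpr (h b)) trivial
      have hfg : (⊤ : Submodule R Ω[R⁄k]).FG := ⟨{ω}, by simpa using hω⟩
      have := Submodule.eq_bot_of_le_smul_of_le_jacobson_bot (maximalIdeal R) ⊤ hfg hle
        (by rw [jacobson_eq_maximalIdeal _ bot_ne_top])
      refine ⟨0, ?_⟩
      simp [this]
  algebraize [(aeval b : k[X] →ₐ[k] R).toRingHom]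
  have : IsScalarTower k k[X] R := .of_algebraMap_eq fun a => by
    simp [RingHom.algebraMap_toAlgebra]
  have hsub : Subsingleton Ω[R⁄k[X]] := by
    have hz : map k k[X] R R (D k R b) = 0 := by
      rw [map_D]
      have : algebraMap R R b = algebraMap k[X] R X := by simp [RingHom.algebraMap_toAlgebra]
      rw [this, Derivation.map_algebraMap]
    have htop : (⊤ : Submodule R Ω[R⁄k[X]]) = ⊥ := by
      rw [← LinearMap.range_eq_top.mpr (map_surjective k k[X] R), LinearMap.range_eq_map, ← hb,
        Submodule.map_span, Set.image_singleton, hz, Submodule.span_zero_singleton]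
    exact (Submodule.subsingleton_iff R).mp (subsingleton_of_bot_eq_top htop.symm)
  have : Algebra.FormallyUnramified k[X] R := ⟨hsub⟩
  -- unramifiedness is used over the localization of `k[b]`, where the homomorphism is local
  let p : Ideal k[X] := (maximalIdeal R).comap (algebraMap k[X] R)
  let f : Localization.AtPrime p →+* R := IsLocalization.lift (M := p.primeCompl)
    (g := algebraMap k[X] R) (fun y => by
      by_contra h
      exact y.2 ((mem_maximalIdeal _).mpr h))
  algebraize [f]
  have : IsScalarTower k[X] (Localization.AtPrime p) R := .of_algebraMap_eq fun a => by
    simp [RingHom.algebraMap_toAlgebra, f]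
  have hloc : IsLocalHom (algebraMap (Localization.AtPrime p) R) := by
    have hmap : (maximalIdeal (Localization.AtPrime p)).map (algebraMap _ R) ≤ maximalIdeal R := by
      rw [← Localization.AtPrime.map_eq_maximalIdeal, Ideal.map_map,
        ← IsScalarTower.algebraMap_eq, Ideal.map_le_iff_le_comap]
    exact ((local_hom_TFAE (algebraMap (Localization.AtPrime p) R)).out 0 2 rfl rfl).mpr hmap
  have : Algebra.FormallyUnramified (Localization.AtPrime p) R := .of_restrictScalars k[X] _ _
  have : Algebra.EssFiniteType (Localization.AtPrime p) R := by
    have : Algebra.EssFiniteType k[X] R := .of_comp k _ _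
    exact .of_comp k[X] _ _
  have hmax := Algebra.FormallyUnramified.map_maximalIdeal (R := Localization.AtPrime p) (S := R)
  rw [← Localization.AtPrime.map_eq_maximalIdeal, Ideal.map_map,
    ← IsScalarTower.algebraMap_eq] at hmax
  obtain ⟨g, hg⟩ := (IsPrincipalIdealRing.principal p).principal
  refine ⟨algebraMap k[X] R g, ?_⟩
  rw [← hmax, show p = Ideal.span {g} from hg, Ideal.map_span, Set.image_singleton]

end LocalRings

section Curve

variable {k : Type u} [Field k]

lemma isField_sections_specField {U : (Spec (.of k)).Opens} {y : Spec (.of k)} (hy : y ∈ U) :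
    IsField Γ(Spec (.of k), U) := by
  have : U = ⊤ := top_le_iff.mp fun z _ => by rwa [Subsingleton.elim z y]
  subst this
  exact (Scheme.ΓSpecIso (.of k)).commRingCatIsoToRingEquiv.toMulEquiv.isField
    (Field.toIsField k)

variable (C : SmoothProjectiveCurve k)

open IsLocalRing KaehlerDifferential in
/-- The differentials of the local ring at a point of a curve are generated by one element, since
the curve is smooth of relative dimension `1`. -/
lemma maximalIdeal_stalk_isPrincipal (x : C.X) :
    (maximalIdeal (C.X.presheaf.stalk x)).IsPrincipal := by
  obtain ⟨U, hU, V, hV, hx, e, hf⟩ :=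
    SmoothOfRelativeDimension.exists_isStandardSmoothOfRelativeDimension (n := 1) (f := C.hom) x
  have hfield : IsField Γ(Spec (.of k), U) := isField_sections_specField (e hx)
  let := hfield.toField
  algebraize [(C.hom.appLE U V e).hom]
  let : Algebra Γ(C.X, V) (C.X.presheaf.stalk x) := (C.X.presheaf.germ V x hx).hom.toAlgebra
  have hloc : IsLocalization.AtPrime (C.X.presheaf.stalk x) (hV.primeIdealOf ⟨x, hx⟩).asIdeal :=
    hV.isLocalization_stalk ⟨x, hx⟩
  let : Algebra Γ(Spec (.of k), U) (C.X.presheaf.stalk x) :=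
    ((algebraMap Γ(C.X, V) (C.X.presheaf.stalk x)).comp
      (algebraMap Γ(Spec (.of k), U) Γ(C.X, V))).toAlgebra
  have : IsScalarTower Γ(Spec (.of k), U) Γ(C.X, V) (C.X.presheaf.stalk x) :=
    .of_algebraMap_eq fun _ => rfl
  have : Nonempty V := ⟨⟨x, hx⟩⟩
  have : Algebra.IsStandardSmooth Γ(Spec (.of k), U) Γ(C.X, V) :=
    Algebra.IsStandardSmoothOfRelativeDimension.isStandardSmooth 1
  have hrank := Algebra.IsStandardSmoothOfRelativeDimension.rank_kaehlerDifferential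
    (R := Γ(Spec (.of k), U)) (S := Γ(C.X, V)) 1
  let b := Module.Free.chooseBasis Γ(C.X, V) Ω[Γ(C.X, V)⁄Γ(Spec (.of k), U)]
  rw [Nat.cast_one, b.mk_eq_rank''.symm, Cardinal.eq_one_iff_unique] at hrank
  obtain ⟨hu, ⟨i⟩⟩ := hrank
  let : Unique (Module.Free.ChooseBasisIndex Γ(C.X, V) Ω[Γ(C.X, V)⁄Γ(Spec (.of k), U)]) :=
    { default := i, uniq := fun _ => Subsingleton.elim _ _ }
  have hb : Submodule.span Γ(C.X, V) {b default} = ⊤ := by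
    rw [← b.span_eq, Set.range_unique]
  have hspan := span_eq_top_of_isLocalizedModule (C.X.presheaf.stalk x)
    (hV.primeIdealOf ⟨x, hx⟩).asIdeal.primeCompl
    (map Γ(Spec (.of k), U) Γ(Spec (.of k), U) Γ(C.X, V) (C.X.presheaf.stalk x)) hb
  rw [Set.image_singleton] at hspan
  have : Algebra.EssFiniteType Γ(Spec (.of k), U) (C.X.presheaf.stalk x) := by
    have : Algebra.EssFiniteType Γ(C.X, V) (C.X.presheaf.stalk x) :=
      .of_isLocalization _ (hV.primeIdealOf ⟨x, hx⟩).asIdeal.primeCompl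
    exact .comp _ Γ(C.X, V) _
  exact maximalIdeal_isPrincipal_of_kaehler _ _ _ hspan

open IsLocalRing in
instance isPrincipalIdealRing_stalk (x : C.X) : IsPrincipalIdealRing (C.X.presheaf.stalk x) := by
  by_cases h : IsField (C.X.presheaf.stalk x)
  · let := h.toField
    infer_instance
  · exact ((tfae_of_isNoetherianRing_of_isLocalRing_of_isDomain _).out 4 0).mp
      (maximalIdeal_stalk_isPrincipal C x)

/-- The local ring at a point other than the generic point is not a field. -/
lemma eq_genericPoint_of_isField {X : Scheme.{u}} [IsIntegral X] {x : X}
    (h : IsField (X.presheaf.stalk x)) : x = genericPoint X := by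
  have h1 : genericPoint X ∈ Set.range (X.fromSpecStalk x) := by
    rw [Scheme.range_fromSpecStalk]
    exact (genericPoint_spec X).specializes trivial
  have h2 : x ∈ Set.range (X.fromSpecStalk x) := by
    rw [Scheme.range_fromSpecStalk]
    exact specializes_rfl
  obtain ⟨y, hy⟩ := h1
  obtain ⟨z, hz⟩ := h2
  let := h.toField
  have : Subsingleton (PrimeSpectrum (X.presheaf.stalk x)) := inferInstance
  exact hz.symm.trans ((congr_arg _ (Subsingleton.elim
    (α := PrimeSpectrum (X.presheaf.stalk x)) z y)).trans hy)

variable {C}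

lemma isDiscreteValuationRing_stalk {x : C.X} (hx : x ≠ genericPoint C.X) :
    IsDiscreteValuationRing (C.X.presheaf.stalk x) where
  not_a_field' := fun h => hx (eq_genericPoint_of_isField
    (IsLocalRing.isField_iff_maximalIdeal_eq.mpr h))

lemma coheight_eq_one {x : C.X} (hx : x ≠ genericPoint C.X) : Order.coheight x = 1 := by
  have := isDiscreteValuationRing_stalk hx
  have h := ringKrullDim_stalk_eq_coheight x
  rw [IsDiscreteValuationRing.ringKrullDim_eq_one] at h
  exact_mod_cast h.symm

/-- On a curve, every point other than the generic point is closed. -/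
lemma isClosed_singleton {x : C.X} (hx : x ≠ genericPoint C.X) : IsClosed ({x} : Set C.X) := by
  rw [← closure_subset_iff_isClosed]
  intro y hy
  have hxy : x ⤳ y := specializes_iff_mem_closure.mpr hy
  have hy' : y ≠ genericPoint C.X := by
    rintro rfl
    exact hx (hxy.antisymm ((genericPoint_spec C.X).specializes trivial)).eq
  by_contra hne
  have hlt : y < x := lt_of_le_not_ge hxy fun h : y ⤳ x => hne (h.antisymm hxy).eq
  have := Order.coheight_strictAnti hlt (by rw [coheight_eq_one hx]; simp)
  rw [coheight_eq_one hx, coheight_eq_one hy'] at this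
  exact lt_irrefl _ this

attribute [local instance] MvPolynomial.gradedAlgebra

/-- Projective space is proper over `k`: `Proj` of a graded ring is proper over the subring of
elements of degree zero, which is `k` for a polynomial ring. -/
instance isProper_projectiveSpaceHom (n : ℕ) : IsProper (projectiveSpaceHom k n) := by
  have hbij : Function.Bijective
      (algebraMap k (MvPolynomial.homogeneousSubmodule (Fin (n + 1)) k 0)) := by
    constructor
    · intro a b hab
      exact MvPolynomial.C_injective (Fin (n + 1)) k (congr_arg Subtype.val hab)
    · rintro ⟨p, hp⟩
      refine ⟨p.coeff 0, Subtype.ext ?_⟩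
      rw [MvPolynomial.mem_homogeneousSubmodule, ← MvPolynomial.totalDegree_zero_iff_isHomogeneous,
        MvPolynomial.totalDegree_eq_zero_iff_eq_C] at hp
      exact hp.symm
  have : Algebra.FiniteType (MvPolynomial.homogeneousSubmodule (Fin (n + 1)) k 0)
      (MvPolynomial (Fin (n + 1)) k) :=
    have : IsScalarTower k (MvPolynomial.homogeneousSubmodule (Fin (n + 1)) k 0)
      (MvPolynomial (Fin (n + 1)) k) :=
      ⟨fun a b c => by rw [Algebra.smul_def (A := MvPolynomial (Fin (n + 1)) k) (a • b),
        Algebra.smul_def b c, ← Algebra.smul_mul_assoc]; rfl⟩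
    .of_restrictScalars_finiteType k _ _
  have : IsIso (CommRingCat.ofHom
      (algebraMap k (MvPolynomial.homogeneousSubmodule (Fin (n + 1)) k 0))) :=
    (ConcreteCategory.isIso_iff_bijective _).mpr hbij
  have : IsProper (Proj.toSpecZero (MvPolynomial.homogeneousSubmodule (Fin (n + 1)) k)) :=
    inferInstance
  exact MorphismProperty.comp_mem @IsProper _ _ this inferInstance

variable (C) in
instance isProper_hom : IsProper C.hom := by
  obtain ⟨n, i, hi, h⟩ := C.projective
  rw [← h]
  infer_instance

instance compactSpace_curve : CompactSpace C.X :=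
  (quasiCompact_iff_compactSpace C.hom).mp inferInstance

instance isNoetherian_curve : IsNoetherian C.X where

/-- On a curve, the complement of a non-empty open set is finite. -/
lemma finite_compl {U : C.X.Opens} (hU : genericPoint C.X ∈ U) : ((U : Set C.X)ᶜ).Finite := by
  -- each of the finitely many irreducible components of the complement is a point
  obtain ⟨S, hS, hirr, hU'⟩ :=
    TopologicalSpace.NoetherianSpace.exists_finite_set_isClosed_irreducible U.isOpen.isClosed_compl
  rw [hU'.2]
  refine hS.sUnion fun Z hZ => ?_
  have hgen := (hU'.1 Z hZ).closure_genericPoint (hirr Z hZ)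
  have hmem : (hU'.1 Z hZ).genericPoint ∈ Z :=
    Set.mem_of_mem_of_subset (subset_closure (Set.mem_singleton _)) hgen.subset
  have hne : (hU'.1 Z hZ).genericPoint ≠ genericPoint C.X := fun h => by
    have : (hU'.1 Z hZ).genericPoint ∈ (U : Set C.X)ᶜ :=
      hU'.2.symm.subset (Set.mem_sUnion_of_mem hmem hZ)
    rw [h] at this
    exact this hU
  rw [← hgen, (isClosed_singleton hne).closure_eq]
  exact Set.finite_singleton _

end Curve

/-! ### Ramification and orders of vanishing -/

section Ramification

/-- The ramification index of a prime ideal over a principal ideal is the order of vanishing of a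
generator in the local ring. -/
lemma ramificationIdx_eq_ord {R A O : Type*} [CommRing R] [CommRing A] [CommRing O] [Algebra R A]
    [Algebra A O] (q : Ideal A) [q.IsPrime] [IsLocalization.AtPrime O q] (t : R)
    [q.LiesOver (Ideal.span {t})] :
    q.ramificationIdx R = (Ring.ord O (algebraMap A O (algebraMap R A t))).toNat := by
  rw [Ideal.ramificationIdx_eq (Ideal.span {t}) q, Ring.ord, Ideal.map_span, Set.image_singleton]
  let e := IsLocalization.algEquiv q.primeCompl (Localization.AtPrime q) O
  let := e.toRingEquiv.toRingHom.toAlgebra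
  have hsurj : Function.Surjective (algebraMap (Localization.AtPrime q) O) := e.surjective
  rw [← Module.length_eq_of_surjective (S := Localization.AtPrime q) hsurj]
  congr 1
  have ht : e (algebraMap R (Localization.AtPrime q) t) = algebraMap A O (algebraMap R A t) := by
    rw [IsScalarTower.algebraMap_apply R A (Localization.AtPrime q), e.commutes]
  have hmap : Submodule.map (Algebra.linearMap (Localization.AtPrime q) O)
      (Ideal.span {algebraMap R (Localization.AtPrime q) t}) =
      (Ideal.span {algebraMap A O (algebraMap R A t)}).restrictScalars _ := by
    ext y
    simp only [Submodule.mem_map, Submodule.restrictScalars_mem, Ideal.mem_span_singleton']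
    constructor
    · rintro ⟨_, ⟨a, rfl⟩, rfl⟩
      refine ⟨e a, ?_⟩
      rw [← ht, ← map_mul]
      rfl
    · rintro ⟨a, rfl⟩
      refine ⟨_, ⟨e.symm a, rfl⟩, ?_⟩
      rw [← ht]
      exact (map_mul e _ _).trans (by rw [e.apply_symm_apply])
  let e' : Localization.AtPrime q ≃ₗ[Localization.AtPrime q] O :=
    LinearEquiv.ofBijective (Algebra.linearMap _ _) e.bijective
  exact (Submodule.Quotient.equiv _ ((Ideal.span
    {algebraMap A O (algebraMap R A t)}).restrictScalars (Localization.AtPrime q)) e'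
      hmap).length_eq

open Polynomial in
/-- Over an algebraically closed field all residue degrees are `1`, hence the fibre of a finite
torsion-free `k[X]`-algebra over `X = 0`, counted with multiplicities, has as many points as the
rank of the algebra. -/
lemma sum_ramificationIdx_eq_finrank {k A : Type*} [Field k] [IsAlgClosed k] [CommRing A]
    [IsDomain A] [Algebra k[X] A] [Module.Finite k[X] A] [FaithfulSMul k[X] A]
    [Fintype ((Ideal.span {(X : k[X])}).primesOver A)] :
    ∑ q : (Ideal.span {(X : k[X])}).primesOver A, q.1.ramificationIdx k[X] =
      Module.finrank k[X] A := by
  have hmax : (Ideal.span {(X : k[X])}).IsMaximal :=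
    PrincipalIdealRing.isMaximal_of_irreducible irreducible_X
  have : Module.IsTorsionFree k[X] A := inferInstance
  have : Module.Free k[X] A := Module.free_of_finite_type_torsion_free'
  rw [← Ideal.sum_ramification_inertia_eq_finrank (Ideal.span {(X : k[X])}) A]
  refine Finset.sum_congr rfl fun q _ => ?_
  have := q.2.1
  have := q.2.2
  have : q.1.IsMaximal := Ideal.IsMaximal.of_liesOver_isMaximal q.1 (Ideal.span {(X : k[X])})
  rw [Ideal.inertiaDeg_eq_of_isMaximal (Ideal.span {(X : k[X])}) q.1]
  let : Field (k[X] ⧸ Ideal.span {(X : k[X])}) := Ideal.Quotient.field _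
  let : Field (A ⧸ q.1) := Ideal.Quotient.field _
  have hX : Ideal.span {X - C (0 : k)} = Ideal.span {X} := by simp
  have : IsAlgClosed (k[X] ⧸ Ideal.span {(X : k[X])}) := IsAlgClosed.of_ringEquiv k _
    ((quotientSpanXSubCAlgEquiv (0 : k)).symm.toRingEquiv.trans (Ideal.quotEquivOfEq hX))
  have : Module.Finite (k[X] ⧸ Ideal.span {(X : k[X])}) (A ⧸ q.1) := inferInstance
  have hb := IsAlgClosed.algebraMap_bijective_of_isIntegral
    (k := k[X] ⧸ Ideal.span {(X : k[X])}) (K := A ⧸ q.1)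
  rw [((LinearEquiv.ofBijective (Algebra.linearMap _ _) hb).finrank_eq).symm, Module.finrank_self,
    mul_one]

end Ramification

section Order

variable {k : Type u} [Field k] {C : SmoothProjectiveCurve k} {U V : C.X.Opens} {x : C.X}

lemma ord_genericPoint (f : C.X.functionField) : C.X.ord f (genericPoint C.X) = 0 := by
  refine Scheme.ord_eq_zero_of_coheight_neq_one (fun h => ?_) f
  have h1 := ringKrullDim_stalk_eq_coheight (genericPoint C.X)
  have : ringKrullDim (C.X.presheaf.stalk (genericPoint C.X)) = 0 :=
    ringKrullDim_eq_zero_of_field C.X.functionField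
  rw [h, this] at h1
  exact absurd h1 (by decide)

/-- The order of vanishing of a regular function is the length of a quotient of the local ring. This
length is finite, so that `ENat.toNat` does not take its junk value. -/
lemma ord_algebraMap (hx : x ≠ genericPoint C.X) {a : C.X.presheaf.stalk x} (ha : a ≠ 0) :
    C.X.ord (algebraMap _ C.X.functionField a) x = ((Ring.ord _ a).toNat : ℤ) := by
  have hc := coheight_eq_one hx
  have : Ring.KrullDimLE 1 (C.X.presheaf.stalk x) := krullDimLE_of_coheight_le hc.le
  have hne : algebraMap _ C.X.functionField a ≠ 0 := by
    rwa [Ne, FaithfulSMul.algebraMap_eq_zero_iff]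
  rw [Scheme.ord_eq_iff hc hne]
  have hfin : Ring.ord _ a ≠ ⊤ := Ring.ord_ne_top (mem_nonZeroDivisors_of_ne_zero ha)
  exact (Ring.ordFrac_eq_ord _ ha).trans (Ring.ordMonoidWithZeroHom_eq_coe _
    (mem_nonZeroDivisors_of_ne_zero ha) (ENat.natCast_toNat hfin).symm)

lemma toK_eq_algebraMap (hU : genericPoint C.X ∈ U) (hx : x ∈ U) (a : Γ(C.X, U)) :
    toK hU a = algebraMap _ C.X.functionField (C.X.presheaf.germ U x hx a) := by
  have : Nonempty U := ⟨⟨x, hx⟩⟩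
  exact (Scheme.algebraMap_germ_eq_germToFunctionField C.X hx a).symm

lemma ord_toNat_pos {R : Type*} [CommRing R] [IsDomain R] [IsDiscreteValuationRing R] {a : R}
    (ha : a ≠ 0) : 0 < (Ring.ord R a).toNat ↔ ¬ IsUnit a := by
  have hfin : Ring.ord R a ≠ ⊤ := Ring.ord_ne_top (mem_nonZeroDivisors_of_ne_zero ha)
  rw [Nat.pos_iff_ne_zero, Ne, ENat.toNat_eq_zero, not_or, and_iff_left hfin, Ring.ord_eq_addVal,
    IsDiscreteValuationRing.addVal_eq_zero_iff]

/-- At a closed point of a curve either `t` is regular, or `t⁻¹` is regular and vanishes, since the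
local ring is a valuation ring. -/
lemma exists_germ_or_inv (hx : x ≠ genericPoint C.X) {t : C.X.functionField} (ht : t ≠ 0) :
    (∃ (V : C.X.Opens) (hV : genericPoint C.X ∈ V) (_ : x ∈ V) (a : Γ(C.X, V)), toK hV a = t) ∨
    (∃ (V : C.X.Opens) (hV : genericPoint C.X ∈ V) (hxV : x ∈ V) (a : Γ(C.X, V)),
      toK hV a * t = 1 ∧ ¬ IsUnit (C.X.presheaf.germ V x hxV a)) := by
  have := isDiscreteValuationRing_stalk hx
  have key : ∀ a : C.X.presheaf.stalk x, ∃ (V : C.X.Opens) (hV : genericPoint C.X ∈ V)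
      (hxV : x ∈ V) (b : Γ(C.X, V)), C.X.presheaf.germ V x hxV b = a ∧
      toK hV b = algebraMap _ C.X.functionField a := by
    intro a
    obtain ⟨V, hxV, b, rfl⟩ := C.X.presheaf.exists_germ_eq a
    exact ⟨V, genericPoint_mem hxV, hxV, b, rfl, toK_eq_algebraMap _ _ _⟩
  rcases ValuationRing.isInteger_or_isInteger (C.X.presheaf.stalk x) t with ⟨a, ha⟩ | ⟨a, ha⟩
  · obtain ⟨V, hV, hxV, b, -, hb⟩ := key a
    exact .inl ⟨V, hV, hxV, b, hb.trans ha⟩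
  · obtain ⟨V, hV, hxV, b, hba, hb⟩ := key a
    by_cases hu : IsUnit a
    · obtain ⟨V', hV', hxV', b', -, hb'⟩ := key (hu.unit⁻¹ : (C.X.presheaf.stalk x)ˣ)
      refine .inl ⟨V', hV', hxV', b', hb'.trans ?_⟩
      rw [map_units_inv, IsUnit.unit_spec, ha, inv_inv]
    · refine .inr ⟨V, hV, hxV, b, ?_, hba ▸ hu⟩
      rw [hb, ha, inv_mul_cancel₀ ht]

end Order

/-! ### The graph of a rational function -/

section Regularity

variable {k : Type u} [Field k] (C : SmoothProjectiveCurve k)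

variable {C} in
/-- A rational function `t ≠ 0` is a regular function on the open set of points where it has no
pole, and `t⁻¹` is regular and zero at the remaining points. -/
lemma exists_domain {t : C.X.functionField} (ht : t ≠ 0) :
    ∃ (U : C.X.Opens) (hU : genericPoint C.X ∈ U) (a : Γ(C.X, U)), toK hU a = t ∧
      ∀ x ∉ U, ∃ (V : C.X.Opens) (hV : genericPoint C.X ∈ V) (hxV : x ∈ V) (b : Γ(C.X, V)),
        toK hV b * t = 1 ∧ ¬ IsUnit (C.X.presheaf.germ V x hxV b) := by
  let ι := {x : C.X // ∃ (V : C.X.Opens) (hV : genericPoint C.X ∈ V) (_ : x ∈ V)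
    (a : Γ(C.X, V)), toK hV a = t}
  choose V hV hxV a ha using fun i : ι => i.2
  obtain ⟨W, hW, b, hb⟩ := exists_toK_eq t
  let U : C.X.Opens := ⨆ i, V i
  have hU : genericPoint C.X ∈ U :=
    TopologicalSpace.Opens.mem_iSup.mpr ⟨⟨genericPoint C.X, W, hW, hW, b, hb⟩, hV _⟩
  obtain ⟨s, hs⟩ := exists_glueO V (fun i => le_iSup V i)
    (fun x hx => TopologicalSpace.Opens.mem_iSup.mp hx) a (fun i j => by
      apply toK_injective (mem_inf (hV i) (hV j))
      rw [toK_resO, toK_resO, ha, ha])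
  refine ⟨U, hU, s, ?_, fun x hx => ?_⟩
  · rw [← toK_resO (hV ⟨genericPoint C.X, W, hW, hW, b, hb⟩) (le_iSup V _), hs, ha]
  · have hxη : x ≠ genericPoint C.X := fun h => hx (h ▸ hU)
    refine (exists_germ_or_inv hxη ht).resolve_left fun h => hx ?_
    exact TopologicalSpace.Opens.mem_iSup.mpr ⟨⟨x, h⟩, hxV _⟩

lemma le_preimage_top {X Y : Scheme.{u}} (f : X ⟶ Y) (U : X.Opens) : U ≤ f ⁻¹ᵁ ⊤ := le_top

/-- The constants on an open subset of a curve over `k`. -/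
noncomputable def constants (U : C.X.Opens) : k →+* Γ(C.X, U) :=
  ((Scheme.ΓSpecIso (.of k)).inv ≫ C.hom.appLE ⊤ U (le_preimage_top _ _)).hom

lemma resO_constants {U V : C.X.Opens} (h : V ≤ U) (c : k) :
    resO h (constants C U c) = constants C V c := by
  have : C.hom.appLE ⊤ U (le_preimage_top _ _) ≫ C.X.presheaf.map (homOfLE h).op =
      C.hom.appLE ⊤ V (le_preimage_top _ _) :=
    Scheme.Hom.appLE_map _ _ _
  exact congr_arg (fun f => f.hom ((Scheme.ΓSpecIso (.of k)).inv.hom c)) this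

lemma toSpecΓ_constants (U : C.X.Opens) :
    U.toSpecΓ ≫ Spec.map (CommRingCat.ofHom (constants C U)) = U.ι ≫ C.hom := by
  rw [constants, CommRingCat.ofHom_hom, Spec.map_comp, Scheme.Opens.toSpecΓ_SpecMap_appLE_assoc]
  simp only [Scheme.Opens.toSpecΓ_top, Category.assoc, toSpecΓ_SpecMap_ΓSpecIso_inv,
    Category.comp_id]
  exact Scheme.Hom.resLE_comp_ι _ _

open Polynomial

variable {C} {U : C.X.Opens} (a : Γ(C.X, U))

/-- The ring homomorphism `k[X] ⟶ 𝒪(U)` which sends `X` to `a`. -/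
noncomputable def evalHom : k[X] →+* Γ(C.X, U) := eval₂RingHom (constants C U) a

/-- The morphism from `U` to the affine line given by the function `a`. -/
noncomputable def toLine : U.toScheme ⟶ Spec (.of k[X]) :=
  U.toSpecΓ ≫ Spec.map (CommRingCat.ofHom (evalHom a))

lemma toLine_comp :
    toLine a ≫ Spec.map (CommRingCat.ofHom (Polynomial.C : k →+* k[X])) = U.ι ≫ C.hom := by
  rw [toLine, Category.assoc, ← Spec.map_comp, ← toSpecΓ_constants, ← CommRingCat.ofHom_comp]
  have : (evalHom a).comp Polynomial.C = constants C U := RingHom.ext fun c => by simp [evalHom]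
  rw [this]

/-- The graph of a regular function on `U`, in the product of the curve and the affine line. -/
noncomputable def graph : U.toScheme ⟶
    pullback C.hom (Spec.map (CommRingCat.ofHom (Polynomial.C : k →+* k[X]))) :=
  pullback.lift U.ι (toLine a) (toLine_comp a).symm

lemma isImmersion_graph : IsImmersion (graph a) :=
  have : IsImmersion (graph a ≫ pullback.fst _ _) := by
    rw [graph, pullback.lift_fst]
    infer_instance
  .of_comp (graph a) (pullback.fst _ _)

/-- The point `toLine a x` of the affine line is the prime ideal of the polynomials `p` such that
`p(a)` vanishes at `x`. -/
lemma mem_toLine_iff (x : U) (p : k[X]) :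
    p ∈ (toLine a x : PrimeSpectrum k[X]).asIdeal ↔ x.1 ∉ C.X.basicOpen (evalHom a p) := by
  have := Scheme.Opens.toSpecΓ_preimage_basicOpen U (evalHom a p)
  have h : x ∈ U.toSpecΓ ⁻¹ᵁ PrimeSpectrum.basicOpen (evalHom a p) ↔
    x.1 ∈ C.X.basicOpen (evalHom a p) := by rw [this]; rfl
  rw [← h, ← not_iff_not, not_not]
  simp [toLine]
  rfl

lemma toLine_appLE {N : U.toScheme.Opens} (hN : N ≤ U.ι ⁻¹ᵁ U) (p : k[X]) :
    (toLine a).appLE ⊤ N (le_preimage_top _ _) ((Scheme.ΓSpecIso (.of k[X])).inv p) =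
      U.ι.appLE U N hN (evalHom a p) := by
  have h : (Scheme.ΓSpecIso (.of k[X])).inv ≫ (toLine a).appLE ⊤ N (le_preimage_top _ _) =
      CommRingCat.ofHom (evalHom a) ≫ U.ι.appLE U N hN := by
    have h1 : (toLine a).appLE ⊤ N (le_preimage_top _ _) =
      (toLine a).appTop ≫ U.toScheme.presheaf.map (homOfLE le_top).op := rfl
    rw [h1, toLine, Scheme.Hom.comp_appTop, Category.assoc, ← Scheme.ΓSpecIso_inv_naturality_assoc,
      Scheme.Opens.toSpecΓ_appTop, Category.assoc, Iso.inv_hom_id_assoc]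
    congr 1
    have h2 : U.topIso.inv ≫ U.toScheme.presheaf.map (homOfLE le_top : N ⟶ ⊤).op =
      C.X.presheaf.map (eqToHom U.ι_image_top).op ≫
        C.X.presheaf.map (homOfLE (U.ι.image_mono le_top)).op := rfl
    rw [h2, ← Functor.map_comp, Scheme.Hom.appLE, Scheme.Opens.ι_app]
    change C.X.presheaf.map _ = C.X.presheaf.map _ ≫ C.X.presheaf.map (U.ι.opensFunctor.map _).op
    rw [← Functor.map_comp]
    rfl
  exact congr_arg (fun f => f.hom p) h

lemma appLE_resO {X Y : Scheme.{u}} (f : X ⟶ Y) {U V : Y.Opens} (h : V ≤ U) {N : X.Opens}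
    (hN : N ≤ f ⁻¹ᵁ V) (b : Γ(Y, U)) :
    f.appLE V N hN (resO h b) = f.appLE U N (hN.trans (f.preimage_mono h)) b :=
  congr_arg (fun g => g.hom b) (Scheme.Hom.map_appLE f hN (homOfLE h).op)

lemma appLE_appLE {X Y Z : Scheme.{u}} (f : X ⟶ Y) (g : Y ⟶ Z) (h : X ⟶ Z) (hfg : f ≫ g = h)
    {U : Z.Opens} {V : Y.Opens} {N : X.Opens} (hV : V ≤ g ⁻¹ᵁ U) (hN : N ≤ f ⁻¹ᵁ V)
    (hN' : N ≤ h ⁻¹ᵁ U) (b : Γ(Z, U)) :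
    f.appLE V N hN (g.appLE U V hV b) = h.appLE U N hN' b := by
  subst hfg
  exact congr_arg (fun g => g.hom b) (Scheme.Hom.appLE_comp_appLE f g U V N hV hN)

lemma isUnit_mul_sub_one {R : Type*} [CommRing R] [IsLocalRing R] {a : R} (ha : ¬ IsUnit a)
    (b : R) : IsUnit (a * b - 1) := by
  rw [← IsUnit.neg_iff, neg_sub]
  exact (IsLocalRing.isUnit_or_isUnit_of_add_one (add_sub_cancel (a * b) 1)).resolve_left
    fun h => ha (isUnit_of_mul_isUnit_left h)

variable {a}

/-- If the function `a` on `U` has a pole at each point outside `U`, then its graph is closed. -/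
lemma isClosedImmersion_graph (hU : genericPoint C.X ∈ U)
    (ha : ∀ x ∉ U, ∃ (V : C.X.Opens) (hV : genericPoint C.X ∈ V) (hxV : x ∈ V) (b : Γ(C.X, V)),
      toK hV b * toK hU a = 1 ∧ ¬ IsUnit (C.X.presheaf.germ V x hxV b)) :
    IsClosedImmersion (graph a) := by
  have := isImmersion_graph a
  refine IsClosedImmersion.of_isPreimmersion _ ?_
  rw [← isOpen_compl_iff, isOpen_iff_forall_mem_open]
  intro z hz
  let pr := pullback.fst C.hom (Spec.map (CommRingCat.ofHom (Polynomial.C : k →+* k[X])))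
  have hpr : graph a ≫ pr = U.ι := pullback.lift_fst _ _ _
  by_cases hzU : pr z ∈ U
  · -- over `U` the graph is the image of a section of a separated morphism, hence closed
    let W := pr ⁻¹ᵁ U
    have hrange : Set.range (graph a) ⊆ Set.range W.ι := by
      rw [Scheme.Opens.range_ι]
      rintro _ ⟨u, rfl⟩
      change pr (graph a u) ∈ U
      rw [← Scheme.Hom.comp_apply, hpr]
      exact u.2
    let ℓ := IsOpenImmersion.lift W.ι (graph a) hrange
    have hℓ : ℓ ≫ W.ι = graph a := IsOpenImmersion.lift_fac _ _ _
    have hsec : ℓ ≫ pr ∣_ U = 𝟙 _ := by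
      rw [← cancel_mono U.ι, Category.assoc, morphismRestrict_ι, ← Category.assoc, hℓ, hpr,
        Category.id_comp]
    have : IsClosedImmersion (ℓ ≫ pr ∣_ U) := by rw [hsec]; infer_instance
    have : IsClosedImmersion ℓ := .of_comp ℓ (pr ∣_ U)
    have hcl : IsOpen (Set.range ℓ)ᶜ := ℓ.isClosedEmbedding.isClosed_range.isOpen_compl
    refine ⟨W.ι '' (Set.range ℓ)ᶜ, ?_, W.ι.isOpenEmbedding.isOpenMap _ hcl, ⟨z, hzU⟩, ?_, rfl⟩
    · rintro _ ⟨w, hw, rfl⟩ ⟨u, hu⟩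
      refine hw ⟨u, W.ι.isOpenEmbedding.injective ?_⟩
      rw [← hu, ← hℓ, Scheme.Hom.comp_apply]
    · rintro ⟨u, hu⟩
      refine hz ⟨u, ?_⟩
      rw [← hℓ, Scheme.Hom.comp_apply, hu]
      rfl
  · -- near the fibre over a pole, with `b = 1 / a` and `t` the coordinate of the line, the function
    -- `b * t - 1` vanishes on the graph, but is invertible on this fibre since `b` is zero there
    obtain ⟨V, hV, hxV, b, hab, hb⟩ := ha _ hzU
    let W := pr ⁻¹ᵁ V
    let pr' := pullback.snd C.hom (Spec.map (CommRingCat.ofHom (Polynomial.C : k →+* k[X])))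
    let b' := pr.appLE V W le_rfl b
    let t' := pr'.appLE ⊤ W (le_preimage_top _ _) ((Scheme.ΓSpecIso (.of k[X])).inv Polynomial.X)
    have hpr' : graph a ≫ pr' = toLine a := pullback.lift_snd _ _ _
    refine ⟨(pullback C.hom (Spec.map (CommRingCat.ofHom (Polynomial.C : k →+* k[X])))).basicOpen
      (b' * t' - 1), ?_, (Scheme.basicOpen _ _).isOpen, ?_⟩
    · rintro _ hw ⟨u, rfl⟩
      have huW : graph a u ∈ W := Scheme.basicOpen_le _ _ hw
      have hN : graph a ⁻¹ᵁ W ≤ U.ι ⁻¹ᵁ (U ⊓ V) := fun y hy =>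
        mem_inf y.2 (by
          have : pr (graph a y) ∈ V := hy
          rwa [← Scheme.Hom.comp_apply, hpr] at this)
      have hzero : (graph a).appLE W (graph a ⁻¹ᵁ W) le_rfl (b' * t' - 1) = 0 := by
        rw [map_sub, map_mul, map_one, appLE_appLE (graph a) pr _ hpr le_rfl le_rfl
          (hN.trans (U.ι.preimage_mono inf_le_right)), appLE_appLE (graph a) pr' _ hpr'
          (le_preimage_top _ _) le_rfl (le_preimage_top _ _), toLine_appLE a
          (hN.trans (U.ι.preimage_mono inf_le_left)), ← appLE_resO U.ι inf_le_right hN,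
          ← appLE_resO U.ι inf_le_left hN, ← map_mul, sub_eq_zero]
        convert map_one (U.ι.appLE (U ⊓ V) (graph a ⁻¹ᵁ W) hN).hom
        apply toK_injective (mem_inf hU hV)
        rw [map_mul, toK_resO, toK_resO, map_one, ← hab]
        simp [evalHom]
      rw [SetLike.mem_coe, Scheme.mem_basicOpen _ _ _ huW] at hw
      have hu := hw.map ((graph a).stalkMap u).hom
      rw [Scheme.Hom.germ_stalkMap_apply] at hu
      rw [Scheme.Hom.appLE_eq_app] at hzero
      rw [hzero, map_zero] at hu
      exact not_isUnit_zero hu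
    · have hzW : z ∈ W := hxV
      rw [SetLike.mem_coe, Scheme.mem_basicOpen _ _ _ hzW]
      have hb' : ¬ IsUnit ((pullback C.hom (Spec.map
          (CommRingCat.ofHom (Polynomial.C : k →+* k[X])))).presheaf.germ W z hzW b') :=
        fun h => hb (by
        have := Scheme.Hom.germ_stalkMap_apply pr V z hxV b
        have e : b' = pr.app V b := by
          rw [← Scheme.Hom.appLE_eq_app]
        rw [← e] at this
        rw [← this] at h
        exact (isUnit_map_iff _ _).mp h)
      rw [map_sub, map_one, map_mul]
      exact isUnit_mul_sub_one hb' _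

end Regularity

/-! ### Principal divisors have degree zero -/

section PrincipalDivisors

open Polynomial IntermediateField

open IntermediateField.algebraAdjoinAdjoin in
/-- The rank over `k[X]` of a finite algebra can be computed on fraction fields: it is the degree
`[K : k(t)]`, where `t` is the image of `X`. -/
lemma finrank_eq_finrank_adjoin {k K A : Type*} [Field k] [Field K] [Algebra k K] [CommRing A]
    [IsDomain A] [Algebra k[X] A] [Algebra A K] [IsFractionRing A K] [Module.Finite k[X] A] {t : K}
    (ht : Transcendental k t) (h : ∀ p, algebraMap A K (algebraMap k[X] A p) = aeval t p) :
    Module.finrank k[X] A = Module.finrank k⟮t⟯ K := by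
  let e := Polynomial.algEquivOfTranscendental k t ht
  let : Algebra k[X] k⟮t⟯ := ((algebraMap (Algebra.adjoin k {t}) k⟮t⟯).comp
    e.toRingEquiv.toRingHom).toAlgebra
  let : Algebra k[X] K := ((algebraMap A K).comp (algebraMap k[X] A)).toAlgebra
  have : IsScalarTower k[X] A K := .of_algebraMap_eq fun _ => rfl
  have : IsScalarTower k[X] k⟮t⟯ K := .of_algebraMap_eq fun p => by
    refine (h p).trans ?_
    change _ = algebraMap k⟮t⟯ K (algebraMap (Algebra.adjoin k {t}) k⟮t⟯ (e p))
    rw [← IsScalarTower.algebraMap_apply (Algebra.adjoin k {t}) k⟮t⟯ K]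
    change _ = (Algebra.adjoin k {t}).val (aeval _ p)
    rw [← aeval_algHom_apply]
    rfl
  have : IsFractionRing k[X] k⟮t⟯ := .of_ringEquiv_left e.toRingEquiv fun _ => rfl
  have : FaithfulSMul k[X] A := by
    rw [faithfulSMul_iff_algebraMap_injective, injective_iff_map_eq_zero]
    intro p hp
    have := h p
    rw [hp, map_zero] at this
    exact (transcendental_iff.mp ht) p this.symm
  exact (IsFractionRing.finrank_eq k[X] k⟮t⟯ A K).symm

variable {k : Type u} [Field k] {C : SmoothProjectiveCurve k} {U : C.X.Opens} {a : Γ(C.X, U)}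

variable (C) in
/-- The function field of a curve over `k` is a `k`-algebra. -/
noncomputable instance algebraFunctionField : Algebra k C.X.functionField :=
  ((toK (U := (⊤ : C.X.Opens)) trivial).comp (constants C ⊤)).toAlgebra

lemma toK_evalHom (hU : genericPoint C.X ∈ U) (p : k[X]) :
    toK hU (evalHom a p) = aeval (toK hU a) p := by
  rw [evalHom, coe_eval₂RingHom, hom_eval₂, aeval_def]
  congr 1
  ext c
  change _ = toK (U := ⊤) _ _
  rw [RingHom.comp_apply, ← resO_constants C (le_top : U ≤ ⊤), toK_resO]

/-- A non-constant rational function defines a finite morphism from its domain to the affine line: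
this morphism is proper since its graph is closed in the product of the affine line with the
projective curve, and its fibres are finite. -/
lemma isFinite_toLine (hU : genericPoint C.X ∈ U)
    (ha : ∀ x ∉ U, ∃ (V : C.X.Opens) (hV : genericPoint C.X ∈ V) (hxV : x ∈ V) (b : Γ(C.X, V)),
      toK hV b * toK hU a = 1 ∧ ¬ IsUnit (C.X.presheaf.germ V x hxV b))
    (ht : Transcendental k (toK hU a)) : IsFinite (toLine a) := by
  have := isClosedImmersion_graph hU ha
  have hproper : IsProper (toLine a) := by
    rw [← pullback.lift_snd U.ι (toLine a) (toLine_comp a).symm]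
    change IsProper (graph a ≫ _)
    infer_instance
  have hgen : (toLine a ⟨genericPoint C.X, hU⟩ : PrimeSpectrum k[X]).asIdeal = ⊥ := by
    rw [eq_bot_iff]
    intro p hp
    rw [mem_toLine_iff] at hp
    by_contra hp0
    refine hp ((C.X.mem_basicOpen _ _ hU).mpr (IsUnit.mk0 _ fun h0 => hp0 ?_))
    refine (transcendental_iff.mp ht) p ?_
    rw [← toK_evalHom]
    exact h0
  have hfin : ∀ p, (toLine a ⁻¹' {p}).Finite := by
    intro p
    by_cases hp : IsClosed {p}
    · -- a closed fibre does not contain the generic point, which maps to the generic point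
      have hcl : IsClosed (toLine a ⁻¹' {p}) := hp.preimage (toLine a).continuous
      have hη : (⟨genericPoint C.X, hU⟩ : U.toScheme) ∉ toLine a ⁻¹' {p} := fun h => by
        have h' : toLine a ⟨genericPoint C.X, hU⟩ = p := h
        rw [← h'] at hp
        have := (PrimeSpectrum.isClosed_singleton_iff_isMaximal _).mp hp
        rw [hgen] at this
        exact Polynomial.not_isField k (Ring.isField_iff_maximal_bot.mpr this)
      let W : C.X.Opens := U.ι ''ᵁ ⟨_, hcl.isOpen_compl⟩
      have hW : genericPoint C.X ∈ W := ⟨_, hη, rfl⟩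
      refine Set.Finite.of_finite_image ((finite_compl hW).subset ?_)
        U.ι.isOpenEmbedding.injective.injOn
      rintro _ ⟨x, hx, rfl⟩ ⟨y, hy, hxy⟩
      exact hy (U.ι.isOpenEmbedding.injective hxy ▸ hx)
    · -- a closed point maps to a closed point, the morphism being proper
      refine (Set.finite_singleton (⟨genericPoint C.X, hU⟩ : U.toScheme)).subset fun x hx => ?_
      by_contra hne
      have hx' : x.1 ≠ genericPoint C.X := fun h => hne (Subtype.ext h)
      have hcl : IsClosed ({x} : Set U.toScheme) := by
        have := (isClosed_singleton hx').preimage U.ι.continuous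
        have h1 : U.ι '' {x} = {x.1} := Set.image_singleton
        rwa [← h1, Set.preimage_image_eq _ U.ι.isOpenEmbedding.injective] at this
      refine hp ?_
      have := (toLine a).isClosedMap _ hcl
      have h1 : toLine a '' {x} = {p} := Set.image_singleton.trans (congr_arg _ hx)
      rwa [h1] at this
  have : LocallyQuasiFinite (toLine a) := locallyQuasiFinite_iff_finite_preimage_singleton.mpr hfin
  exact IsFinite.of_isProper_of_locallyQuasiFinite _

/-- If the morphism to the affine line is finite, then `U` is affine and `𝒪(U)` is a finite
`k[X]`-algebra. -/
lemma isAffineOpen_of_isFinite (h : IsFinite (toLine a)) :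
    IsAffineOpen U ∧ (evalHom a).Finite := by
  have hU : IsAffineOpen U := isAffine_of_isAffineHom (toLine a)
  refine ⟨hU, ?_⟩
  have : U.toSpecΓ = hU.isoSpec.hom := rfl
  have h1 : Spec.map (CommRingCat.ofHom (evalHom a)) = hU.isoSpec.inv ≫ toLine a := by
    rw [toLine, this, Iso.inv_hom_id_assoc]
  have h2 : IsFinite (Spec.map (CommRingCat.ofHom (evalHom a))) := by
    rw [h1]
    infer_instance
  exact (IsFinite.SpecMap_iff _).mp h2

lemma ord_toK {x : C.X} (hx : x ≠ genericPoint C.X) {V : C.X.Opens}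
    (hV : genericPoint C.X ∈ V) (hxV : x ∈ V) {b : Γ(C.X, V)} (hb : b ≠ 0) :
    C.X.ord (toK hV b) x = ((Ring.ord _ (C.X.presheaf.germ V x hxV b)).toNat : ℤ) := by
  rw [toK_eq_algebraMap hV hxV, ord_algebraMap hx]
  rwa [Ne, ← map_zero (C.X.presheaf.germ V x hxV).hom,
    (germ_injective_of_isIntegral C.X x hxV).eq_iff]

variable (C) in
lemma ord_one (x : C.X) : C.X.ord (1 : C.X.functionField) x = 0 := by
  have := Scheme.ord_mul (x := x) (one_ne_zero (α := C.X.functionField)) one_ne_zero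
  rw [mul_one] at this
  exact left_eq_add.mp this

lemma ord_inv {t : C.X.functionField} (ht : t ≠ 0) (x : C.X) : C.X.ord t⁻¹ x = - C.X.ord t x := by
  have := Scheme.ord_mul (x := x) ht (inv_ne_zero ht)
  rw [mul_inv_cancel₀ ht, ord_one] at this
  linarith

variable [IsAlgClosed k]

/-- The number of zeros of a non-constant rational function `t`, counted with multiplicities, is
`[k(X) : k(t)]`: the zeros form the fibre over `0` of a finite morphism to the affine line, and the
multiplicities are the ramification indices. -/
lemma finsum_ord_eq_finrank {t : C.X.functionField} (ht : Transcendental k t) :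
    (Function.support fun x => max (C.X.ord t x) 0).Finite ∧
      ∑ᶠ x, max (C.X.ord t x) 0 = Module.finrank k⟮t⟯ C.X.functionField := by
  have ht0 : t ≠ 0 := fun h => ht (h ▸ isAlgebraic_zero)
  obtain ⟨U, hU, a, rfl, ha⟩ := exists_domain ht0
  obtain ⟨hUa, hfin⟩ := isAffineOpen_of_isFinite (isFinite_toLine hU ha ht)
  have : Nonempty U := ⟨⟨_, hU⟩⟩
  algebraize [evalHom a]
  let : Algebra Γ(C.X, U) C.X.functionField := (toK hU).toAlgebra
  have : IsFractionRing Γ(C.X, U) C.X.functionField :=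
    functionField_isFractionRing_of_isAffineOpen C.X U hUa
  have hrank := finrank_eq_finrank_adjoin (A := Γ(C.X, U)) ht (toK_evalHom hU)
  have : FaithfulSMul k[X] Γ(C.X, U) := by
    rw [faithfulSMul_iff_algebraMap_injective, injective_iff_map_eq_zero]
    intro p hp
    refine (transcendental_iff.mp ht) p ?_
    rw [← toK_evalHom]
    exact (congr_arg (toK hU) hp).trans (map_zero _)
  have hfinp : Finite ((Ideal.span {(X : k[X])}).primesOver Γ(C.X, U)) :=
    Algebra.QuasiFinite.finite_primesOver _
  have := Fintype.ofFinite ((Ideal.span {(X : k[X])}).primesOver Γ(C.X, U))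
  have ha0 : a ≠ 0 := fun h => ht0 (by rw [h, map_zero])
  let j : (Ideal.span {(X : k[X])}).primesOver Γ(C.X, U) → C.X := fun q =>
    hUa.fromSpec (⟨q.1, q.2.1⟩ : PrimeSpectrum Γ(C.X, U))
  have hj : Function.Injective j := fun q q' h => by
    have := hUa.fromSpec.isOpenEmbedding.injective h
    exact Subtype.ext (congr_arg PrimeSpectrum.asIdeal this)
  have hmem : ∀ q, j q ∈ U := fun q => by
    have : j q ∈ Set.range hUa.fromSpec := ⟨_, rfl⟩
    rwa [hUa.range_fromSpec] at this
  have hX : algebraMap k[X] Γ(C.X, U) X = a := by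
    change evalHom a X = a
    simp [evalHom]
  have haq : ∀ q : (Ideal.span {(X : k[X])}).primesOver Γ(C.X, U), a ∈ q.1 := fun q => by
    have := q.2.2
    rw [← hX, ← Ideal.mem_comap]
    exact (this.over ▸ Ideal.mem_span_singleton_self X : X ∈ q.1.under k[X])
  have hval : ∀ q, max (C.X.ord (toK hU a) (j q)) 0 = (q.1.ramificationIdx k[X] : ℤ) := by
    intro q
    have := q.2.1
    have := q.2.2
    let : Algebra Γ(C.X, U) (C.X.presheaf.stalk (j q)) :=
      (C.X.presheaf.germ U (j q) (hmem q)).hom.toAlgebra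
    have hloc : IsLocalization.AtPrime (C.X.presheaf.stalk (j q)) q.1 :=
      hUa.isLocalization_stalk' ⟨q.1, q.2.1⟩ (hmem q)
    have hau : ¬ IsUnit (C.X.presheaf.germ U (j q) (hmem q) a) := fun h =>
      (IsLocalization.AtPrime.isUnit_to_map_iff (C.X.presheaf.stalk (j q)) q.1 a).mp h (haq q)
    have hne : j q ≠ genericPoint C.X := fun h => hau <| by
      have key : ∀ (y : C.X) (hy : y ∈ U), y = genericPoint C.X →
          IsUnit (C.X.presheaf.germ U y hy a) := by
        rintro _ _ rfl
        exact IsUnit.mk0 _ ht0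
      exact key _ _ h
    rw [ord_toK hne hU (hmem q) ha0, ramificationIdx_eq_ord
      (O := C.X.presheaf.stalk (j q)) q.1 X, hX]
    exact max_eq_left (Nat.cast_nonneg _)
  -- all zeros lie in the fibre, in particular in the domain of `t`
  have hsupp : (Function.support fun x => max (C.X.ord (toK hU a) x) 0) ⊆ Set.range j := by
    intro x hx
    have hpos : 0 < C.X.ord (toK hU a) x := by
      by_contra h
      exact hx (max_eq_right (not_lt.mp h))
    have hxη : x ≠ genericPoint C.X := by
      rintro rfl
      rw [ord_genericPoint] at hpos
      exact lt_irrefl _ hpos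
    have := isDiscreteValuationRing_stalk hxη
    have hxU : x ∈ U := by
      by_contra hxU
      obtain ⟨V, hV, hxV, b, hb, -⟩ := ha x hxU
      have hb0 : toK hV b ≠ 0 := left_ne_zero_of_mul_eq_one hb
      have h1 := Scheme.ord_mul (x := x) hb0 ht0
      rw [hb, ord_one, ord_toK hxη hV hxV fun h => hb0 (by rw [h, map_zero])] at h1
      have := Nat.cast_nonneg (α := ℤ) (Ring.ord _ (C.X.presheaf.germ V x hxV b)).toNat
      linarith
    rw [ord_toK hxη hU hxU ha0, Nat.cast_pos, ord_toNat_pos fun h => ha0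
      (germ_injective_of_isIntegral C.X x hxU (h.trans (map_zero _).symm))] at hpos
    let : Algebra Γ(C.X, U) (C.X.presheaf.stalk x) := (C.X.presheaf.germ U x hxU).hom.toAlgebra
    have hloc : IsLocalization.AtPrime (C.X.presheaf.stalk x) (hUa.primeIdealOf ⟨x, hxU⟩).asIdeal :=
      hUa.isLocalization_stalk ⟨x, hxU⟩
    have hmemq : a ∈ (hUa.primeIdealOf ⟨x, hxU⟩).asIdeal := by
      by_contra h
      exact hpos ((IsLocalization.AtPrime.isUnit_to_map_iff _ _ a).mpr h)
    have hover : (hUa.primeIdealOf ⟨x, hxU⟩).asIdeal.LiesOver (Ideal.span {(X : k[X])}) := by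
      have hmax : (Ideal.span {(X : k[X])}).IsMaximal :=
        PrincipalIdealRing.isMaximal_of_irreducible irreducible_X
      refine ⟨hmax.eq_of_le (Ideal.IsPrime.ne_top inferInstance) ?_⟩
      rw [Ideal.span_singleton_le_iff_mem, Ideal.mem_comap, hX]
      exact hmemq
    exact ⟨⟨(hUa.primeIdealOf ⟨x, hxU⟩).asIdeal, inferInstance, hover⟩,
      hUa.fromSpec_primeIdealOf ⟨x, hxU⟩⟩
  refine ⟨(Set.finite_range j).subset hsupp, ?_⟩
  rw [← hrank, ← sum_ramificationIdx_eq_finrank, Nat.cast_sum, ← finsum_eq_sum_of_fintype,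
    ← finsum_mem_univ, ← finsum_mem_inter_support_eq _ (Set.range j) Set.univ (by
      rw [Set.univ_inter, Set.inter_eq_right.mpr hsupp]), finsum_mem_range hj]
  exact finsum_congr hval

/-- A principal divisor has finite support and degree `0`: a non-constant rational function `t` has
`[k(X) : k(t)]` zeros and, since `k(t) = k(t⁻¹)`, as many poles. -/
lemma finsum_ord_eq_zero {t : C.X.functionField} (ht0 : t ≠ 0) :
    (Function.support fun x => C.X.ord t x).Finite ∧ ∑ᶠ x, C.X.ord t x = 0 := by
  by_cases ht : IsAlgebraic k t
  · -- an algebraic `t` is a constant, `k` being algebraically closed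
    have hz : ∀ x, C.X.ord t x = 0 := by
      intro x
      have : Algebra.IsIntegral k k⟮t⟯ :=
        Algebra.isAlgebraic_iff_isIntegral.mp (isAlgebraic_adjoin_simple ht.isIntegral)
      obtain ⟨c, hc⟩ := (IsAlgClosed.algebraMap_bijective_of_isIntegral (k := k)
        (K := k⟮t⟯)).2 (AdjoinSimple.gen k t)
      have hct : toK (U := ⊤) trivial (constants C ⊤ c) = t := congr_arg Subtype.val hc
      have hc0 : c ≠ 0 := by
        rintro rfl
        rw [map_zero, map_zero] at hct
        exact ht0 hct.symm
      have : Nonempty (⊤ : C.X.Opens) := ⟨⟨x, trivial⟩⟩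
      rw [← hct]
      exact Scheme.ord_of_isUnit ((IsUnit.mk0 c hc0).map _) trivial
    simp [hz]
  · obtain ⟨h1, h2⟩ := finsum_ord_eq_finrank ht
    have ht' : Transcendental k t⁻¹ := fun h => ht (by simpa using h.inv)
    obtain ⟨h3, h4⟩ := finsum_ord_eq_finrank ht'
    have hadj : k⟮t⁻¹⟯ = k⟮t⟯ := le_antisymm
      (adjoin_simple_le_iff.mpr (inv_mem (mem_adjoin_simple_self k t)))
      (adjoin_simple_le_iff.mpr (by simpa using inv_mem (mem_adjoin_simple_self k t⁻¹)))
    have hx : ∀ x, C.X.ord t x = max (C.X.ord t x) 0 - max (C.X.ord t⁻¹ x) 0 := fun x => by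
      rw [ord_inv ht0]
      rcases le_total (C.X.ord t x) 0 with h | h
      · rw [max_eq_right h, max_eq_left (by linarith)]; ring
      · rw [max_eq_left h, max_eq_right (by linarith)]; ring
    constructor
    · refine (h1.union h3).subset fun x h => ?_
      by_contra h'
      rw [Set.mem_union, not_or, Function.notMem_support, Function.notMem_support] at h'
      exact h ((hx x).trans (by rw [h'.1, h'.2, sub_zero]))
    · rw [finsum_congr hx, finsum_sub_distrib h1 h3, h2, h4, hadj, sub_self]

end PrincipalDivisors

/-! ### Saturated subobjects -/

section Saturation

lemma sum_eq_sum_castAdd_add_sum_natAdd {p q n : ℕ} (h : p + q = n) {M : Type*} [AddCommMonoid M]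
    (f : Fin n → M) : ∑ i, f i =
      ∑ i : Fin p, f (Fin.cast h (Fin.castAdd q i)) +
        ∑ j : Fin q, f (Fin.cast h (Fin.natAdd p j)) := by
  subst h
  exact Fin.sum_univ_add f

/-- A subspace of `K ^ n`, where `K` is the fraction field of a principal ideal domain `R`, is
spanned by some members of a basis of `R ^ n`, given here by the columns of an invertible matrix. -/
lemma exists_adapted_matrix {R K : Type*} [CommRing R] [IsDomain R] [IsPrincipalIdealRing R]
    [Field K] [Algebra R K] [IsFractionRing R K] {n : ℕ} (W : Submodule K (Fin n → K)) :
    ∃ (p q : ℕ) (h : p + q = n) (P Q : Matrix (Fin n) (Fin n) R), P * Q = 1 ∧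
      ∀ c : Fin n → K, (P.map (algebraMap R K)).mulVec c ∈ W ↔
        ∀ j : Fin q, c (Fin.cast h (Fin.natAdd p j)) = 0 := by
  let ι : (Fin n → R) →ₗ[R] (Fin n → K) := (Algebra.linearMap R K).compLeft (Fin n)
  let N : Submodule R (Fin n → R) := (W.restrictScalars R).comap ι
  have hN : ∀ v, v ∈ N ↔ (fun i => algebraMap R K (v i)) ∈ W := fun v => Iff.rfl
  -- the quotient by `N = W ∩ R ^ n` is torsion-free, hence free, and a basis of `N` together with
  -- lifts of a basis of the quotient is a basis of `R ^ n`
  have htf : Module.IsTorsionFree R ((Fin n → R) ⧸ N) := by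
    refine Module.IsTorsionFree.mk fun a ha => ?_
    have ha0 : algebraMap R K a ≠ 0 := by
      rw [Ne, FaithfulSMul.algebraMap_eq_zero_iff]
      exact ha.ne_zero
    intro x y hxy
    rw [← sub_eq_zero]
    have hxy' : a • (x - y) = 0 := by rw [smul_sub, sub_eq_zero]; exact hxy
    obtain ⟨v, hv⟩ := N.mkQ_surjective (x - y)
    rw [← hv] at hxy' ⊢
    rw [← map_smul, Submodule.mkQ_apply, Submodule.Quotient.mk_eq_zero, hN] at hxy'
    rw [Submodule.mkQ_apply, Submodule.Quotient.mk_eq_zero, hN]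
    have := W.smul_mem (algebraMap R K a)⁻¹ hxy'
    convert this using 1
    ext i
    simp [ha0]
  let bN := Module.finBasis R N
  let bQ := Module.finBasis R ((Fin n → R) ⧸ N)
  let b := (Module.Basis.sumQuot bN bQ).reindex finSumFinEquiv
  have hn : Module.finrank R N + Module.finrank R ((Fin n → R) ⧸ N) = n := by
    have := Module.finrank_eq_card_basis b
    simpa using this.symm
  refine ⟨_, _, hn, ?_⟩
  let b' := b.reindex (finCongr hn)
  let e := Pi.basisFun R (Fin n)
  refine ⟨e.toMatrix b', b'.toMatrix e, e.toMatrix_mul_toMatrix_flip b', fun c => ?_⟩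
  have hb : ∀ i j, (e.toMatrix b') i j = b' j i := fun i j => by simp [e, Module.Basis.toMatrix]
  have hleft : ∀ i, b' (Fin.cast hn (Fin.castAdd _ i)) = bN i := fun i => by
    simp [b', b, finCongr]
  have hright : ∀ j, N.mkQ (b' (Fin.cast hn (Fin.natAdd _ j))) = bQ j := fun j => by
    simp [b', b, finCongr]
  have hmul : ((e.toMatrix b').map (algebraMap R K)).mulVec c =
      ∑ j, c j • fun i => algebraMap R K (b' j i) := by
    ext i
    simp [Matrix.mulVec, dotProduct, hb, mul_comm]
  rw [hmul]
  constructor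
  · intro h j
    obtain ⟨d, hd⟩ := IsLocalization.exist_integer_multiples_of_finite (nonZeroDivisors R) c
    choose c' hc' using hd
    have hd0 : algebraMap R K d ≠ 0 := by
      rw [Ne, FaithfulSMul.algebraMap_eq_zero_iff]
      exact nonZeroDivisors.ne_zero d.2
    have hmem : ∑ j, c' j • b' j ∈ N := by
      rw [hN]
      have := W.smul_mem (algebraMap R K d) h
      convert this using 1
      ext i
      simp only [Finset.sum_apply, Pi.smul_apply, smul_eq_mul, map_sum, map_mul, hc',
        Finset.mul_sum]
      exact Finset.sum_congr rfl fun j _ => by rw [Algebra.smul_def, mul_assoc]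
    rw [← Submodule.ker_mkQ N, LinearMap.mem_ker, map_sum,
      sum_eq_sum_castAdd_add_sum_natAdd hn] at hmem
    simp only [map_smul, hleft, hright] at hmem
    have hz : ∀ i, N.mkQ (bN i : Fin n → R) = 0 := fun i =>
      (Submodule.Quotient.mk_eq_zero N).mpr (bN i).2
    simp only [hz, smul_zero, Finset.sum_const_zero, zero_add] at hmem
    have hc0 := Fintype.linearIndependent_iff.mp bQ.linearIndependent _ hmem j
    have := hc' (Fin.cast hn (Fin.natAdd _ j))
    rw [hc0, map_zero, Algebra.smul_def] at this
    exact (mul_eq_zero.mp this.symm).resolve_left hd0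
  · intro h
    rw [sum_eq_sum_castAdd_add_sum_natAdd hn]
    simp only [h, zero_smul, Finset.sum_const_zero, add_zero, hleft]
    exact W.sum_mem fun i _ => W.smul_mem _ ((hN _).mp (bN i).2)

variable {X : Scheme.{u}} [IsIntegral X] {E F G : X.Modules} {U V W : X.Opens} {r r' n : ℕ}

/-- The subspace of the generic fibre of `F` generated by the image of a morphism `E ⟶ F`. -/
noncomputable def genericImage (φ : E ⟶ F) (t : LocalFrame F r U) (hU : genericPoint X ∈ U) :
    Submodule X.functionField (Fin r → X.functionField) where
  carrier := {c | ∃ (V : X.Opens) (hV : genericPoint X ∈ V) (m : Γ(E, V)),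
    t.ratCoord hU hV (φ.app V m) = c}
  add_mem' := by
    rintro _ _ ⟨V, hV, m, rfl⟩ ⟨V', hV', m', rfl⟩
    refine ⟨V ⊓ V', mem_inf hV hV', res E inf_le_left m + res E inf_le_right m', ?_⟩
    rw [map_add, map_add, app_res, app_res, t.ratCoord_res hU hV, t.ratCoord_res hU hV']
  zero_mem' := ⟨U, hU, 0, by rw [map_zero, map_zero]⟩
  smul_mem' := by
    rintro c _ ⟨V, hV, m, rfl⟩
    obtain ⟨V', hV', a, rfl⟩ := exists_toK_eq c
    refine ⟨V ⊓ V', mem_inf hV hV', (resO inf_le_right a : Γ(X, V ⊓ V')) • res E inf_le_left m, ?_⟩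
    rw [app_smul, t.ratCoord_smul, toK_resO, app_res, t.ratCoord_res hU hV]

/-- The basis of `exists_adapted_matrix` over a local ring `𝒪_x`, spread out to a neighbourhood of
`x`. -/
lemma exists_adapted_sections (x : X) [IsPrincipalIdealRing (X.presheaf.stalk x)] {n : ℕ}
    (W : Submodule X.functionField (Fin n → X.functionField)) :
    ∃ (p q : ℕ) (h : p + q = n) (U : X.Opens) (_ : x ∈ U) (hU : genericPoint X ∈ U)
      (P : Matrix (Fin n) (Fin n) Γ(X, U)), IsUnit P.det ∧
      ∀ c : Fin n → X.functionField, (P.map (toK hU)).mulVec c ∈ W ↔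
        ∀ j : Fin q, c (Fin.cast h (Fin.natAdd p j)) = 0 := by
  obtain ⟨p, q, h, P, Q, hPQ, hW⟩ := exists_adapted_matrix (R := X.presheaf.stalk x) W
  obtain ⟨U, hx, a, ha⟩ := exists_germ_eq_pi x
    (Sum.elim (fun i : Fin n × Fin n => P i.1 i.2) (fun i : Fin n × Fin n => Q i.1 i.2))
  have hP : (Matrix.of fun i j => a (.inl (i, j))).map (X.presheaf.germ U x hx) = P := by
    ext i j; exact ha (.inl (i, j))
  have hQ : (Matrix.of fun i j => a (.inr (i, j))).map (X.presheaf.germ U x hx) = Q := by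
    ext i j; exact ha (.inr (i, j))
  have hU : genericPoint X ∈ U := genericPoint_mem hx
  refine ⟨p, q, h, U, hx, hU, Matrix.of fun i j => a (.inl (i, j)), ?_, fun c => ?_⟩
  · refine IsUnit.of_mul_eq_one (Matrix.det (Matrix.of fun i j => a (.inr (i, j)))) ?_
    rw [← Matrix.det_mul]
    convert Matrix.det_one (n := Fin n)
    have hinj : Function.Injective (X.presheaf.germ U x hx) := germ_injective_of_isIntegral X x hx
    apply Matrix.map_injective hinj
    have := Matrix.map_mul (f := (X.presheaf.germ U x hx).hom)
      (L := Matrix.of fun i j => a (.inl (i, j))) (M := Matrix.of fun i j => a (.inr (i, j)))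
    refine this.trans ?_
    rw [hP, hQ, hPQ]
    exact (Matrix.map_one _ (map_zero _) (map_one _)).symm
  · rw [← hW]
    have : (Matrix.of fun i j => a (.inl (i, j))).map (toK hU) =
        P.map (algebraMap (X.presheaf.stalk x) X.functionField) := by
      rw [← hP]
      ext i j
      have : Nonempty U := ⟨⟨x, hx⟩⟩
      exact (Scheme.algebraMap_germ_eq_germToFunctionField X hx _).symm
    rw [this]

/-- The length of a frame over a non-empty open set is determined by the module. -/
lemma LocalFrame.length_eq (s : LocalFrame E r U) (t : LocalFrame E r' V)
    (hU : genericPoint X ∈ U) (hV : genericPoint X ∈ V) : r = r' := by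
  have h1 : ratMatrix (𝟙 E) s t hU hV * ratMatrix (𝟙 E) t s hV hU = 1 := by
    rw [← ratMatrix_comp, Category.comp_id, ratMatrix_id]
  have h2 : ratMatrix (𝟙 E) t s hV hU * ratMatrix (𝟙 E) s t hU hV = 1 := by
    rw [← ratMatrix_comp, Category.comp_id, ratMatrix_id]
  have e : (Fin r → X.functionField) ≃ₗ[X.functionField] (Fin r' → X.functionField) :=
    LinearEquiv.ofLinearMap (Matrix.mulVecLin (ratMatrix (𝟙 E) s t hU hV))
      (Matrix.mulVecLin (ratMatrix (𝟙 E) t s hV hU))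
      (by rw [← Matrix.mulVecLin_mul, h1, Matrix.mulVecLin_one])
      (by rw [← Matrix.mulVecLin_mul, h2, Matrix.mulVecLin_one])
  simpa using e.finrank_eq

lemma subsingleton_of_genericPoint_notMem (hU : genericPoint X ∉ U) : Subsingleton Γ(E, U) := by
  have hbot : U = ⊥ := by
    rw [eq_bot_iff]
    exact fun x hx => (hU (genericPoint_mem hx)).elim
  exact ⟨fun m n => eq_of_res_eq fun x hx => by
    rw [hbot] at hx
    exact hx.elim⟩

/-- A subobject `i : F ⟶ E` is saturated if a section of `E` belongs to it as soon as it does so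
near the generic point, that is, if the quotient is torsion-free. -/
def IsSaturated (i : F ⟶ E) : Prop :=
  ∀ (U V : X.Opens) (h : V ≤ U) (m : Γ(E, U)), genericPoint X ∈ V →
    (∃ n, i.app V n = res E h m) → ∃ n, i.app U n = m

lemma ratMatrix_change (s : LocalFrame E r U) (P : Matrix (Fin r) (Fin r) Γ(X, U))
    (hP : IsUnit P.det) (hU : genericPoint X ∈ U) :
    ratMatrix (𝟙 E) (s.change P hP) s hU hU = P.map (toK hU) := by
  ext i j
  change s.ratCoord hU hU (∑ i, P i j • s.sec i) i = toK hU (P i j)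
  rw [map_sum, Finset.sum_apply, Finset.sum_eq_single i]
  · simp [LocalFrame.ratCoord_smul, LocalFrame.ratCoord_sec]
  · intro b _ hb
    simp [LocalFrame.ratCoord_smul, LocalFrame.ratCoord_sec, Pi.single_eq_of_ne hb.symm]
  · simp

/-- If all local rings of `X` are principal ideal domains, then a saturated subobject of a vector
bundle is a sub-bundle: locally a basis of the subobject extends to a basis of the bundle. -/
lemma IsSaturated.exists_hasRank [∀ x : X, IsPrincipalIdealRing (X.presheaf.stalk x)]
    {S : ShortComplex X.Modules} (hS : S.ShortExact) (hE : HasRank S.X₂ n)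
    (hsat : IsSaturated S.f) :
    ∃ p q, p + q = n ∧ HasRank S.X₁ p ∧ HasRank S.X₃ q := by
  have hloc : ∀ x : X, ∃ (p q : ℕ) (U : X.Opens), p + q = n ∧ x ∈ U ∧
      Nonempty (LocalFrame S.X₁ p U) ∧ Nonempty (LocalFrame S.X₃ q U) := by
    intro x
    obtain ⟨U, hx, ⟨s⟩⟩ := hE.exists_frame x
    have hU := genericPoint_mem hx
    obtain ⟨p, q, rfl, V, hxV, hV, P, hP, hW⟩ := exists_adapted_sections x (genericImage S.f s hU)
    have hxW : x ∈ U ⊓ V := mem_inf hx hxV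
    have hUV := genericPoint_mem hxW
    let P' := (resO (inf_le_right : U ⊓ V ≤ V)).mapMatrix P
    have hP' : IsUnit P'.det := by
      rw [← RingHom.map_det]
      exact hP.map _
    -- the members of this frame indexed by `Fin.castAdd` span the subobject
    let s' := (s.restrict (inf_le_left : U ⊓ V ≤ U)).change P' hP'
    have hs : ∀ (W : X.Opens) (h : W ≤ U ⊓ V) (m : Γ(S.X₂, W)),
        (∃ n, S.f.app W n = m) ↔ ∀ j : Fin q, s'.coord h m (Fin.natAdd p j) = 0 := by
      intro W h m
      by_cases hη : genericPoint X ∈ W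
      · have hc : s.ratCoord hU hη m = (P.map (toK hV)).mulVec (s'.ratCoord hUV hη m) := by
          have h1 := ratMatrix_mulVec (𝟙 S.X₂) s' (s.restrict (inf_le_left : U ⊓ V ≤ U)) hUV hUV hη
            m
          rw [ratMatrix_change, LocalFrame.ratCoord_restrict _ hU] at h1
          refine Eq.trans ?_ (h1.symm.trans (congr_arg (fun M => Matrix.mulVec M _) ?_))
          · rfl
          · ext i j
            exact toK_resO hUV inf_le_right (P i j)
        -- here saturatedness is used
        have himage : (∃ n, S.f.app W n = m) ↔ s.ratCoord hU hη m ∈ genericImage S.f s hU := by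
          constructor
          · rintro ⟨n, rfl⟩
            exact ⟨W, hη, n, rfl⟩
          · rintro ⟨V', hV', n, hn⟩
            refine hsat W (W ⊓ V') inf_le_left m (mem_inf hη hV') ⟨res _ inf_le_right n, ?_⟩
            apply s.ratCoord_injective hE hU (mem_inf hη hV')
            rw [app_res, s.ratCoord_res hU hV', hn, s.ratCoord_res hU hη]
        rw [himage, hc, hW, LocalFrame.ratCoord_of_le s' hUV h hη]
        exact forall_congr' fun j => map_eq_zero_iff _ (toK_injective hη)
      · have h1 := subsingleton_of_genericPoint_notMem (E := S.X₂) hη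
        have h2 : Subsingleton Γ(X, W) := ⟨fun a b => eqO_of_resO_eq fun x hx =>
          (hη (genericPoint_mem hx)).elim⟩
        exact ⟨fun _ j => Subsingleton.elim _ _, fun _ => ⟨0, Subsingleton.elim _ _⟩⟩
    exact ⟨p, q, U ⊓ V, rfl, hxW, LocalFrame.nonempty_sub hS s' hs,
      LocalFrame.nonempty_quotient hS s' hs⟩
  choose p q U hpq hxU hF hG using hloc
  have hconst : ∀ x y, p x = p y := fun x y =>
    (hF x).some.length_eq (hF y).some (genericPoint_mem (hxU x)) (genericPoint_mem (hxU y))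
  have hp : ∀ x, p x = p (genericPoint X) := fun x => hconst _ _
  have hq : ∀ x, q x = q (genericPoint X) := fun x => by
    have h1 := hpq x
    have h2 := hpq (genericPoint X)
    have h3 := hp x
    omega
  exact ⟨_, _, hpq (genericPoint X), .of_frames fun x => ⟨U x, hxU x, hp x ▸ hF x⟩,
    .of_frames fun x => ⟨U x, hxU x, hq x ▸ hG x⟩⟩

end Saturation

/-! ### Vector bundles and sub-bundles -/

section Abelian

variable {𝒜 : Type v} [Category.{w} 𝒜] [Abelian 𝒜] {X Y Z : 𝒜}

lemma shortExact_kernel (g : X ⟶ Y) [Epi g] :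
    (ShortComplex.mk (kernel.ι g) g (kernel.condition g)).ShortExact :=
  { exact := ShortComplex.exact_kernel g, mono_f := inferInstance, epi_g := inferInstance }

lemma shortExact_cokernel (f : X ⟶ Y) [Mono f] :
    (ShortComplex.mk f (cokernel.π f) (cokernel.condition f)).ShortExact :=
  { exact := ShortComplex.exact_cokernel f, mono_f := inferInstance, epi_g := inferInstance }

/-- The short exact sequence `Y / X ⟶ Z / X ⟶ Z / Y`. -/
lemma exists_shortExact_cokernel_comp (f : X ⟶ Y) (g : Y ⟶ Z) [Mono g] :
    ∃ (i : cokernel f ⟶ cokernel (f ≫ g)) (p : cokernel (f ≫ g) ⟶ cokernel g) (w : i ≫ p = 0),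
      (ShortComplex.mk i p w).ShortExact := by
  let D := kernelCokernelCompSequence.snakeInput f g
  have hz : IsZero D.L₀.X₃ := isZero_kernel_of_mono g
  have hm : Mono D.L₃.f := D.L₂'_exact.mono_g (hz.eq_of_src _ _)
  have hp : Epi D.L₂.g := inferInstanceAs (Epi (biprod.snd : Y ⊞ Z ⟶ Z))
  exact ⟨D.L₃.f, D.L₃.g, D.L₃.zero, { exact := D.L₃_exact, mono_f := hm, epi_g := D.epi_L₃_g }⟩

/-- The short exact sequence `ker f ⟶ ker (f ≫ g) ⟶ ker g`. -/
lemma exists_shortExact_kernel_comp (f : X ⟶ Y) (g : Y ⟶ Z) [Epi f] :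
    ∃ (i : kernel f ⟶ kernel (f ≫ g)) (p : kernel (f ≫ g) ⟶ kernel g) (w : i ≫ p = 0),
      (ShortComplex.mk i p w).ShortExact := by
  let D := kernelCokernelCompSequence.snakeInput f g
  have hz : IsZero D.L₃.X₁ := isZero_cokernel_of_epi f
  have he : Epi D.L₀.g := D.L₁'_exact.epi_f (hz.eq_of_tgt _ _)
  have hi : Mono D.L₁.f := inferInstanceAs (Mono (biprod.inl : X ⟶ X ⊞ Y))
  exact ⟨D.L₀.f, D.L₀.g, D.L₀.zero, { exact := D.L₀_exact, mono_f := D.mono_L₀_f, epi_g := he }⟩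

end Abelian

section Bundles

variable {X : Scheme.{u}} {E F G : X.Modules} {U V W : X.Opens} {r r' n : ℕ}

/-- The image of a frame under an isomorphism. -/
noncomputable def LocalFrame.map (s : LocalFrame E r U) (φ : E ⟶ F) [IsIso φ] :
    LocalFrame F r U where
  sec i := φ.app U (s.sec i)
  existsUnique V h m := by
    obtain ⟨m, rfl⟩ := (app_bijective φ V).2 m
    have key : ∀ c : Fin r → Γ(X, V), φ.app V m = ∑ i, c i • res F h (φ.app U (s.sec i)) ↔
        m = ∑ i, c i • res E h (s.sec i) := fun c => by
      rw [← (app_bijective φ V).1.eq_iff, map_sum]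
      simp only [app_smul, app_res]
    simp only [key]
    exact s.existsUnique V h m

lemma HasRank.of_iso (hE : HasRank E r) (e : E ≅ F) : HasRank F r :=
  .of_frames fun x => by
    obtain ⟨U, hx, ⟨s⟩⟩ := hE.exists_frame x
    exact ⟨U, hx, ⟨s.map e.hom⟩⟩

lemma IsVectorBundle.of_iso (hE : IsVectorBundle E) (e : E ≅ F) : IsVectorBundle F := by
  obtain ⟨r, hr⟩ := hE
  exact ⟨r, hr.of_iso e⟩

lemma hasRank_zero_iff : HasRank E 0 ↔ IsZero E := by
  constructor
  · intro h
    refine isZero_of_subsingleton fun U => ⟨fun m m' => eq_of_res_eq fun x hx => ?_⟩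
    obtain ⟨V, hxV, ⟨s⟩⟩ := h.exists_frame x
    exact ⟨U ⊓ V, inf_le_left, mem_inf hx hxV,
      s.coord_injective inf_le_right (Subsingleton.elim _ _)⟩
  · intro h
    have := subsingleton_of_isZero h
    exact .of_frames fun x => ⟨⊤, trivial, ⟨⟨Fin.elim0, fun V hV m =>
      ⟨Fin.elim0, by simpa using Subsingleton.elim _ _, fun _ _ => Subsingleton.elim _ _⟩⟩⟩⟩

lemma IsVectorBundle.of_isZero (h : IsZero E) : IsVectorBundle E := ⟨0, hasRank_zero_iff.mpr h⟩

lemma IsVectorBundle.extension {S : ShortComplex X.Modules} (hS : S.ShortExact)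
    (h₁ : IsVectorBundle S.X₁) (h₃ : IsVectorBundle S.X₃) : IsVectorBundle S.X₂ := by
  obtain ⟨r, hr⟩ := h₁
  obtain ⟨r', hr'⟩ := h₃
  exact ⟨_, hr.extension hS hr'⟩

variable [IsIntegral X]

lemma rank_eq_of_iso (hE : IsVectorBundle E) (e : E ≅ F) : rank F = rank E :=
  rank_eq (hE.hasRank.of_iso e)

lemma rank_eq_zero_iff (hE : IsVectorBundle E) : rank E = 0 ↔ IsZero E := by
  rw [← hasRank_zero_iff]
  exact ⟨fun h => h ▸ hE.hasRank, rank_eq⟩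

lemma rank_add {S : ShortComplex X.Modules} (hS : S.ShortExact) (h₁ : IsVectorBundle S.X₁)
    (h₃ : IsVectorBundle S.X₃) : rank S.X₂ = rank S.X₁ + rank S.X₃ :=
  rank_eq (h₁.hasRank.extension hS h₃.hasRank)

lemma rank_le_of_mono (hE : IsVectorBundle E) (hF : IsVectorBundle F) (φ : E ⟶ F) [Mono φ] :
    rank E ≤ rank F := hE.hasRank.le_of_mono hF.hasRank φ

/-- The saturation of the image of a morphism: the subsheaf of the sections which belong to the
image near the generic point. The condition is empty over the empty open set. -/
noncomputable def saturation (φ : F ⟶ E) : LocalSubmodule E where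
  carrier U :=
    { carrier := {m | ∀ _ : genericPoint X ∈ U, ∃ (V : X.Opens) (h : V ≤ U), genericPoint X ∈ V ∧
        ∃ n, φ.app V n = res E h m}
      add_mem' := fun {a b} ha hb hU => by
        obtain ⟨V, hV, hxV, n, hn⟩ := ha hU
        obtain ⟨V', hV', hxV', n', hn'⟩ := hb hU
        refine ⟨V ⊓ V', inf_le_left.trans hV, mem_inf hxV hxV',
          res F inf_le_left n + res F inf_le_right n', ?_⟩
        rw [map_add, app_res, app_res, hn, hn']
        simp
      zero_mem' := fun hU => ⟨U, le_rfl, hU, 0, by simp⟩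
      smul_mem' := fun c m hm hU => by
        obtain ⟨V, hV, hxV, n, hn⟩ := hm hU
        exact ⟨V, hV, hxV, resO hV c • n, by rw [app_smul, hn, res_smul]⟩ }
  res_mem {U V} h m hm hV := by
    obtain ⟨W, hW, hxW, n, hn⟩ := hm (h hV)
    refine ⟨W ⊓ V, inf_le_right, mem_inf hxW hV, res F inf_le_left n, ?_⟩
    rw [app_res, hn]
    simp
  mem_of_local {U m} h hU := by
    obtain ⟨V, hV, hxV, hm⟩ := h _ hU
    obtain ⟨W, hW, hxW, n, hn⟩ := hm hxV
    exact ⟨W, hW.trans hV, hxW, n, by rw [hn, res_res]⟩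

lemma isSaturated_saturation (φ : F ⟶ E) : IsSaturated (saturation φ).ι := by
  rintro U V h m hV ⟨n, hn⟩
  refine (saturation φ).exists_ι_app fun hU => ?_
  obtain ⟨W, hW, hxW, n', hn'⟩ := (saturation φ).ι_app_mem V n hV
  exact ⟨W, hW.trans h, hxW, n', by rw [hn', hn, res_res]⟩

lemma isSaturated_kernel (φ : E ⟶ G) (hG : IsVectorBundle G) : IsSaturated (kernel.ι φ) := by
  rintro U V h m hV ⟨n, hn⟩
  have hm : φ.app U m = 0 := by
    apply res_injective hG.hasRank h hV
    rw [← app_res, ← hn, ← app_comp, kernel.condition, res_zero]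
    rfl
  obtain ⟨n', hn'⟩ := (kerSub φ).exists_ι_app (m := m) hm
  refine ⟨(kernel.lift φ (kerSub φ).ι ?_).app U n', ?_⟩
  · ext V n
    exact (kerSub φ).ι_app_mem V n
  · rw [← app_comp, kernel.lift_ι, hn']

section PrincipalIdealRing

variable [∀ x : X, IsPrincipalIdealRing (X.presheaf.stalk x)]

lemma IsSaturated.isSubbundle {i : F ⟶ E} [Mono i] (hi : IsSaturated i) (hE : IsVectorBundle E) :
    IsSubbundle i := by
  obtain ⟨p, q, -, hp, hq⟩ := IsSaturated.exists_hasRank (shortExact_cokernel i) hE.hasRank hi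
  exact ⟨inferInstance, ⟨p, hp⟩, ⟨q, hq⟩⟩

lemma isSubbundle_kernel (φ : E ⟶ G) (hE : IsVectorBundle E) (hG : IsVectorBundle G) :
    IsSubbundle (kernel.ι φ) :=
  (isSaturated_kernel φ hG).isSubbundle hE

/-- Every subobject of a vector bundle which is a vector bundle is contained in a sub-bundle of the
same rank. -/
lemma exists_isSubbundle (i : F ⟶ E) [Mono i] (hF : IsVectorBundle F) (hE : IsVectorBundle E) :
    ∃ (F' : X.Modules) (j : F ⟶ F') (i' : F' ⟶ E), j ≫ i' = i ∧ Mono j ∧ IsSubbundle i' ∧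
      rank F' = rank F := by
  have hsub := (isSaturated_saturation i).isSubbundle hE
  obtain ⟨j, hj⟩ := (saturation i).exists_lift i
    (fun U m hU => ⟨U, le_rfl, hU, m, by simp⟩)
  have hmono : Mono (j ≫ (saturation i).ι) := by rw [hj]; infer_instance
  have : Mono j := mono_of_mono j (saturation i).ι
  refine ⟨_, j, (saturation i).ι, hj, this, hsub, ?_⟩
  refine (hF.hasRank.eq_of_generically_surjective hsub.2.1.hasRank j fun W m hW => ?_).symm
  obtain ⟨W', h, hW', n, hn⟩ := (saturation i).ι_app_mem W m hW
  refine ⟨W', h, hW', n, app_injective (saturation i).ι W' ?_⟩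
  rw [← app_comp, hj, hn, app_res]

end PrincipalIdealRing

end Bundles

/-! ### Degree -/

section Degree

section RatMatrix

variable {X : Scheme.{u}} [IsIntegral X] {E F G : X.Modules} {U V W : X.Opens} {r r' : ℕ}

/-- Over the function field, a transition matrix is the matrix of the identity with respect to the
two frames. -/
lemma toK_transition (s : LocalFrame E r U) (t : LocalFrame E r V) (hU : genericPoint X ∈ U)
    (hV : genericPoint X ∈ V) :
    (s.transition t).map (toK (mem_inf hU hV)) = ratMatrix (𝟙 E) s t hU hV := by
  ext i j
  have := t.ratCoord_of_le hV (inf_le_right : U ⊓ V ≤ V) (mem_inf hU hV)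
    (res E inf_le_left (s.sec j))
  rw [t.ratCoord_res hV hU] at this
  exact (congr_fun this i).symm

/-- The matrix of a morphism with respect to two frames has regular entries where both frames are
defined. -/
lemma exists_toK_ratMatrix (φ : E ⟶ F) (s : LocalFrame E r U) (t : LocalFrame F r' V)
    (hU : genericPoint X ∈ U) (hV : genericPoint X ∈ V) :
    ∃ M : Matrix (Fin r') (Fin r) Γ(X, U ⊓ V),
      M.map (toK (mem_inf hU hV)) = ratMatrix φ s t hU hV := by
  refine ⟨Matrix.of fun i j => t.coord (inf_le_right : U ⊓ V ≤ V)
    (res F inf_le_left (φ.app U (s.sec j))) i, ?_⟩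
  ext i j
  have := t.ratCoord_of_le hV (inf_le_right : U ⊓ V ≤ V) (mem_inf hU hV)
    (res F inf_le_left (φ.app U (s.sec j)))
  rw [t.ratCoord_res hV hU] at this
  exact (congr_fun this i).symm

lemma det_ratMatrix_ne_zero (φ : E ⟶ F) [Mono φ] (s : LocalFrame E r U) (t : LocalFrame F r V)
    (hU : genericPoint X ∈ U) (hV : genericPoint X ∈ V) (hF : HasRank F r) :
    (ratMatrix φ s t hU hV).det ≠ 0 := by
  have := Matrix.mulVec_injective_iff_isUnit.mp (ratMatrix_mulVec_injective φ s t hU hV hF)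
  exact ((Matrix.isUnit_iff_isUnit_det _).mp this).ne_zero

/-- With respect to the frames of an extension obtained from frames of its ends, the transition
matrix is block triangular. -/
lemma det_ratMatrix_extension {S : ShortComplex X.Modules} (hS : S.ShortExact)
    (s : LocalFrame S.X₁ r U) (t : LocalFrame S.X₃ r' U) (e : Fin r' → Γ(S.X₂, U))
    (he : ∀ i, S.g.app U (e i) = t.sec i)
    (s' : LocalFrame S.X₁ r V) (t' : LocalFrame S.X₃ r' V) (e' : Fin r' → Γ(S.X₂, V))
    (he' : ∀ i, S.g.app V (e' i) = t'.sec i) (hU : genericPoint X ∈ U) (hV : genericPoint X ∈ V) :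
    (ratMatrix (𝟙 S.X₂) (.extension hS s t e he) (.extension hS s' t' e' he') hU hV).det =
      (ratMatrix (𝟙 S.X₁) s s' hU hV).det * (ratMatrix (𝟙 S.X₃) t t' hU hV).det := by
  set D := LocalFrame.extension hS s t e he with hD
  set D' := LocalFrame.extension hS s' t' e' he' with hD'
  have hsec : ∀ i, D'.sec (Fin.castAdd r' i) = S.f.app V (s'.sec i) :=
    LocalFrame.extension_sec_castAdd hS s' t' e' he'
  have hsec' : ∀ j, D'.sec (Fin.natAdd r j) = e' j :=
    LocalFrame.extension_sec_natAdd hS s' t' e' he'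
  have hf : ratMatrix S.f s' D' hV hV = Matrix.of fun i j =>
      (Pi.single (Fin.castAdd r' j) 1 : Fin (r + r') → X.functionField) i := by
    ext i j
    change D'.ratCoord hV hV (S.f.app V (s'.sec j)) i = _
    rw [← hsec, D'.ratCoord_sec]
    rfl
  have hg : ratMatrix S.g D' t' hV hV = Matrix.of fun i j =>
      (Pi.single (Fin.natAdd r i) 1 : Fin (r + r') → X.functionField) j := by
    ext i j
    change t'.ratCoord hV hV (S.g.app V (D'.sec j)) i = _
    refine Fin.addCases (fun j => ?_) (fun j => ?_) j
    · rw [hsec, app_app_eq_zero, map_zero]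
      simp [Pi.single_apply, Fin.ext_iff]
      omega
    · rw [hsec', he', t'.ratCoord_sec]
      simp [Pi.single_apply, eq_comm]
  have ha : ∀ (n : Γ(S.X₁, U)) i, D'.ratCoord hV hU (S.f.app U n) i =
      Fin.append (s'.ratCoord hV hU n) 0 i := fun n i => by
    rw [← ratMatrix_mulVec S.f s' D' hV hV hU, hf]
    refine Fin.addCases (fun i => ?_) (fun i => ?_) i
    · simp [Matrix.mulVec, dotProduct, Pi.single_apply]
    · rw [Fin.append_right]
      have h : ∀ j : Fin r, Fin.natAdd r i ≠ Fin.castAdd r' j := fun j => by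
        simp only [ne_eq, Fin.ext_iff, Fin.val_natAdd, Fin.val_castAdd]
        omega
      simp [Matrix.mulVec, dotProduct, Pi.single_apply, h]
  have hb : ∀ (m : Γ(S.X₂, U)) j, D'.ratCoord hV hU m (Fin.natAdd r j) =
      t'.ratCoord hV hU (S.g.app U m) j := fun m j => by
    rw [← ratMatrix_mulVec S.g D' t' hV hV hU, hg]
    simp [Matrix.mulVec, dotProduct, Pi.single_apply]
  rw [← Matrix.det_fromBlocks_zero₂₁ _ (Matrix.of fun i j =>
    ratMatrix (𝟙 S.X₂) D D' hU hV (Fin.castAdd r' i) (Fin.natAdd r j)),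
    ← Matrix.det_submatrix_equiv_self finSumFinEquiv]
  congr 1
  ext (i | i) (j | j)
  · change D'.ratCoord hV hU (D.sec (Fin.castAdd r' j)) (Fin.castAdd r' i) = _
    rw [LocalFrame.extension_sec_castAdd, ha,
      Fin.append_left]
    rfl
  · rfl
  · change D'.ratCoord hV hU (D.sec (Fin.castAdd r' j)) (Fin.natAdd r i) = _
    rw [LocalFrame.extension_sec_castAdd, ha,
      Fin.append_right]
    rfl
  · change D'.ratCoord hV hU (D.sec (Fin.natAdd r j)) (Fin.natAdd r i) = _
    rw [LocalFrame.extension_sec_natAdd, hb, he]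
    rfl

end RatMatrix

variable {k : Type u} [Field k] {C : SmoothProjectiveCurve k} {E F G : C.X.Modules}
  {U V : C.X.Opens} {r r' : ℕ}

lemma ord_toK_nonneg {x : C.X} (hU : genericPoint C.X ∈ U) (hx : x ∈ U) (a : Γ(C.X, U)) :
    0 ≤ C.X.ord (toK hU a) x := by
  by_cases ha : a = 0
  · rw [ha, map_zero, Scheme.ord_zero]
    rfl
  · by_cases hxη : x = genericPoint C.X
    · rw [hxη, ord_genericPoint]
    · rw [ord_toK hxη hU hx ha]
      exact Nat.cast_nonneg _

lemma ord_det_nonneg {x : C.X} (φ : E ⟶ F) (s : LocalFrame E r U) (t : LocalFrame F r V)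
    (hU : genericPoint C.X ∈ U) (hV : genericPoint C.X ∈ V) (hxU : x ∈ U) (hxV : x ∈ V) :
    0 ≤ C.X.ord (ratMatrix φ s t hU hV).det x := by
  obtain ⟨M, hM⟩ := exists_toK_ratMatrix φ s t hU hV
  rw [← hM, ← RingHom.mapMatrix_apply, ← RingHom.map_det]
  exact ord_toK_nonneg _ (mem_inf hxU hxV) _

lemma ord_det_eq_zero {x : C.X} (s : LocalFrame E r U) (t : LocalFrame E r V)
    (hU : genericPoint C.X ∈ U) (hV : genericPoint C.X ∈ V) (hxU : x ∈ U) (hxV : x ∈ V) :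
    C.X.ord (ratMatrix (𝟙 E) s t hU hV).det x = 0 := by
  have h1 : (ratMatrix (𝟙 E) s t hU hV).det * (ratMatrix (𝟙 E) t s hV hU).det = 1 := by
    rw [← Matrix.det_mul, ← ratMatrix_comp, Category.comp_id, ratMatrix_id, Matrix.det_one]
  have h2 := Scheme.ord_mul (x := x) (left_ne_zero_of_mul_eq_one h1)
    (right_ne_zero_of_mul_eq_one h1)
  rw [h1, ord_one] at h2
  have h3 := ord_det_nonneg (𝟙 E) s t hU hV hxU hxV
  have h4 := ord_det_nonneg (𝟙 E) t s hV hU hxV hxU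
  linarith

namespace FrameAtlas

variable (A : FrameAtlas E r) (B : FrameAtlas F r)

lemma genericPoint_mem_nhd (x : C.X) : genericPoint C.X ∈ A.nhd x := genericPoint_mem (A.mem_nhd x)

lemma ordDet_eq (x : C.X) : A.ordDet x = C.X.ord (ratMatrix (𝟙 E) (A.frame (genericPoint C.X))
    (A.frame x) (A.mem_nhd _) (A.genericPoint_mem_nhd x)).det x := by
  rw [← toK_transition, ← RingHom.mapMatrix_apply, ← RingHom.map_det]
  rfl

lemma finite_support_ordDet : (Function.support A.ordDet).Finite := by
  refine (finite_compl (A.mem_nhd (genericPoint C.X))).subset fun x hx hxU => hx ?_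
  rw [ordDet_eq]
  exact ord_det_eq_zero _ _ _ _ hxU (A.mem_nhd x)

/-- A monomorphism between bundles of the same rank is given near each point `x` by a matrix whose
determinant has a non-negative order at `x`; the sum of these orders is the difference of the
degrees, since the determinant at the generic point has a principal divisor. -/
lemma degree_le [IsAlgClosed k] (φ : E ⟶ F) [Mono φ] : A.degree ≤ B.degree := by
  let d := (ratMatrix φ (A.frame (genericPoint C.X)) (B.frame (genericPoint C.X)) (A.mem_nhd _)
    (B.mem_nhd _)).det
  have hd : d ≠ 0 := det_ratMatrix_ne_zero _ _ _ _ _ ⟨B⟩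
  obtain ⟨hfin, hsum⟩ := finsum_ord_eq_zero hd
  -- compare the determinants in `φ_x ∘ (transition of E) = (transition of F) ∘ φ_η`
  have hx : ∀ x, 0 ≤ B.ordDet x + C.X.ord d x - A.ordDet x := by
    intro x
    have hA := det_ratMatrix_ne_zero (𝟙 E) (A.frame (genericPoint C.X)) (A.frame x)
      (A.mem_nhd _) (A.genericPoint_mem_nhd x) ⟨A⟩
    have hB := det_ratMatrix_ne_zero (𝟙 F) (B.frame (genericPoint C.X)) (B.frame x)
      (B.mem_nhd _) (B.genericPoint_mem_nhd x) ⟨B⟩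
    have hφ := det_ratMatrix_ne_zero φ (A.frame x) (B.frame x)
      (A.genericPoint_mem_nhd x) (B.genericPoint_mem_nhd x) ⟨B⟩
    have h1 : ratMatrix φ (A.frame x) (B.frame x) (A.genericPoint_mem_nhd x)
        (B.genericPoint_mem_nhd x) * ratMatrix (𝟙 E) (A.frame (genericPoint C.X)) (A.frame x)
          (A.mem_nhd _) (A.genericPoint_mem_nhd x) =
        ratMatrix (𝟙 F) (B.frame (genericPoint C.X)) (B.frame x) (B.mem_nhd _)
          (B.genericPoint_mem_nhd x) * ratMatrix φ (A.frame (genericPoint C.X))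
          (B.frame (genericPoint C.X)) (A.mem_nhd _) (B.mem_nhd _) := by
      rw [← ratMatrix_comp, ← ratMatrix_comp, Category.id_comp, Category.comp_id]
    have h2 := congr_arg (fun M => C.X.ord (Matrix.det M) x) h1
    simp only [Matrix.det_mul] at h2
    rw [Scheme.ord_mul hφ hA, Scheme.ord_mul hB hd, ← ordDet_eq, ← ordDet_eq] at h2
    have h3 := ord_det_nonneg φ (A.frame x) (B.frame x) (A.genericPoint_mem_nhd x)
      (B.genericPoint_mem_nhd x) (A.mem_nhd x) (B.mem_nhd x)
    linarith
  have := finsum_nonneg hx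
  rw [finsum_sub_distrib ((B.finite_support_ordDet.union hfin).subset
    (Function.support_add _ _)) A.finite_support_ordDet,
    finsum_add_distrib B.finite_support_ordDet hfin, hsum, add_zero, sub_nonneg] at this
  exact this

end FrameAtlas

variable [IsAlgClosed k]

/-- The degree does not depend on the choice of local frames. -/
lemma degree_eq (A : FrameAtlas E r) : degree E = A.degree := by
  have h : IsVectorBundle E := ⟨r, ⟨A⟩⟩
  rw [degree, dif_pos h]
  have key : ∀ {r' : ℕ} (B : FrameAtlas E r'), B.degree = A.degree := fun B => by
    obtain rfl := HasRank.unique ⟨A⟩ ⟨B⟩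
    exact le_antisymm (B.degree_le A (𝟙 E)) (A.degree_le B (𝟙 E))
  exact key _

/-- The degree does not decrease under a monomorphism between vector bundles of the same rank. -/
lemma degree_le_of_mono (hE : IsVectorBundle E) (hF : IsVectorBundle F) (φ : E ⟶ F) [Mono φ]
    (h : rank E = rank F) : degree E ≤ degree F := by
  obtain ⟨A⟩ := hE.hasRank
  obtain ⟨B⟩ := hF.hasRank
  rw [← h] at B
  rw [degree_eq A, degree_eq B]
  exact A.degree_le B φ

lemma degree_eq_of_iso (hE : IsVectorBundle E) (e : E ≅ F) : degree F = degree E :=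
  le_antisymm (degree_le_of_mono (hE.of_iso e) hE e.inv (rank_eq_of_iso hE e))
    (degree_le_of_mono hE (hE.of_iso e) e.hom (rank_eq_of_iso hE e).symm)

/-- The degree is additive in short exact sequences. -/
lemma degree_add {S : ShortComplex C.X.Modules} (hS : S.ShortExact) (h₁ : IsVectorBundle S.X₁)
    (h₃ : IsVectorBundle S.X₃) : degree S.X₂ = degree S.X₁ + degree S.X₃ := by
  have := hS.epi_g
  obtain ⟨A⟩ := h₁.hasRank
  obtain ⟨B⟩ := h₃.hasRank
  choose W hW hxW e he using fun x => exists_local_lifts S.g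
    ((B.frame x).restrict (inf_le_right : A.nhd x ⊓ B.nhd x ≤ _)).sec (x := x)
    (mem_inf (A.mem_nhd x) (B.mem_nhd x))
  let A' : FrameAtlas S.X₁ (rank S.X₁) :=
    ⟨W, hxW, fun x => (A.frame x).restrict ((hW x).trans inf_le_left)⟩
  let B' : FrameAtlas S.X₃ (rank S.X₃) :=
    ⟨W, hxW, fun x => ((B.frame x).restrict inf_le_right).restrict (hW x)⟩
  let D : FrameAtlas S.X₂ (rank S.X₁ + rank S.X₃) :=
    ⟨W, hxW, fun x => .extension hS (A'.frame x) (B'.frame x) (e x) (he x)⟩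
  rw [degree_eq A', degree_eq B', degree_eq D, FrameAtlas.degree, FrameAtlas.degree,
    FrameAtlas.degree, ← finsum_add_distrib A'.finite_support_ordDet B'.finite_support_ordDet]
  refine finsum_congr fun x => ?_
  rw [D.ordDet_eq, A'.ordDet_eq, B'.ordDet_eq, ← Scheme.ord_mul
    (det_ratMatrix_ne_zero _ _ _ _ _ ⟨A'⟩) (det_ratMatrix_ne_zero _ _ _ _ _ ⟨B'⟩)]
  congr 1
  exact det_ratMatrix_extension hS (A'.frame _) (B'.frame _) (e _) (he _) (A'.frame x) (B'.frame x)
    (e x) (he x) _ _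

lemma degree_eq_zero_of_isZero (h : IsZero E) : degree E = 0 := by
  have hb := IsVectorBundle.of_isZero h
  have hS : (ShortComplex.mk (𝟙 E) (0 : E ⟶ E) comp_zero).ShortExact :=
    { exact := ShortComplex.exact_of_isZero_X₂ _ h
      mono_f := inferInstanceAs (Mono (𝟙 E))
      epi_g := ⟨fun _ _ _ => h.eq_of_src _ _⟩ }
  have := degree_add hS hb hb
  exact left_eq_add.mp this

end Degree

/-! ### Bounds for slopes -/

section Hyperplane

variable {X : Scheme.{u}} [IsIntegral X] {E : X.Modules} {U : X.Opens} {r : ℕ}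

/-- The subsheaf of the sections whose `i`-th rational coordinate vanishes. -/
noncomputable def coordinateHyperplane (s : LocalFrame E r U) (hU : genericPoint X ∈ U)
    (i : Fin r) : LocalSubmodule E where
  carrier V :=
    { carrier := {m | ∀ hV : genericPoint X ∈ V, s.ratCoord hU hV m i = 0}
      add_mem' := fun ha hb hV => by rw [map_add, Pi.add_apply, ha, hb, add_zero]
      zero_mem' := fun hV => by rw [map_zero, Pi.zero_apply]
      smul_mem' := fun c m hm hV => by
        rw [LocalFrame.ratCoord_smul, Pi.smul_apply, hm hV, smul_zero] }
  res_mem h m hm hV := by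
    rw [s.ratCoord_res hU (h hV)]
    exact hm _
  mem_of_local {V m} h hV := by
    obtain ⟨W, hW, hxW, hm⟩ := h _ hV
    rw [← s.ratCoord_res hU hV hxW hW]
    exact hm hxW

lemma isSaturated_coordinateHyperplane (s : LocalFrame E r U) (hU : genericPoint X ∈ U)
    (i : Fin r) : IsSaturated (coordinateHyperplane s hU i).ι := by
  rintro V W h m hW ⟨n, hn⟩
  refine (coordinateHyperplane s hU i).exists_ι_app fun hV => ?_
  rw [← s.ratCoord_res hU hV hW h, ← hn]
  exact (coordinateHyperplane s hU i).ι_app_mem W n hW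

/-- A vector bundle of rank at least two is an extension of vector bundles of smaller ranks. -/
lemma exists_isSubbundle_of_two_le_rank [∀ x : X, IsPrincipalIdealRing (X.presheaf.stalk x)]
    (hE : IsVectorBundle E) (h : 2 ≤ rank E) :
    ∃ (F : X.Modules) (i : F ⟶ E), IsSubbundle i ∧ rank F < rank E ∧
      rank (cokernel i) < rank E := by
  obtain ⟨U, hU, ⟨s⟩⟩ := hE.hasRank.exists_generic_frame
  let a : Fin (rank E) := ⟨0, by omega⟩
  let b : Fin (rank E) := ⟨1, by omega⟩
  have hab : a ≠ b := by simp [a, b]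
  let N := coordinateHyperplane s hU a
  have hN : IsSubbundle N.ι := (isSaturated_coordinateHyperplane s hU a).isSubbundle hE
  have hadd : rank E = rank N.toModules + rank (cokernel N.ι) :=
    rank_add (shortExact_cokernel N.ι) hN.2.1 hN.2.2
  have h₁ : rank N.toModules ≠ 0 := fun h0 => by
    have := subsingleton_of_isZero ((rank_eq_zero_iff hN.2.1).mp h0)
    have hb : s.sec b ∈ N.carrier U := fun hU' => by
      rw [s.ratCoord_sec, Pi.single_eq_of_ne hab]
    obtain ⟨n, hn⟩ := N.exists_ι_app hb
    rw [Subsingleton.elim n 0, map_zero] at hn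
    have h1 := congr_fun (s.ratCoord_sec hU b) b
    rw [← hn, map_zero] at h1
    simp at h1
  have h₂ : rank (cokernel N.ι) ≠ 0 := fun h0 => by
    have hz := (rank_eq_zero_iff hN.2.2).mp h0
    have : Epi N.ι := Preadditive.epi_of_isZero_cokernel _ hz
    have : IsIso N.ι := isIso_of_mono_of_epi _
    obtain ⟨n, hn⟩ := (app_bijective N.ι U).2 (s.sec a)
    have h1 := N.ι_app_mem U n hU
    rw [hn, s.ratCoord_sec] at h1
    simp at h1
  exact ⟨_, N.ι, hN, by omega, by omega⟩

end Hyperplane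

section Slopes

variable {k : Type u} [Field k] {C : SmoothProjectiveCurve k}
  {E F G K : C.X.Modules} {a b : ℝ}

/-- The degree of every vector bundle `K` contained in `E` is at most `b * rank K`. -/
def SubDegreeLE (b : ℝ) (E : C.X.Modules) : Prop :=
  ∀ (K : C.X.Modules) (i : K ⟶ E), Mono i → IsVectorBundle K → (degree K : ℝ) ≤ b * rank K

/-- For every vector bundle `K` contained in `E`, the degree of `E / K` is at least `a` times its
rank. Degree and rank of the quotient, which may have torsion, are written as differences. -/
def QuotDegreeGE (a : ℝ) (E : C.X.Modules) : Prop :=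
  ∀ (K : C.X.Modules) (i : K ⟶ E), Mono i → IsVectorBundle K →
    a * ((rank E : ℝ) - rank K) ≤ degree E - degree K

lemma SubDegreeLE.mono (h : SubDegreeLE a E) (hab : a ≤ b) : SubDegreeLE b E :=
  fun K i hi hK => (h K i hi hK).trans (by gcongr)

lemma QuotDegreeGE.anti (h : QuotDegreeGE b E) (hE : IsVectorBundle E) (hab : a ≤ b) :
    QuotDegreeGE a E := fun K i hi hK => by
  have : (rank K : ℝ) ≤ rank E := by exact_mod_cast rank_le_of_mono hK hE i
  refine le_trans ?_ (h K i hi hK)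
  have := sub_nonneg.mpr this
  gcongr

lemma SubDegreeLE.of_mono (h : SubDegreeLE b E) (i : F ⟶ E) [Mono i] : SubDegreeLE b F :=
  fun K j _ hK => h K (j ≫ i) inferInstance hK

namespace HNFiltration

variable (H : HNFiltration E)

lemma sub_le_sub (i : Fin (H.n + 1)) : H.sub i.castSucc ≤ H.sub i.succ :=
  H.strictMono.monotone i.castSucc_le_succ

/-- The inclusion of a term of the filtration in the next one, with quotient `H.quot i`. -/
noncomputable def step (i : Fin (H.n + 1)) : ShortComplex C.X.Modules :=
  .mk ((H.sub i.castSucc).ofLE (H.sub i.succ) (H.sub_le_sub i)) (cokernel.π _)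
    (cokernel.condition _)

lemma shortExact_step (i : Fin (H.n + 1)) : (H.step i).ShortExact := shortExact_cokernel _

lemma isSemistable_quot (i : Fin (H.n + 1)) : IsSemistable (H.quot i) := H.semistable i

lemma slope_quot_le (i : Fin (H.n + 1)) : slope (H.quot i) ≤ H.muMax :=
  H.slope_anti.antitone (Fin.zero_le i)

lemma le_slope_quot (i : Fin (H.n + 1)) : H.muMin ≤ slope (H.quot i) :=
  H.slope_anti.antitone (Fin.le_last i)

lemma muMin_le_muMax : H.muMin ≤ H.muMax := H.slope_quot_le _

lemma isZero_sub_zero : IsZero (H.sub 0 : C.X.Modules) := by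
  rw [H.sub_zero]
  exact (isZero_zero _).of_iso Subobject.botCoeIsoZero

lemma rank_quot_pos (i : Fin (H.n + 1)) : 0 < rank (H.quot i) := by
  refine Nat.pos_of_ne_zero fun h => ?_
  have hz := (rank_eq_zero_iff (H.isSemistable_quot i).1).mp h
  let f := (H.sub i.castSucc).ofLE _ (H.sub_le_sub i)
  have : Epi f := Preadditive.epi_of_isZero_cokernel f hz
  have : IsIso f := isIso_of_mono_of_epi f
  refine (H.strictMono i.castSucc_lt_succ).not_ge (Subobject.le_of_comm (inv f) ?_)
  rw [IsIso.inv_comp_eq]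
  exact (Subobject.ofLE_arrow (H.sub_le_sub i)).symm

end HNFiltration

variable [IsAlgClosed k]

lemma QuotDegreeGE.of_iso (h : QuotDegreeGE a E) (hE : IsVectorBundle E) (e : E ≅ F) :
    QuotDegreeGE a F := fun K j _ hK => by
  rw [degree_eq_of_iso hE e, rank_eq_of_iso hE e]
  exact h K (j ≫ e.inv) inferInstance hK

lemma subDegreeLE_of_isZero (h : IsZero E) : SubDegreeLE b E := fun K i _ hK => by
  have hz : IsZero K := h.of_mono i
  rw [degree_eq_zero_of_isZero hz, (rank_eq_zero_iff hK).mpr hz]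
  simp

lemma quotDegreeGE_of_isZero (h : IsZero E) : QuotDegreeGE a E := fun K i _ hK => by
  have hz : IsZero K := h.of_mono i
  rw [degree_eq_zero_of_isZero hz, (rank_eq_zero_iff hK).mpr hz, degree_eq_zero_of_isZero h,
    (rank_eq_zero_iff (.of_isZero h)).mpr h]
  simp

/-- A vector bundle contained in an extension is itself an extension of bundles contained in the
ends of the extension. -/
lemma exists_mono_of_shortExact {S : ShortComplex C.X.Modules} (hS : S.ShortExact)
    (h₃ : IsVectorBundle S.X₃) (i : K ⟶ S.X₂) [Mono i]
    (hK : IsVectorBundle K) :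
    ∃ (K' K'' : C.X.Modules) (i' : K' ⟶ S.X₁) (i'' : K'' ⟶ S.X₃), Mono i' ∧ Mono i'' ∧
      IsVectorBundle K' ∧ IsVectorBundle K'' ∧ rank K = rank K' + rank K'' ∧
      degree K = degree K' + degree K'' := by
  have := hS.mono_f
  have hsub := isSubbundle_kernel (i ≫ S.g) hK h₃
  have hk : (kernel.ι (i ≫ S.g) ≫ i) ≫ S.g = 0 := by rw [Category.assoc, kernel.condition]
  have hl : hS.exact.lift _ hk ≫ S.f = kernel.ι (i ≫ S.g) ≫ i := hS.exact.lift_f _ hk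
  have hm : Mono (hS.exact.lift _ hk ≫ S.f) := by rw [hl]; infer_instance
  exact ⟨_, _, hS.exact.lift _ hk, Abelian.factorThruCoimage (i ≫ S.g),
    mono_of_mono _ S.f, inferInstance, hsub.2.1, hsub.2.2,
    rank_add (shortExact_cokernel _) hsub.2.1 hsub.2.2,
    degree_add (shortExact_cokernel _) hsub.2.1 hsub.2.2⟩

lemma SubDegreeLE.extension {S : ShortComplex C.X.Modules} (hS : S.ShortExact)
    (h₃ : IsVectorBundle S.X₃) (H₁ : SubDegreeLE b S.X₁) (H₃ : SubDegreeLE b S.X₃) :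
    SubDegreeLE b S.X₂ := fun K i _ hK => by
  obtain ⟨K', K'', i', i'', hi', hi'', hK', hK'', hr, hd⟩ :=
    exists_mono_of_shortExact hS h₃ i hK
  have h' := H₁ K' i' hi' hK'
  have h'' := H₃ K'' i'' hi'' hK''
  rw [hr, hd]
  push_cast
  linarith

lemma QuotDegreeGE.extension {S : ShortComplex C.X.Modules} (hS : S.ShortExact)
    (h₁ : IsVectorBundle S.X₁) (h₃ : IsVectorBundle S.X₃) (H₁ : QuotDegreeGE a S.X₁)
    (H₃ : QuotDegreeGE a S.X₃) : QuotDegreeGE a S.X₂ := fun K i _ hK => by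
  obtain ⟨K', K'', i', i'', hi', hi'', hK', hK'', hr, hd⟩ :=
    exists_mono_of_shortExact hS h₃ i hK
  have h' := H₁ K' i' hi' hK'
  have h'' := H₃ K'' i'' hi'' hK''
  rw [hr, hd, rank_add hS h₁ h₃, degree_add hS h₁ h₃]
  push_cast
  linarith

lemma degree_eq_slope_mul (hE : IsVectorBundle E) : (degree E : ℝ) = slope E * rank E := by
  by_cases h : rank E = 0
  · rw [degree_eq_zero_of_isZero ((rank_eq_zero_iff hE).mp h), h]
    simp
  · rw [slope, div_mul_cancel₀ _ (by exact_mod_cast h)]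

lemma slope_eq_of_iso (hE : IsVectorBundle E) (e : E ≅ F) : slope F = slope E := by
  rw [slope, slope, degree_eq_of_iso hE e, rank_eq_of_iso hE e]

/-- Semi-stability bounds the slopes of sub-bundles; the saturation of an arbitrary `K` contained in
`E` is a sub-bundle of the same rank and of at least the same degree. -/
lemma IsSemistable.subDegreeLE (h : IsSemistable E) : SubDegreeLE (slope E) E := fun K i _ hK => by
  obtain ⟨F, j, i', -, hj, hi', hr⟩ := exists_isSubbundle i hK h.1
  have hd : (degree K : ℝ) ≤ degree F := by
    exact_mod_cast degree_le_of_mono hK hi'.2.1 j hr.symm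
  refine hd.trans ?_
  rw [← hr]
  by_cases hz : IsZero F
  · exact subDegreeLE_of_isZero hz F (𝟙 F) inferInstance hi'.2.1
  by_cases hiso : IsIso i'
  · rw [slope_eq_of_iso hi'.2.1 (asIso i'), ← degree_eq_slope_mul hi'.2.1]
  · rw [degree_eq_slope_mul hi'.2.1]
    have := h.2 F i' hi' hz hiso
    gcongr

lemma IsSemistable.quotDegreeGE (h : IsSemistable E) : QuotDegreeGE (slope E) E :=
  fun K i hi hK => by
    have := h.subDegreeLE K i hi hK
    rw [degree_eq_slope_mul h.1, mul_sub]
    linarith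

/-- The slopes of the vector bundles contained in a given one are bounded above. By induction on the
rank this reduces to line bundles, where `degree_le_of_mono` applies. -/
lemma exists_subDegreeLE (hE : IsVectorBundle E) : ∃ b, SubDegreeLE b E := by
  induction hn : rank E using Nat.strong_induction_on generalizing E with
  | _ n ih =>
  subst hn
  by_cases h : 2 ≤ rank E
  · obtain ⟨F, i, hi, h₁, h₂⟩ := exists_isSubbundle_of_two_le_rank hE h
    have := hi.1
    obtain ⟨b₁, hb₁⟩ := ih _ h₁ hi.2.1 rfl
    obtain ⟨b₂, hb₂⟩ := ih _ h₂ hi.2.2 rfl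
    exact ⟨max b₁ b₂, .extension (shortExact_cokernel i) hi.2.2
      (hb₁.mono (le_max_left _ _)) (hb₂.mono (le_max_right _ _))⟩
  · refine ⟨degree E, fun K i _ hK => ?_⟩
    have hr := rank_le_of_mono hK hE i
    by_cases h0 : rank K = 0
    · exact subDegreeLE_of_isZero ((rank_eq_zero_iff hK).mp h0) K (𝟙 K) inferInstance hK
    · have h1 : rank K = 1 := by omega
      have hd : (degree K : ℝ) ≤ degree E := by
        exact_mod_cast degree_le_of_mono hK hE i (by omega)
      simpa [h1] using hd

namespace HNFiltration

variable (H : HNFiltration E)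

/-- Each term of the filtration is an iterated extension of the semi-stable quotients, whose slopes
lie between `muMin` and `muMax`. -/
lemma sub_bounds (i : Fin (H.n + 2)) : IsVectorBundle (H.sub i : C.X.Modules) ∧
    SubDegreeLE H.muMax (H.sub i : C.X.Modules) ∧
      QuotDegreeGE H.muMin (H.sub i : C.X.Modules) := by
  induction i using Fin.induction with
  | zero => exact ⟨.of_isZero H.isZero_sub_zero, subDegreeLE_of_isZero H.isZero_sub_zero,
      quotDegreeGE_of_isZero H.isZero_sub_zero⟩
  | succ i ih =>
    have hs := H.isSemistable_quot i
    exact ⟨.extension (H.shortExact_step i) ih.1 hs.1,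
      .extension (H.shortExact_step i) hs.1 ih.2.1 (hs.subDegreeLE.mono (H.slope_quot_le i)),
      .extension (H.shortExact_step i) ih.1 hs.1 ih.2.2
        (hs.quotDegreeGE.anti hs.1 (H.le_slope_quot i))⟩

/-- The last term of the filtration is the bundle itself. -/
noncomputable def subLastIso : (H.sub (Fin.last _) : C.X.Modules) ≅ E :=
  have : IsIso (H.sub (Fin.last _)).arrow := Subobject.isIso_arrow_iff_eq_top _ |>.mpr H.sub_last
  asIso (H.sub (Fin.last _)).arrow

lemma subDegreeLE : SubDegreeLE H.muMax E :=
  (H.sub_bounds _).2.1.of_mono H.subLastIso.inv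

lemma quotDegreeGE : QuotDegreeGE H.muMin E :=
  (H.sub_bounds _).2.2.of_iso (H.sub_bounds _).1 H.subLastIso

/-- The first term `F₁` of the filtration is contained in `E`. -/
lemma muMax_le (h : SubDegreeLE b E) : H.muMax ≤ b := by
  have hr := H.rank_quot_pos 0
  have hz : IsZero (H.step 0).X₁ := H.isZero_sub_zero
  have hq := H.isSemistable_quot 0
  have hi : IsIso (H.step 0).g := by
    have := (H.shortExact_step 0).epi_g
    have : Mono (H.step 0).g := (H.shortExact_step 0).exact.mono_g (hz.eq_of_src _ _)
    exact isIso_of_mono_of_epi _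
  let e : H.quot 0 ≅ (H.sub (Fin.succ 0) : C.X.Modules) := (asIso (H.step 0).g).symm
  have hd := h (H.quot 0) (e.hom ≫ (H.sub _).arrow) inferInstance hq.1
  rw [degree_eq_slope_mul hq.1] at hd
  exact le_of_mul_le_mul_right hd (by exact_mod_cast hr)

/-- The last quotient `F_s` of the filtration is a quotient of `E`. -/
lemma le_muMin (h : QuotDegreeGE a E) : a ≤ H.muMin := by
  have hr := H.rank_quot_pos (Fin.last _)
  have hq := H.isSemistable_quot (Fin.last _)
  have hK := (H.sub_bounds (Fin.last H.n).castSucc).1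
  have h1 := degree_add (H.shortExact_step (Fin.last _)) hK hq.1
  have h2 := rank_add (H.shortExact_step (Fin.last _)) hK hq.1
  have h3 : degree E = degree (H.step (Fin.last _)).X₂ :=
    degree_eq_of_iso (H.sub_bounds _).1 H.subLastIso
  have h4 : rank E = rank (H.step (Fin.last _)).X₂ :=
    rank_eq_of_iso (H.sub_bounds _).1 H.subLastIso
  have hd := h _ (H.sub (Fin.last H.n).castSucc).arrow inferInstance hK
  have h5 : (degree (H.step (Fin.last _)).X₃ : ℝ) = H.muMin * rank (H.step (Fin.last _)).X₃ :=
    degree_eq_slope_mul hq.1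
  rw [h3, h1, h4, h2] at hd
  push_cast at hd
  rw [h5] at hd
  change a * (rank (H.step (Fin.last _)).X₁ + _ - rank (H.step (Fin.last _)).X₁) ≤
    degree (H.step (Fin.last _)).X₁ + _ - degree (H.step (Fin.last _)).X₁ at hd
  rw [add_sub_cancel_left, add_sub_cancel_left] at hd
  exact le_of_mul_le_mul_right hd (by exact_mod_cast hr)

end HNFiltration

end Slopes

/-! ### Existence of Harder–Narasimhan filtrations -/

section Existence

/-- Among pairs `(q, d)` with `q` bounded and `d` bounded below there is one for which `d / q` is
minimal and, among those, `q` is maximal. -/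
lemma exists_min_ratio {T : Set (ℕ × ℤ)} (hT : T.Nonempty) {r : ℕ} {B : ℤ}
    (hr : ∀ t ∈ T, 0 < t.1 ∧ t.1 ≤ r) (hB : ∀ t ∈ T, B ≤ t.2) :
    ∃ t ∈ T, ∀ t' ∈ T, (t.2 : ℝ) / t.1 ≤ t'.2 / t'.1 ∧
      ((t'.2 : ℝ) / t'.1 = t.2 / t.1 → t'.1 ≤ t.1) := by
  -- `m t` is `r!` times the ratio, so that `m t * (r + 1) - q` orders the pairs lexicographically
  let m : ℕ × ℤ → ℤ := fun t => t.2 * (r.factorial / t.1 : ℕ)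
  have hm : ∀ t ∈ T, (m t : ℝ) = r.factorial * (t.2 / t.1) := fun t ht => by
    have h0 : (t.1 : ℝ) ≠ 0 := by exact_mod_cast (hr t ht).1.ne'
    have hd := Nat.dvd_factorial (hr t ht).1 (hr t ht).2
    simp only [m, Int.cast_mul, Int.cast_natCast, Nat.cast_div hd h0]
    ring
  have hpos : (0 : ℝ) < r.factorial := by exact_mod_cast r.factorial_pos
  obtain ⟨_, ⟨t, ht, rfl⟩, hmin⟩ := Int.exists_least_of_bdd
    (P := fun z => ∃ t ∈ T, m t * (r + 1) - t.1 = z)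
    ⟨-(|B| * r.factorial) * (r + 1) - r, by
      rintro _ ⟨t, ht, rfl⟩
      have h1 : -(|B| * r.factorial) ≤ m t := by
        have h2 : -|B| ≤ t.2 := (neg_abs_le B).trans (hB t ht)
        have h3 : (0 : ℤ) ≤ (r.factorial / t.1 : ℕ) := Int.natCast_nonneg _
        have h4 : ((r.factorial / t.1 : ℕ) : ℤ) ≤ r.factorial := by
          exact_mod_cast Nat.div_le_self _ _
        have h5 : 0 ≤ |B| := abs_nonneg B
        simp only [m]
        nlinarith
      have h2 : (t.1 : ℤ) ≤ r := by exact_mod_cast (hr t ht).2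
      nlinarith⟩
    (hT.elim fun t ht => ⟨_, t, ht, rfl⟩)
  refine ⟨t, ht, fun t' ht' => ?_⟩
  have h1 := hmin _ ⟨t', ht', rfl⟩
  have h2 : ((t.1 : ℕ) : ℤ) ≤ r := by exact_mod_cast (hr t ht).2
  have h3 : (0 : ℤ) < t'.1 := by exact_mod_cast (hr t' ht').1
  have h4 : m t ≤ m t' := by
    by_contra! h
    have h5 : m t' + 1 ≤ m t := h
    nlinarith
  refine ⟨le_of_mul_le_mul_left ?_ hpos, fun h => ?_⟩
  · rw [← hm t ht, ← hm t' ht']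
    exact_mod_cast h4
  · have h5 : m t' = m t := by
      have h6 : (m t' : ℝ) = m t := by rw [hm t ht, hm t' ht', h]
      exact_mod_cast h6
    rw [h5] at h1
    omega

variable {k : Type u} [Field k] {C : SmoothProjectiveCurve k} {E F G K Q : C.X.Modules}

lemma IsSubbundle.comp_iso {X : Scheme.{u}} {E F G : X.Modules} {i : F ⟶ E} (h : IsSubbundle i)
    (e : E ≅ G) : IsSubbundle (i ≫ e.hom) :=
  have := h.1
  ⟨inferInstance, h.2.1, h.2.2.of_iso (cokernelCompIsIso i e.hom).symm⟩

/-- The quotient of two subobjects, in terms of monomorphisms which represent them. -/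
lemma nonempty_cokernel_ofLE_iso {X : Scheme.{u}} {E A B : X.Modules} {P R : Subobject E}
    (h : P ≤ R) (p : A ⟶ E) (q : B ⟶ E) [Mono p] [Mono q] (f : A ⟶ B) (hf : f ≫ q = p)
    (hP : P = .mk p) (hR : R = .mk q) : Nonempty (cokernel (P.ofLE R h) ≅ cokernel f) := by
  subst hP hR
  refine ⟨cokernel.mapIso _ _ (Subobject.underlyingIso p) (Subobject.underlyingIso q) ?_⟩
  rw [← cancel_mono q, Category.assoc, Category.assoc, Subobject.underlyingIso_hom_comp_eq_mk,
    Subobject.ofLE_arrow, hf, Subobject.underlyingIso_hom_comp_eq_mk]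

variable [IsAlgClosed k]

lemma IsSemistable.of_iso (h : IsSemistable E) (e : E ≅ F) : IsSemistable F := by
  refine ⟨h.1.of_iso e, fun G i hi hz hiso => ?_⟩
  rw [slope_eq_of_iso h.1 e]
  refine h.2 G (i ≫ e.inv) (hi.comp_iso e.symm) hz fun h' => hiso ?_
  have : i = (i ≫ e.inv) ≫ e.hom := by simp
  rw [this]
  infer_instance

open ZeroObject in
/-- A semi-stable bundle is its own Harder–Narasimhan filtration. -/
lemma IsSemistable.nonempty_hnFiltration (h : IsSemistable E) (hz : ¬ IsZero E) :
    Nonempty (HNFiltration E) := by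
  have hlt : StrictMono (![⊥, ⊤] : Fin 2 → Subobject E) := by
    refine Fin.strictMono_iff_lt_succ.mpr fun i => ?_
    obtain rfl := Subsingleton.elim i 0
    change (⊥ : Subobject E) < ⊤
    refine bot_lt_iff_ne_bot.mpr fun h0 => hz ?_
    rw [Subobject.top_eq_id, Subobject.mk_eq_bot_iff_zero] at h0
    exact (IsZero.iff_id_eq_zero E).mpr h0
  have hc : Nonempty (cokernel (Subobject.ofLE (⊥ : Subobject E) ⊤ bot_le) ≅ E) := by
    obtain ⟨e⟩ := nonempty_cokernel_ofLE_iso (bot_le : (⊥ : Subobject E) ≤ ⊤)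
      (0 : (0 : C.X.Modules) ⟶ E) (𝟙 E) 0 zero_comp
      (Subobject.mk_eq_bot_iff_zero.mpr rfl).symm (Subobject.top_eq_id E)
    exact ⟨e ≪≫ cokernelZeroIsoTarget⟩
  obtain ⟨e⟩ := hc
  have hsub : Subsingleton (Fin (0 + 1)) := inferInstanceAs (Subsingleton (Fin 1))
  exact ⟨{
    n := 0
    sub := ![⊥, ⊤]
    strictMono := hlt
    sub_zero := rfl
    sub_last := rfl
    semistable := fun i => by
      obtain rfl := Subsingleton.elim i 0
      exact h.of_iso e.symm
    slope_anti := Subsingleton.strictAnti _ }⟩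

/-- A Harder–Narasimhan filtration of a sub-bundle `K`, followed by `E` itself, is one of `E` if
`E / K` is semi-stable of sufficiently small slope. -/
lemma HNFiltration.nonempty_of_subbundle (i : K ⟶ E) [Mono i] (H : HNFiltration K)
    (hi : IsSemistable (cokernel i)) (hz : ¬ IsZero (cokernel i))
    (hs : slope (cokernel i) < H.muMin) : Nonempty (HNFiltration E) := by
  let sub : Fin (H.n + 1 + 2) → Subobject E :=
    Fin.snoc (α := fun _ => Subobject E)
      (fun j : Fin (H.n + 2) => (Subobject.map i).obj (H.sub j)) ⊤
  have hsub : ∀ j : Fin (H.n + 2), sub j.castSucc = (Subobject.map i).obj (H.sub j) := fun j =>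
    Fin.snoc_castSucc (α := fun _ => Subobject E) _ _ j
  have hlast : sub (Fin.last _) = ⊤ := Fin.snoc_last (α := fun _ => Subobject E) _ _
  have hmk : ∀ P : Subobject K, (Subobject.map i).obj P = .mk (P.arrow ≫ i) := fun P => by
    conv_lhs => rw [← Subobject.mk_arrow P, Subobject.map_mk]
  have htop : (Subobject.map i).obj (H.sub (Fin.last _)) = .mk i := by
    rw [H.sub_last, Subobject.map_top]
  have hmono : StrictMono sub := by
    refine Fin.strictMono_iff_lt_succ.mpr fun j => ?_
    induction j using Fin.lastCases with
    | last =>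
      rw [hsub, htop, Fin.succ_last, hlast, lt_top_iff_ne_top, ne_eq,
        ← Subobject.isIso_iff_mk_eq_top]
      exact fun h => hz (isZero_cokernel_of_epi i)
    | cast j =>
      rw [Fin.succ_castSucc, hsub, hsub]
      exact lt_of_le_of_ne ((Subobject.map i).monotone (H.sub_le_sub j))
        ((Subobject.map_obj_injective i).ne (H.strictMono j.castSucc_lt_succ).ne)
  have hle : ∀ j : Fin (H.n + 1 + 1), sub j.castSucc ≤ sub j.succ := fun j =>
    hmono.monotone j.castSucc_le_succ
  have hq : ∀ j : Fin (H.n + 1),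
      Nonempty (cokernel ((sub j.castSucc.castSucc).ofLE _ (hle j.castSucc)) ≅ H.quot j) := fun j =>
    nonempty_cokernel_ofLE_iso _ ((H.sub j.castSucc).arrow ≫ i) ((H.sub j.succ).arrow ≫ i)
      ((H.sub j.castSucc).ofLE _ (H.sub_le_sub j)) (by rw [← Category.assoc, Subobject.ofLE_arrow])
      (by rw [hsub, hmk]) (by rw [Fin.succ_castSucc, hsub, hmk])
  have hq' : Nonempty (cokernel ((sub (Fin.last (H.n + 1)).castSucc).ofLE _ (hle (Fin.last _))) ≅
      cokernel i) :=
    nonempty_cokernel_ofLE_iso _ i (𝟙 E) i (Category.comp_id i) (by rw [hsub, htop])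
      (by rw [Fin.succ_last, hlast, Subobject.top_eq_id])
  have hslope : ∀ j : Fin (H.n + 1),
      slope (cokernel ((sub j.castSucc.castSucc).ofLE _ (hle j.castSucc))) = slope (H.quot j) :=
    fun j => (hq j).elim fun e => slope_eq_of_iso (H.isSemistable_quot j).1 e.symm
  have hslope' : slope (cokernel ((sub (Fin.last (H.n + 1)).castSucc).ofLE _ (hle (Fin.last _)))) =
      slope (cokernel i) := hq'.elim fun e => slope_eq_of_iso hi.1 e.symm
  exact ⟨{
    n := H.n + 1
    sub := sub
    strictMono := hmono
    sub_zero := by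
      change sub (Fin.castSucc 0) = ⊥
      rw [hsub, H.sub_zero, Subobject.map_bot]
    sub_last := hlast
    semistable := fun j => by
      induction j using Fin.lastCases with
      | last => exact hq'.elim fun e => hi.of_iso e.symm
      | cast j => exact (hq j).elim fun e => (H.isSemistable_quot j).of_iso e.symm
    slope_anti := by
      refine Fin.strictAnti_iff_succ_lt.mpr fun j => ?_
      refine lt_of_lt_of_eq ?_ (hslope j).symm
      induction j using Fin.lastCases with
      | last => exact lt_of_eq_of_lt hslope' hs
      | cast j => exact lt_of_eq_of_lt (hslope j.succ) (H.slope_anti j.castSucc_lt_succ) }⟩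

/-- The quotient bundle of minimal slope of a vector bundle, of maximal rank among those. -/
lemma exists_minimal_quotient (hE : IsVectorBundle E) (hz : ¬ IsZero E) :
    ∃ (Q : C.X.Modules) (π : E ⟶ Q), Epi π ∧ IsVectorBundle Q ∧ 0 < rank Q ∧
      ∀ (Q' : C.X.Modules) (π' : E ⟶ Q'), Epi π' → IsVectorBundle Q' → 0 < rank Q' →
        slope Q ≤ slope Q' ∧ (slope Q' = slope Q → rank Q' ≤ rank Q) := by
  obtain ⟨b, hb⟩ := exists_subDegreeLE hE
  let T : Set (ℕ × ℤ) := {t | ∃ (Q : C.X.Modules) (π : E ⟶ Q), Epi π ∧ IsVectorBundle Q ∧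
    0 < rank Q ∧ t = (rank Q, degree Q)}
  have hS : ∀ {Q : C.X.Modules} (π : E ⟶ Q) [Epi π], IsVectorBundle Q → ∃ K : C.X.Modules,
      (degree K : ℝ) ≤ b * rank K ∧ rank E = rank K + rank Q ∧
        degree E = degree K + degree Q := fun π _ hQ => by
    have hk := isSubbundle_kernel π hE hQ
    exact ⟨kernel π, hb _ (kernel.ι π) inferInstance hk.2.1,
      rank_add (shortExact_kernel π) hk.2.1 hQ, degree_add (shortExact_kernel π) hk.2.1 hQ⟩
  obtain ⟨_, ⟨Q, π, hπ, hQ, hr, rfl⟩, hmin⟩ := exists_min_ratio (T := T) (r := rank E)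
    (B := degree E - ⌈|b| * rank E⌉)
    ⟨_, E, 𝟙 E, inferInstance, hE, Nat.pos_of_ne_zero fun h => hz ((rank_eq_zero_iff hE).mp h), rfl⟩
    (by
      rintro _ ⟨Q, π, hπ, hQ, hr, rfl⟩
      obtain ⟨K, -, h, -⟩ := hS π hQ
      exact ⟨hr, by omega⟩)
    (by
      rintro _ ⟨Q, π, hπ, hQ, hr, rfl⟩
      obtain ⟨K, h1, h2, h3⟩ := hS π hQ
      have h4 : (degree K : ℝ) ≤ |b| * rank E := by
        refine h1.trans (mul_le_mul (le_abs_self b) ?_ (Nat.cast_nonneg _) (abs_nonneg b))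
        exact_mod_cast (by omega : rank K ≤ rank E)
      have h5 : degree K ≤ ⌈|b| * rank E⌉ := by
        exact_mod_cast h4.trans (Int.le_ceil _)
      simp only
      omega)
  exact ⟨Q, π, hπ, hQ, hr, fun Q' π' hπ' hQ' hr' => hmin _ ⟨Q', π', hπ', hQ', hr', rfl⟩⟩

/-- Existence of the Harder–Narasimhan filtration: the last quotient is a quotient bundle `Q` of
minimal slope and, among those, of maximal rank, and the other terms are the filtration of the
kernel. -/
theorem nonempty_hnFiltration (hE : IsVectorBundle E) (hz : ¬ IsZero E) :
    Nonempty (HNFiltration E) := by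
  induction hn : rank E using Nat.strong_induction_on generalizing E with
  | _ n ih =>
  subst hn
  obtain ⟨Q, π, hπ, hQ, hr, hmin⟩ := exists_minimal_quotient hE hz
  -- a sub-bundle of `Q` of larger slope would give a quotient of `Q` of smaller slope
  have hQss : IsSemistable Q := by
    refine ⟨hQ, fun F i hi hF hiso => ?_⟩
    have := hi.1
    have h1 := rank_add (shortExact_cokernel i) hi.2.1 hi.2.2
    have h2 := degree_add (shortExact_cokernel i) hi.2.1 hi.2.2
    have h3 : 0 < rank F := Nat.pos_of_ne_zero fun h => hF ((rank_eq_zero_iff hi.2.1).mp h)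
    have h4 : 0 < rank (cokernel i) := Nat.pos_of_ne_zero fun h => hiso <| by
      have : Epi i := Preadditive.epi_of_isZero_cokernel i ((rank_eq_zero_iff hi.2.2).mp h)
      exact isIso_of_mono_of_epi i
    have h5 := (hmin _ (π ≫ cokernel.π i) (epi_comp _ _) hi.2.2 h4).1
    dsimp only at h1 h2
    rw [slope, slope] at *
    rw [h1, h2] at h5 ⊢
    push_cast at h5 ⊢
    have h3' : (0 : ℝ) < rank F := by exact_mod_cast h3
    have h4' : (0 : ℝ) < rank (cokernel i) := by exact_mod_cast h4
    rw [div_le_div_iff₀ (by positivity) (by positivity)] at h5 ⊢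
    nlinarith
  have hk := isSubbundle_kernel π hE hQ
  have hS := shortExact_kernel π
  have hrE : rank E = rank (kernel π) + rank Q := rank_add hS hk.2.1 hQ
  by_cases hK : IsZero (kernel π)
  · have : Mono π := Preadditive.mono_of_isZero_kernel π hK
    have : IsIso π := isIso_of_mono_of_epi π
    exact (hQss.of_iso (asIso π).symm).nonempty_hnFiltration hz
  · obtain ⟨H⟩ := ih _ (by omega) hk.2.1 hK rfl
    let e : cokernel (kernel.ι π) ≅ Q :=
      (cokernelIsCokernel _).coconePointUniqueUpToIso hS.gIsCokernel
    refine H.nonempty_of_subbundle (kernel.ι π) (hQss.of_iso e.symm)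
      (fun h => hr.ne' ((rank_eq_zero_iff hQ).mpr (h.of_iso e.symm))) ?_
    rw [slope_eq_of_iso hQ e.symm]
    -- Let `G` be the last quotient of the filtration of the kernel. The quotient of `E` by the last
    -- but one term of this filtration is an extension of `Q` by `G`. Its rank exceeds that of `Q`,
    -- hence so does its slope, by the choice of `Q`; therefore `slope Q < slope G`.
    let f := (H.sub (Fin.last H.n).castSucc).ofLE _ (H.sub_le_sub (Fin.last _))
    let g := (H.sub (Fin.last H.n).succ).arrow
    have hg : IsIso g := (Subobject.isIso_arrow_iff_eq_top _).mpr H.sub_last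
    let e' : cokernel (g ≫ kernel.ι π) ≅ Q := cokernelEpiComp g (kernel.ι π) ≪≫ e
    obtain ⟨i, p, w, hT⟩ := exists_shortExact_cokernel_comp f (g ≫ kernel.ι π)
    have hG := (H.isSemistable_quot (Fin.last _)).1
    have hQ' : IsVectorBundle (cokernel (g ≫ kernel.ι π)) := hQ.of_iso e'.symm
    have h1 : rank (cokernel (f ≫ g ≫ kernel.ι π)) = _ := rank_add hT hG hQ'
    have h2 : degree (cokernel (f ≫ g ≫ kernel.ι π)) = _ := degree_add hT hG hQ'
    have h3 : rank (cokernel (g ≫ kernel.ι π)) = rank Q := rank_eq_of_iso hQ e'.symm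
    have h4 : degree (cokernel (g ≫ kernel.ι π)) = degree Q := degree_eq_of_iso hQ e'.symm
    have hrG := H.rank_quot_pos (Fin.last _)
    have h1' : rank (cokernel (f ≫ g ≫ kernel.ι π)) = rank (H.quot (Fin.last _)) + rank Q := by
      rw [h1]; exact congr_arg _ h3
    have h2' : degree (cokernel (f ≫ g ≫ kernel.ι π)) =
        degree (H.quot (Fin.last _)) + degree Q := by
      rw [h2]; exact congr_arg _ h4
    obtain ⟨h5, h6⟩ := hmin _ (cokernel.π (f ≫ g ≫ kernel.ι π)) inferInstance
      (.extension hT hG hQ') (by omega)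
    have h7 := lt_of_le_of_ne h5 fun h => by have := h6 h.symm; omega
    have hrG' : (0 : ℝ) < rank (H.quot (Fin.last _)) := by exact_mod_cast hrG
    have hr' : (0 : ℝ) < rank Q := by exact_mod_cast hr
    change slope Q < slope (H.quot (Fin.last _))
    rw [slope, slope] at h7 ⊢
    rw [h1', h2'] at h7
    push_cast at h7
    rw [div_lt_div_iff₀ (by positivity) (by positivity)] at h7 ⊢
    nlinarith

end Existence

/-! ### Extension-closed subcategories of abelian categories -/

section ExtensionClosed

universe v' w'

variable {A : Type v} [Category.{w} A] [Preadditive A] {𝒜 : Type v'} [Category.{w'} 𝒜] [Abelian 𝒜]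
  (F : A ⥤ 𝒜) [F.Additive] [F.Full] [F.Faithful]

/-- The sequences of `A` which become short exact in the abelian category `𝒜`. -/
def shortExactIn : ObjectProperty (ShortComplex A) := fun S => (S.map F).ShortExact

variable {F}

lemma admissibleEpi_iff {M N : A} {p : M ⟶ N} : AdmissibleEpi (shortExactIn F) p ↔
    Epi (F.map p) ∧ F.essImage (kernel (F.map p)) := by
  constructor
  · rintro ⟨K, i, w, h⟩
    exact ⟨h.epi_g, K, ⟨h.fIsKernel.conePointUniqueUpToIso (limit.isLimit _)⟩⟩
  · rintro ⟨h, K, ⟨e⟩⟩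
    have w : F.preimage (e.hom ≫ kernel.ι (F.map p)) ≫ p = 0 := F.map_injective (by simp)
    let S := ShortComplex.mk _ p w
    have e' : .mk _ _ (kernel.condition (F.map p)) ≅ S.map F :=
      ShortComplex.isoMk e.symm (Iso.refl _) (Iso.refl _)
        (by change e.inv ≫ F.map _ = kernel.ι (F.map p) ≫ 𝟙 (F.obj M); simp [S])
        (by change 𝟙 (F.obj M) ≫ F.map p = F.map p ≫ 𝟙 (F.obj N); simp)
    exact ⟨K, _, w, ShortComplex.shortExact_of_iso e' (shortExact_kernel (F.map p))⟩

lemma admissibleMono_iff {M N : A} {i : M ⟶ N} : AdmissibleMono (shortExactIn F) i ↔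
    Mono (F.map i) ∧ F.essImage (cokernel (F.map i)) := by
  constructor
  · rintro ⟨Q, p, w, h⟩
    exact ⟨h.mono_f, Q, ⟨h.gIsCokernel.coconePointUniqueUpToIso (colimit.isColimit _)⟩⟩
  · rintro ⟨h, Q, ⟨e⟩⟩
    have w : i ≫ F.preimage (cokernel.π (F.map i) ≫ e.inv) = 0 := F.map_injective (by simp)
    let S := ShortComplex.mk i _ w
    have e' : .mk _ _ (cokernel.condition (F.map i)) ≅ S.map F :=
      ShortComplex.isoMk (Iso.refl _) (Iso.refl _) e.symm
        (by change 𝟙 (F.obj M) ≫ F.map i = F.map i ≫ 𝟙 (F.obj N); simp)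
        (by change 𝟙 (F.obj N) ≫ F.map _ = cokernel.π (F.map i) ≫ e.inv; simp [S])
    exact ⟨Q, _, w, ShortComplex.shortExact_of_iso e' (shortExact_cokernel (F.map i))⟩

/-- If a morphism `q` of `A` has a kernel in `A`, and if its kernel in `𝒜` is a retract of an object
of `A`, then the latter kernel belongs to `A`. -/
lemma essImage_kernel_of_retract {M N P : A} (q : M ⟶ N) [HasKernel q]
    (h : Retract (kernel (F.map q)) (F.obj P)) : F.essImage (kernel (F.map q)) := by
  let a : F.obj (kernel q) ⟶ kernel (F.map q) := kernel.lift _ (F.map (kernel.ι q)) (by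
    rw [← F.map_comp, kernel.condition, F.map_zero])
  let l : P ⟶ kernel q := kernel.lift q (F.preimage (h.r ≫ kernel.ι (F.map q)))
    (F.map_injective (by simp))
  have hl : F.map l ≫ F.map (kernel.ι q) = h.r ≫ kernel.ι (F.map q) := by
    rw [← F.map_comp, kernel.lift_ι, F.map_preimage]
  have h₁ : (h.i ≫ F.map l) ≫ a = 𝟙 _ := by
    rw [← cancel_mono (kernel.ι (F.map q)), Category.assoc, Category.assoc, kernel.lift_ι, hl,
      h.retract_assoc, Category.id_comp]
  have h₂ : a ≫ h.i ≫ F.map l = 𝟙 _ := by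
    obtain ⟨t, ht⟩ := F.map_surjective (a ≫ h.i ≫ F.map l)
    have : t = 𝟙 _ := by
      rw [← cancel_mono (kernel.ι q)]
      apply F.map_injective
      rw [F.map_comp, ht, Category.assoc, Category.assoc, hl, h.retract_assoc, kernel.lift_ι,
        Category.id_comp]
    rw [← ht, this, F.map_id]
  exact ⟨_, ⟨⟨a, h.i ≫ F.map l, h₂, h₁⟩⟩⟩

lemma essImage_cokernel_of_retract {M N P : A} (q : M ⟶ N) [HasCokernel q]
    (h : Retract (cokernel (F.map q)) (F.obj P)) : F.essImage (cokernel (F.map q)) := by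
  let a : cokernel (F.map q) ⟶ F.obj (cokernel q) := cokernel.desc _ (F.map (cokernel.π q)) (by
    rw [← F.map_comp, cokernel.condition, F.map_zero])
  let l : cokernel q ⟶ P := cokernel.desc q (F.preimage (cokernel.π (F.map q) ≫ h.i))
    (F.map_injective (by simp))
  have hl : F.map (cokernel.π q) ≫ F.map l = cokernel.π (F.map q) ≫ h.i := by
    rw [← F.map_comp, cokernel.π_desc, F.map_preimage]
  have h₁ : a ≫ F.map l ≫ h.r = 𝟙 _ := by
    rw [← cancel_epi (cokernel.π (F.map q)), cokernel.π_desc_assoc, reassoc_of% hl, h.retract]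
  have h₂ : (F.map l ≫ h.r) ≫ a = 𝟙 _ := by
    obtain ⟨t, ht⟩ := F.map_surjective ((F.map l ≫ h.r) ≫ a)
    have : t = 𝟙 _ := by
      rw [← cancel_epi (cokernel.π q)]
      apply F.map_injective
      rw [F.map_comp, ht, Category.assoc, reassoc_of% hl, h.retract_assoc, cokernel.π_desc,
        Category.comp_id]
    rw [← ht, this, F.map_id]
  exact ⟨_, ⟨⟨F.map l ≫ h.r, a, h₂, h₁⟩⟩⟩

variable [F.essImage.IsClosedUnderExtensions]

lemma hasFiniteBiproducts_of_extensionClosed [F.essImage.ContainsZero] :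
    HasFiniteBiproducts A := by
  have : HasZeroObject A := by
    obtain ⟨Z, hZ, Y, ⟨e⟩⟩ := ObjectProperty.ContainsZero.exists_zero (P := F.essImage)
    refine ⟨Y, (IsZero.iff_id_eq_zero Y).mpr (F.map_injective ?_)⟩
    exact (hZ.of_iso e).eq_of_src _ _
  have : HasBinaryBiproducts A := ⟨fun X Y => by
    obtain ⟨B, ⟨e⟩⟩ : F.essImage (F.obj X ⊞ F.obj Y) :=
      F.essImage.prop_X₂_of_shortExact (ShortComplex.Splitting.ofHasBinaryBiproduct _ _).shortExact
        (F.obj_mem_essImage X) (F.obj_mem_essImage Y)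
    refine hasBinaryBiproduct_of_total
      { pt := B
        fst := F.preimage (e.hom ≫ biprod.fst)
        snd := F.preimage (e.hom ≫ biprod.snd)
        inl := F.preimage (biprod.inl ≫ e.inv)
        inr := F.preimage (biprod.inr ≫ e.inv)
        inl_fst := F.map_injective (by simp)
        inl_snd := F.map_injective (by simp)
        inr_fst := F.map_injective (by simp)
        inr_snd := F.map_injective (by simp) } (F.map_injective ?_)
    simp only [F.map_add, F.map_comp, F.map_preimage, F.map_id, Category.assoc]
    rw [← Preadditive.comp_add, ← Category.assoc biprod.fst, ← Category.assoc biprod.snd,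
      ← Preadditive.add_comp, biprod.total, Category.id_comp, e.hom_inv_id]⟩
  have : HasFiniteProducts A := hasFiniteProducts_of_has_binary_and_terminal
  exact .of_hasFiniteProducts

/-- A full subcategory of an abelian category which contains a zero object and is closed under
extensions is an exact category. -/
theorem isExactCategory_shortExactIn [F.essImage.ContainsZero] :
    IsExactCategory (shortExactIn F) where
  hasFiniteBiproducts := hasFiniteBiproducts_of_extensionClosed (F := F)
  of_iso e h := ShortComplex.shortExact_of_iso (F.mapShortComplex.mapIso e) h
  of_splitting S := fun ⟨s⟩ => (s.map F).shortExact
  isKernel S h := by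
    replace h : (S.map F).ShortExact := h
    have := h.mono_f
    have : Mono S.f := F.mono_of_mono_map this
    refine ⟨KernelFork.IsLimit.ofι' _ _ fun {K} k hk => ?_⟩
    have hk' : F.map k ≫ (S.map F).g = 0 :=
      (F.map_comp _ _).symm.trans (by rw [hk, F.map_zero]; rfl)
    have hl : F.map (F.preimage (h.exact.lift (F.map k) hk')) ≫ (S.map F).f = F.map k :=
      (congr_arg (· ≫ (S.map F).f) (F.map_preimage _)).trans (h.exact.lift_f _ _)
    exact ⟨F.preimage (h.exact.lift (F.map k) hk'), F.map_injective ((F.map_comp _ _).trans hl)⟩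
  isCokernel S h := by
    replace h : (S.map F).ShortExact := h
    have := h.epi_g
    have : Epi S.g := F.epi_of_epi_map this
    refine ⟨CokernelCofork.IsColimit.ofπ' _ _ fun {K} k hk => ?_⟩
    have hk' : (S.map F).f ≫ F.map k = 0 :=
      (F.map_comp _ _).symm.trans (by rw [hk, F.map_zero]; rfl)
    have hl : (S.map F).g ≫ F.map (F.preimage (h.exact.desc (F.map k) hk')) = F.map k :=
      (congr_arg ((S.map F).g ≫ ·) (F.map_preimage _)).trans (h.exact.g_desc _ _)
    exact ⟨F.preimage (h.exact.desc (F.map k) hk'), F.map_injective ((F.map_comp _ _).trans hl)⟩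
  epi_comp p q hp hq := by
    rw [admissibleEpi_iff] at *
    have := hp.1
    have := hq.1
    obtain ⟨i, j, w, h⟩ := exists_shortExact_kernel_comp (F.map p) (F.map q)
    rw [F.map_comp]
    exact ⟨inferInstance, F.essImage.prop_X₂_of_shortExact h hp.2 hq.2⟩
  mono_comp i j hi hj := by
    rw [admissibleMono_iff] at *
    have := hi.1
    have := hj.1
    obtain ⟨i', j', w, h⟩ := exists_shortExact_cokernel_comp (F.map i) (F.map j)
    rw [F.map_comp]
    exact ⟨inferInstance, F.essImage.prop_X₂_of_shortExact h hi.2 hj.2⟩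
  epi_baseChange {M M'' N} p f hp := by
    rw [admissibleEpi_iff] at hp
    have := hp.1
    have hk := isIso_kernel_map_of_isPullback (IsPullback.of_hasPullback (F.map p) (F.map f)).flip
    have hk' : F.essImage (kernel (pullback.snd (F.map p) (F.map f))) :=
      F.essImage.prop_of_iso (@asIso _ _ _ _ _ hk).symm hp.2
    obtain ⟨P, ⟨e⟩⟩ : F.essImage (pullback (F.map p) (F.map f)) := F.essImage.prop_X₂_of_shortExact
      (shortExact_kernel (pullback.snd (F.map p) (F.map f))) hk' (F.obj_mem_essImage N)
    have w : F.preimage (e.hom ≫ pullback.fst _ _) ≫ p =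
        F.preimage (e.hom ≫ pullback.snd _ _) ≫ f :=
      F.map_injective (by simp [pullback.condition])
    refine ⟨P, F.preimage (e.hom ≫ pullback.fst _ _), F.preimage (e.hom ≫ pullback.snd _ _),
      .of_map F w (.of_iso_pullback ⟨by rw [← F.map_comp, w, F.map_comp]⟩ e (by simp) (by simp)),
      admissibleEpi_iff.mpr ?_⟩
    rw [F.map_preimage]
    exact ⟨inferInstance, F.essImage.prop_of_iso (kernelIsIsoComp e.hom _).symm hk'⟩
  mono_cobaseChange {M' M N} i f hi := by
    rw [admissibleMono_iff] at hi
    have := hi.1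
    have hk := isIso_cokernel_map_of_isPushout (IsPushout.of_hasPushout (F.map i) (F.map f))
    have hk' : F.essImage (cokernel (pushout.inr (F.map i) (F.map f))) :=
      F.essImage.prop_of_iso (@asIso _ _ _ _ _ hk) hi.2
    obtain ⟨P, ⟨e⟩⟩ : F.essImage (pushout (F.map i) (F.map f)) := F.essImage.prop_X₂_of_shortExact
      (shortExact_cokernel (pushout.inr (F.map i) (F.map f))) (F.obj_mem_essImage N) hk'
    have w : i ≫ F.preimage (pushout.inl _ _ ≫ e.inv) =
        f ≫ F.preimage (pushout.inr _ _ ≫ e.inv) :=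
      F.map_injective (by simp [pushout.condition_assoc])
    refine ⟨P, F.preimage (pushout.inl _ _ ≫ e.inv), F.preimage (pushout.inr _ _ ≫ e.inv),
      .of_map F w (.of_iso_pushout ⟨by rw [← F.map_comp, w, F.map_comp]⟩ e (by simp) (by simp)),
      admissibleMono_iff.mpr ?_⟩
    rw [F.map_preimage]
    exact ⟨inferInstance, F.essImage.prop_of_iso (cokernelCompIsIso _ e.inv).symm hk'⟩
  epi_of_comp {L M N} p q hq hpq := by
    rw [admissibleEpi_iff, F.map_comp] at *
    have := hpq.1
    have := epi_of_epi (F.map p) (F.map q)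
    -- the pullback of `p ≫ q` and `q` is an extension in `A`, and it retracts onto the kernel of `q`
    have hk := isIso_kernel_map_of_isPullback
      (IsPullback.of_hasPullback (F.map p ≫ F.map q) (F.map q)).flip
    obtain ⟨P, ⟨e⟩⟩ : F.essImage (pullback (F.map p ≫ F.map q) (F.map q)) :=
      F.essImage.prop_X₂_of_shortExact
        (shortExact_kernel (pullback.snd (F.map p ≫ F.map q) (F.map q)))
      (F.essImage.prop_of_iso (@asIso _ _ _ _ _ hk).symm hpq.2) (F.obj_mem_essImage M)
    obtain ⟨l, hl₁, hl₂⟩ : ∃ l : kernel (F.map q) ⟶ pullback (F.map p ≫ F.map q) (F.map q),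
        l ≫ pullback.fst _ _ = 0 ∧ l ≫ pullback.snd _ _ = kernel.ι (F.map q) :=
      ⟨pullback.lift 0 (kernel.ι _) (by simp), pullback.lift_fst _ _ _, pullback.lift_snd _ _ _⟩
    refine ⟨this, essImage_kernel_of_retract q (P := P)
      { i := l ≫ e.inv
        r := e.hom ≫ kernel.lift _ (pullback.snd _ _ - pullback.fst _ _ ≫ F.map p)
          (by simp [← pullback.condition])
        retract := by
          rw [← cancel_mono (kernel.ι (F.map q))]
          simp [hl₂, reassoc_of% hl₁] }⟩
  mono_of_comp {L M N} i j hi hij := by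
    rw [admissibleMono_iff, F.map_comp] at *
    have := hij.1
    have := mono_of_mono (F.map i) (F.map j)
    have hk := isIso_cokernel_map_of_isPushout
      (IsPushout.of_hasPushout (F.map i ≫ F.map j) (F.map i))
    obtain ⟨P, ⟨e⟩⟩ : F.essImage (pushout (F.map i ≫ F.map j) (F.map i)) :=
      F.essImage.prop_X₂_of_shortExact
        (shortExact_cokernel (pushout.inr (F.map i ≫ F.map j) (F.map i)))
        (F.obj_mem_essImage M)
      (F.essImage.prop_of_iso (@asIso _ _ _ _ _ hk) hij.2)
    obtain ⟨l, hl₁, hl₂⟩ : ∃ l : pushout (F.map i ≫ F.map j) (F.map i) ⟶ cokernel (F.map i),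
        pushout.inl _ _ ≫ l = 0 ∧ pushout.inr _ _ ≫ l = cokernel.π (F.map i) :=
      ⟨pushout.desc 0 (cokernel.π _) (by simp), pushout.inl_desc _ _ _, pushout.inr_desc _ _ _⟩
    refine ⟨this, essImage_cokernel_of_retract i (P := P)
      { i := cokernel.desc _ (pushout.inr _ _ - F.map j ≫ pushout.inl _ _)
          (by simp [← pushout.condition]) ≫ e.inv
        r := e.hom ≫ l
        retract := by
          rw [← cancel_epi (cokernel.π (F.map i))]
          simp [hl₁, hl₂] }⟩

end ExtensionClosed

/-! ### The category 𝒫(I) -/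

section SlopesIn

variable {k : Type u} [Field k] [IsAlgClosed k] {C : SmoothProjectiveCurve k} {E : C.X.Modules}
  {I : Set ℝ}

/-- For a set `I` of slopes without gaps, membership of a non-zero bundle in `𝒫(I)` is a condition
on the degrees of all its subobjects and quotients. -/
lemma exists_hnFiltration_iff (hI : I.OrdConnected) (hE : IsVectorBundle E) (hz : ¬ IsZero E) :
    (∃ H : HNFiltration E, H.muMax ∈ I ∧ H.muMin ∈ I) ↔
      ∃ a ∈ I, ∃ b ∈ I, QuotDegreeGE a E ∧ SubDegreeLE b E := by
  constructor
  · rintro ⟨H, h₁, h₂⟩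
    exact ⟨_, h₂, _, h₁, H.quotDegreeGE, H.subDegreeLE⟩
  · rintro ⟨a, ha, b, hb, h₁, h₂⟩
    obtain ⟨H⟩ := nonempty_hnFiltration hE hz
    have h₃ := H.le_muMin h₁
    have h₄ := H.muMax_le h₂
    exact ⟨H, hI.out ha hb ⟨h₃.trans H.muMin_le_muMax, h₄⟩,
      hI.out ha hb ⟨h₃, H.muMin_le_muMax.trans h₄⟩⟩

lemma slopesIn_iff (hI : I.OrdConnected) (E : VectorBundle C.X) : slopesIn C.X I E ↔
    IsZero E.obj ∨ ∃ a ∈ I, ∃ b ∈ I, QuotDegreeGE a E.obj ∧ SubDegreeLE b E.obj := by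
  by_cases hz : IsZero E.obj
  · simp [slopesIn, hz]
  · simp only [slopesIn, hz, false_or]
    exact exists_hnFiltration_iff hI E.property hz

lemma slopesIn_of_iso (hI : I.OrdConnected) {E F : VectorBundle C.X} (e : E.obj ≅ F.obj)
    (h : slopesIn C.X I E) : slopesIn C.X I F := by
  rw [slopesIn_iff hI] at h ⊢
  refine h.imp (fun h => h.of_iso e.symm) fun ⟨a, ha, b, hb, h₁, h₂⟩ => ?_
  exact ⟨a, ha, b, hb, h₁.of_iso E.property e, h₂.of_mono e.inv⟩

/-- `𝒫(I)` is closed under extensions: the smaller of the two lower bounds for the ends of a short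
exact sequence and the larger of the two upper bounds are bounds for its middle term. -/
lemma slopesIn_of_shortExact (hI : I.OrdConnected) {S : ShortComplex (VectorBundle C.X)}
    (hS : vectorBundleExact S) (h₁ : slopesIn C.X I S.X₁) (h₃ : slopesIn C.X I S.X₃) :
    slopesIn C.X I S.X₂ := by
  replace hS : (S.map (IsVectorBundle (X := C.X)).ι).ShortExact := hS
  by_cases hz₁ : IsZero S.X₁.obj
  · have := hS.epi_g
    have := hS.exact.mono_g (hz₁.eq_of_src _ _)
    have := isIso_of_mono_of_epi (S.map (IsVectorBundle (X := C.X)).ι).g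
    exact slopesIn_of_iso hI (asIso (S.map (IsVectorBundle (X := C.X)).ι).g).symm h₃
  by_cases hz₃ : IsZero S.X₃.obj
  · have := hS.mono_f
    have := hS.exact.epi_f (hz₃.eq_of_tgt _ _)
    have := isIso_of_mono_of_epi (S.map (IsVectorBundle (X := C.X)).ι).f
    exact slopesIn_of_iso hI (asIso (S.map (IsVectorBundle (X := C.X)).ι).f :) h₁
  rw [slopesIn_iff hI] at *
  obtain ⟨a, ha, b, hb, ha₁, hb₁⟩ := h₁.resolve_left hz₁
  obtain ⟨a', ha', b', hb', ha₃, hb₃⟩ := h₃.resolve_left hz₃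
  refine .inr ⟨min a a', ?_, max b b', ?_, ?_, ?_⟩
  · exact min_rec' (· ∈ I) ha ha'
  · exact max_rec' (· ∈ I) hb hb'
  · exact .extension hS S.X₁.property S.X₃.property (ha₁.anti S.X₁.property (min_le_left _ _))
      (ha₃.anti S.X₃.property (min_le_right _ _))
  · exact .extension hS S.X₃.property (hb₁.mono (le_max_left _ _)) (hb₃.mono (le_max_right _ _))

/-- The embedding of `𝒫(I)` in the abelian category of `𝒪_X`-modules. -/
noncomputable abbrev slopesInι (X : Scheme.{u}) [IsIntegral X] [IsLocallyNoetherian X]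
    (I : Set ℝ) : (slopesIn X I).FullSubcategory ⥤ X.Modules :=
  (slopesIn X I).ι ⋙ (IsVectorBundle (X := X)).ι

lemma essImage_slopesInι (hI : I.OrdConnected) (E : C.X.Modules) :
    (slopesInι C.X I).essImage E ↔ ∃ h : IsVectorBundle E, slopesIn C.X I ⟨E, h⟩ := by
  constructor
  · rintro ⟨E', ⟨e⟩⟩
    have h := E'.obj.property.of_iso e
    exact ⟨h, slopesIn_of_iso (F := ⟨E, h⟩) hI e E'.property⟩
  · rintro ⟨h, hE⟩
    exact ⟨⟨⟨E, h⟩, hE⟩, ⟨Iso.refl _⟩⟩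

lemma containsZero_essImage_slopesInι (hI : I.OrdConnected) :
    (slopesInι C.X I).essImage.ContainsZero where
  exists_zero := ⟨_, isZero_zero C.X.Modules,
    (essImage_slopesInι hI _).mpr ⟨.of_isZero (isZero_zero _), .inl (isZero_zero _)⟩⟩

lemma isClosedUnderExtensions_essImage_slopesInι (hI : I.OrdConnected) :
    (slopesInι C.X I).essImage.IsClosedUnderExtensions where
  prop_X₂_of_shortExact {S} hS h₁ h₃ := by
    rw [essImage_slopesInι hI] at *
    obtain ⟨h₁, h₁'⟩ := h₁
    obtain ⟨h₃, h₃'⟩ := h₃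
    have h₂ := IsVectorBundle.extension hS h₁ h₃
    let T : ShortComplex (VectorBundle C.X) :=
      { X₁ := ⟨S.X₁, h₁⟩
        X₂ := ⟨S.X₂, h₂⟩
        X₃ := ⟨S.X₃, h₃⟩
        f := ObjectProperty.homMk S.f
        g := ObjectProperty.homMk S.g
        zero := by ext1; exact S.zero }
    exact ⟨h₂, slopesIn_of_shortExact (S := T) hI hS h₁' h₃'⟩

end SlopesIn

end HNExact

theorem lemma2p1 {k : Type u} [Field k] [IsAlgClosed k] (C : HNExact.SmoothProjectiveCurve k)
    (I : Set ℝ) (hI : I.OrdConnected) :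
    (∀ S : ShortComplex (HNExact.VectorBundle C.X), HNExact.vectorBundleExact S →
      HNExact.slopesIn C.X I S.X₁ → HNExact.slopesIn C.X I S.X₃ →
      HNExact.slopesIn C.X I S.X₂) ∧
    HNExact.IsExactCategory (A := (HNExact.slopesIn C.X I).FullSubcategory)
      (fun S => HNExact.vectorBundleExact (S.map (HNExact.slopesIn C.X I).ι)) := by
  have := HNExact.containsZero_essImage_slopesInι (C := C) hI
  have := HNExact.isClosedUnderExtensions_essImage_slopesInι (C := C) hI
  exact ⟨fun S hS h₁ h₃ => HNExact.slopesIn_of_shortExact hI hS h₁ h₃,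
    HNExact.isExactCategory_shortExactIn (F := HNExact.slopesInι C.X I)⟩
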